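/- Let $K$ be an algebraically closed field of characteristic $0$, and let $U$ be a nonsingular affine surface over $K$ with local coordinates $x_1,x_2$ (that is, $dx_1,dx_2$ is a basis of the module of differentials) and a point $o$ at which $x_1=x_2=0$. *Monster tower.* Put $S(0)=U$ and $\mathcal B(0)=TU$. Let $S(k+1)=\mathbb P\mathcal B(k)$ with projection $\pi_{k+1}:S(k+1)\to S(k)$, and let $\mathcal B(k+1)\subset TS(k+1)$ be the focal bundle: a tangent vector at $(q,\ell)$ belongs to it if $d\pi_{k+1}$ maps it into the line $\ell\subset\mathcal B(k)_q$. If $Z\subset S(k)$ is a nonsingular subvariety for which $TZ\cap\mathcal B(k)$ has rank one, its prolongation is $\{(q,\ell): q\in Z,\ \ell\subset T_qZ\}\subset S(k+1)$. *Charts and nodes.* $S(k)$ is covered by charts $\mathcal C(p_1\cdots p_k)\cong U\times\mathbb A^k$, $p_i\in\{1,2\}$, each with two active coordinates $x_1(p_1\cdots p_k)$ and $x_2(p_1\cdots p_k)$. For $k=0$ the chart is $U$, with active coordinates $x_1,x_2$. Write $\overline 1=2$, $\overline 2=1$ and $w=p_1\cdots p_{k-1}$. The chart $\mathcal C(wp)$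 consists of the points $(q,\ell)$ with $q\in\mathcal C(w)$ and $dx_p(w)|_\ell\ne0$; its active coordinates are $x_p(wp)=x_p(w)$ and the new coordinate $x_{\overline p}(wp)=dx_{\overline p}(w)/dx_p(w)$. The node $N(p_1\cdots p_k)\in S(k)$ is the origin of $\mathcal C(p_1\cdots p_k)$: the point over $o$ at which the $k$ new coordinates vanish. *Twigs.* For $t\ne0$ let $X(k)_t\subset S(k)$ be the $k$-th prolongation of the curve $x_1x_2=t$. Let $\mathcal X(k)$ be the closure of $\bigcup_{t\neq0}X(k)_t\times\{t\}$ in $S(k)\times\mathbb A^1$, and let $X(k)_0$ be its fibre over $t=0$. The twigs at level $k$ are the irreducible components of $X(k)_0$. A twig at level $k$ which $\pi_k$ collapses to a node $N(p_1\cdots p_{k-1})$ is labelled $T(p_1\cdots p_{k-1})$; a twig which $\pi_k$ maps onto a labelled twig of level $k-1$ keeps the label of that twig. *Code words.* A code word of length $k$ is a word of $k$ symbols, each $R$ or some $V_j$, whose first symbol is $R$ and whose $j$-th symbol, for $j\ge2$, is $R$ or $V_j$ or equal to the preceding symbol. For $j\ge2$ let $I_j=I_j[0]\subset S(j)$ be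 the set of points $(q,\ell)$ with $\ell\subset\ker d\pi_{j-1}$, and let $I_j[n+1]\subset S(j+n+1)$ be the prolongation of $I_j[n]\subset S(j+n)$. For a code word $W$ of length $k$, let $I_W\subset S(k)$ be the intersection of the inverse images of the $I_j[n_j-1]$ over all $j$ with $n_j\ge1$, where $n_j$ is the number of symbols $V_j$ in $W$. Its codimension is $\sum_j n_j$. The stratum of $W$ is $I_W$ with all $I_{W'}$ of lower dimension removed, $W'$ being a code word of length $k$. **Theorem.** Let $0\le j\le k-1$ and $p_1,\dots,p_j\in\{1,2\}$. The node $N(p_1\cdots p_j)\in S(j)$ lies in the stratum of exactly one code word $W(p_1\cdots p_j)$, of length $j$. At level $k$ there is exactly one twig $T(p_1\cdots p_j)$. It has points which are not nodes, all of these lie in one stratum, and the code word of this stratum is $$W(p_1\cdots p_j)\;R\;\underbrace{V_{j+2}V_{j+2}\cdots V_{j+2}}_{k-1-j},$$ and no other code word has this property. -/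

import Mathlib

/-!
The monster (Semple) tower over a surface, in the classical language of points and regular functions
over an algebraically closed field `K`.

Words in the alphabet `{1, 2}` are lists over `Fin 2` (`0` stands for `1` and `1` for `2`), read from
right to left: the word `p₁ p₂ ⋯ pₖ` is the list `[pₖ, …, p₂, p₁]`, so that `a :: w` is the word `w`
followed by the letter `a`.
-/

universe u v

/-- The letter of `{1, 2}` opposite to `a`. -/
def opp (a : Fin 2) : Fin 2 := 1 - a

/-- A nonsingular variety over `K`, given by its points and an atlas of affine charts labelled by words,
together with two active coordinates on each chart and a subbundle of its tangent bundle.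
Functions on a chart are represented by total functions, whose values off the chart are immaterial.
Tangent vectors at a point are functionals on functions, see `Stage.tangent`.
This is only a container: the stages that occur are built in `level`. -/
structure Stage (K : Type u) [Field K] where
  /-- the points -/
  Pt : Type (max u v)
  /-- the domain of the chart with label `w` (empty if there is no such chart) -/
  dom : List (Fin 2) → Set Pt
  /-- the two active coordinates `x₁(w)`, `x₂(w)` of the chart `w` -/
  act : List (Fin 2) → Fin 2 → Pt → K
  /-- the coordinate ring of the chart `w` -/
  reg : List (Fin 2) → Subalgebra K (Pt → K)
  /-- the fibres of the focal bundle -/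
  foc : Pt → Submodule K ((Pt → K) → K)

namespace Stage

variable {K : Type u} [Field K]

/-- The function `h` is regular at `q`: near `q` it is a quotient of regular functions of a chart. -/
def RegularAt {P : Type v} (dom : List (Fin 2) → Set P) (reg : List (Fin 2) → Subalgebra K (P → K))
    (q : P) (h : P → K) : Prop :=
  ∃ w, q ∈ dom w ∧ ∃ f ∈ reg w, ∃ g ∈ reg w, g q ≠ 0 ∧
    ∀ z ∈ dom w, g z ≠ 0 → h z = f z / g z

/-- The tangent space at `q`: the point derivations at `q` on the functions regular at `q`
(extended by zero to the functions which are not regular at `q`). -/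
def tangent {P : Type v} (dom : List (Fin 2) → Set P) (reg : List (Fin 2) → Subalgebra K (P → K))
    (q : P) : Submodule K ((P → K) → K) where
  carrier := {D | (∀ h, ¬ RegularAt dom reg q h → D h = 0) ∧
    (∀ c : K, D (fun _ => c) = 0) ∧
    (∀ h₁ h₂, RegularAt dom reg q h₁ → RegularAt dom reg q h₂ → D (h₁ + h₂) = D h₁ + D h₂) ∧
    (∀ h₁ h₂, RegularAt dom reg q h₁ → RegularAt dom reg q h₂ →
      D (h₁ * h₂) = h₁ q * D h₂ + h₂ q * D h₁)}
  zero_mem' := by simp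
  add_mem' := by
    rintro a b ⟨ha₀, ha₁, ha₂, ha₃⟩ ⟨hb₀, hb₁, hb₂, hb₃⟩
    refine ⟨fun h hh => ?_, fun c => ?_, fun h₁ h₂ r₁ r₂ => ?_, fun h₁ h₂ r₁ r₂ => ?_⟩
    · simp [ha₀ h hh, hb₀ h hh]
    · simp [ha₁ c, hb₁ c]
    · simp only [Pi.add_apply, ha₂ h₁ h₂ r₁ r₂, hb₂ h₁ h₂ r₁ r₂]; ring
    · simp only [Pi.add_apply, ha₃ h₁ h₂ r₁ r₂, hb₃ h₁ h₂ r₁ r₂]; ring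
  smul_mem' := by
    rintro c a ⟨ha₀, ha₁, ha₂, ha₃⟩
    refine ⟨fun h hh => ?_, fun e => ?_, fun h₁ h₂ r₁ r₂ => ?_, fun h₁ h₂ r₁ r₂ => ?_⟩
    · simp [ha₀ h hh]
    · simp [ha₁ e]
    · simp only [Pi.smul_apply, smul_eq_mul, ha₂ h₁ h₂ r₁ r₂]; ring
    · simp only [Pi.smul_apply, smul_eq_mul, ha₃ h₁ h₂ r₁ r₂]; ring

/-- `h` is regular at the point `q` of `X`. -/
abbrev Reg (X : Stage.{u, v} K) (q : X.Pt) (h : X.Pt → K) : Prop := RegularAt X.dom X.reg q h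

/-- The tangent space of `X` at `q`. -/
abbrev T (X : Stage.{u, v} K) (q : X.Pt) : Submodule K ((X.Pt → K) → K) := tangent X.dom X.reg q

/-- The points of the projectivized focal bundle: pairs of a point `q` and a line in the fibre of the
focal bundle at `q`. -/
structure Dir (X : Stage.{u, v} K) where
  /-- the point of `X` over which the direction lies -/
  pt : X.Pt
  /-- the line -/
  line : Projectivization K (X.foc pt)

/-- A nonzero vector spanning the line represented by `p`. -/
noncomputable def Dir.vec {X : Stage.{u, v} K} (p : X.Dir) : (X.Pt → K) → K := p.line.rep.1

/-- Charts of the projectivized bundle: the chart `a :: w` consists of the lines on which the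
differential of `x_a(w)` does not vanish. -/
def dirDom (X : Stage.{u, v} K) : List (Fin 2) → Set X.Dir
  | [] => ∅
  | a :: w => {p | p.pt ∈ X.dom w ∧ p.vec (X.act w a) ≠ 0}

/-- In the chart `a :: w`, with `b` the letter opposite to `a`, the retained active coordinate is
`x_a(w)` and the new active coordinate is `d x_b(w) / d x_a(w)`. -/
noncomputable def dirAct (X : Stage.{u, v} K) : List (Fin 2) → Fin 2 → X.Dir → K
  | [] => fun _ _ => 0
  | a :: w => fun i p => if i = a then X.act w a p.pt else p.vec (X.act w i) / p.vec (X.act w a)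

/-- The coordinate ring of the chart `a :: w` is generated by that of the chart `w` and the new
coordinate. -/
noncomputable def dirReg (X : Stage.{u, v} K) : List (Fin 2) → Subalgebra K (X.Dir → K)
  | [] => ⊥
  | a :: w => Algebra.adjoin K
      ({h | ∃ f ∈ X.reg w, h = fun p => f p.pt} ∪ {X.dirAct (a :: w) (opp a)})

/-- The focal vectors at `p`: the tangent vectors which the derivative of the projection maps into the
line represented by `p`. -/
noncomputable def dirFoc (X : Stage.{u, v} K) (p : X.Dir) : Submodule K ((X.Dir → K) → K) where
  carrier := {D | D ∈ tangent X.dirDom X.dirReg p ∧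
    ∃ c : K, ∀ h, X.Reg p.pt h → D (fun z => h z.pt) = c * p.vec h}
  zero_mem' := ⟨Submodule.zero_mem _, 0, by simp⟩
  add_mem' := by
    rintro a b ⟨ha, c, hc⟩ ⟨hb, e, he⟩
    exact ⟨Submodule.add_mem _ ha hb, c + e, fun h hh => by
      simp only [Pi.add_apply, hc h hh, he h hh]; ring⟩
  smul_mem' := by
    rintro r a ⟨ha, c, hc⟩
    exact ⟨Submodule.smul_mem _ r ha, r * c, fun h hh => by
      simp only [Pi.smul_apply, smul_eq_mul, hc h hh]; ring⟩

/-- The projectivization of the focal bundle of `X`, with its own focal bundle. -/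
noncomputable def next (X : Stage.{u, v} K) : Stage.{u, v} K where
  Pt := X.Dir
  dom := X.dirDom
  act := X.dirAct
  reg := X.dirReg
  foc := X.dirFoc

/-- The Zariski topology: it has the basic open sets of the affine charts as a basis. -/
instance zariski (X : Stage.{u, v} K) : TopologicalSpace X.Pt :=
  TopologicalSpace.generateFrom {V | ∃ w, ∃ f ∈ X.reg w, V = {q | q ∈ X.dom w ∧ f q ≠ 0}}

/-- The Zariski topology of the product of `X` and the affine line. -/
abbrev zariskiLine (X : Stage.{u, v} K) : TopologicalSpace (X.Pt × K) :=
  TopologicalSpace.generateFrom {V | ∃ w, ∃ F : Polynomial (X.reg w), V = {z | z.1 ∈ X.dom w ∧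
    F.eval₂ ((Pi.evalRingHom (fun _ : X.Pt => K) z.1).comp (X.reg w).val.toRingHom) z.2 ≠ 0}}

/-- The prolongation of a nonsingular subvariety `Z` of `X`: the focal directions tangent to `Z`, a
tangent vector at `q` being tangent to `Z` if it annihilates the functions which are regular at `q` and
vanish on `Z`. -/
def prolong (X : Stage.{u, v} K) (Z : Set X.Pt) : Set X.next.Pt :=
  {p : X.Dir | p.pt ∈ Z ∧ ∀ h, X.Reg p.pt h → (∀ z ∈ Z, h z = 0) → p.vec h = 0}

end Stage

section Tower

variable {K : Type u} [Field K] {A : Type v} [CommRing A] [Algebra K A]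

/-- The affine surface `U` with coordinate ring `A` and local coordinates `x 0`, `x 1`; its only
chart has the empty word as its label, and its focal bundle is the whole tangent bundle. -/
noncomputable def baseStage (x : Fin 2 → A) : Stage.{u, v} K where
  Pt := A →ₐ[K] K
  dom w := {_q | w = []}
  act _ i q := q (x i)
  reg _ := (AlgHom.pi fun q : A →ₐ[K] K => q).range
  foc q := Stage.tangent (fun w => {_q | w = []})
    (fun _ => (AlgHom.pi fun q : A →ₐ[K] K => q).range) q

/-- The monster space at level `k` over `U`. -/
noncomputable def level (K : Type u) [Field K] {A : Type v} [CommRing A] [Algebra K A]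
    (x : Fin 2 → A) : ℕ → Stage.{u, v} K
  | 0 => baseStage x
  | k + 1 => (level K x k).next

/-- The points of the monster space at level `k`. -/
abbrev S (K : Type u) [Field K] {A : Type v} [CommRing A] [Algebra K A] (x : Fin 2 → A) (k : ℕ) :
    Type (max u v) := (level K x k).Pt

/-- The projection from level `k + 1` to level `k`. -/
def proj (x : Fin 2 → A) {k : ℕ} (p : S K x (k + 1)) : S K x k := Stage.Dir.pt p

/-- The point `p` lies over the point `q` (of the same or a lower level). -/
inductive LiesOver (x : Fin 2 → A) : ∀ {k m : ℕ}, S K x k → S K x m → Prop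
  | refl {k : ℕ} (p : S K x k) : LiesOver x p p
  | step {k m : ℕ} (p : S K x (k + 1)) (q : S K x m) : LiesOver x (proj x p) q → LiesOver x p q

/-- The node `N(w)` at level `k`, as a one-point set: the origin of the chart `w`, that is, the point of
the chart lying over the base point `o` at which all the coordinates introduced at the levels
`1, …, k` vanish. It is empty if `w` does not have length `k`. -/
def node (x : Fin 2 → A) (o : A →ₐ[K] K) : (k : ℕ) → List (Fin 2) → Set (S K x k)
  | 0, [] => {o}
  | 0, _ :: _ => ∅
  | _ + 1, [] => ∅
  | k + 1, a :: w => {p | proj x p ∈ node x o k w ∧ p ∈ (level K x (k + 1)).dom (a :: w) ∧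
      (level K x (k + 1)).act (a :: w) (opp a) p = 0}

/-- The `k`-th prolongation of the curve `x₁ x₂ = t`, for `t ≠ 0`. -/
def curve (x : Fin 2 → A) (t : K) : (k : ℕ) → Set (S K x k)
  | 0 => {q : A →ₐ[K] K | q (x 0) * q (x 1) = t}
  | k + 1 => (level K x k).prolong (curve x t k)

/-- The total space of the family of `k`-th prolongations, inside the product of the monster space and
the line: the closure of the family over the punctured line. -/
def family (K : Type u) [Field K] {A : Type v} [CommRing A] [Algebra K A] (x : Fin 2 → A) (k : ℕ) :
    Set (S K x k × K) :=
  @closure _ (level K x k).zariskiLine {z | z.2 ≠ 0 ∧ z.1 ∈ curve x z.2 k}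

/-- The `k`-th prolongation of the nodal curve: the central member of the family. -/
def nodalProlongation (K : Type u) [Field K] {A : Type v} [CommRing A] [Algebra K A]
    (x : Fin 2 → A) (k : ℕ) : Set (S K x k) :=
  {p | (p, (0 : K)) ∈ family K x k}

/-- The twigs at level `k` are the irreducible components of the `k`-th prolongation of the nodal
curve. -/
def IsTwig (x : Fin 2 → A) (k : ℕ) (Z : Set (S K x k)) : Prop :=
  Maximal (fun Y => Y ⊆ nodalProlongation K x k ∧ IsIrreducible Y) Z

/-- `Z` is the twig `T(w)` at level `k`. A twig which is collapsed to a node of the previous level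
is labelled by this node; a twig which is mapped onto a twig of the previous level keeps the label of the
latter. -/
inductive IsTwigWithLabel (x : Fin 2 → A) (o : A →ₐ[K] K) :
    ∀ k : ℕ, Set (S K x k) → List (Fin 2) → Prop
  | emergent {k : ℕ} (Z : Set (S K x (k + 1))) (w : List (Fin 2)) :
      IsTwig x (k + 1) Z → proj x '' Z = node x o k w → IsTwigWithLabel x o (k + 1) Z w
  | retained {k : ℕ} (Z : Set (S K x (k + 1))) (w : List (Fin 2)) :
      IsTwig x (k + 1) Z → IsTwigWithLabel x o k (proj x '' Z) w →
      IsTwigWithLabel x o (k + 1) Z w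

/-- The divisor at infinity `I_j` at level `j = i + 2`: the points which represent vertical
directions, namely those killed by the derivative of the projection from level `i + 1` to level `i`. -/
def divisorAtInfinity (K : Type u) [Field K] {A : Type v} [CommRing A] [Algebra K A]
    (x : Fin 2 → A) (i : ℕ) : Set (S K x (i + 2)) :=
  {p | ∀ h, (level K x i).Reg (proj x (proj x p)) h →
    Stage.Dir.vec (X := level K x (i + 1)) p (fun z => h (proj x z)) = 0}

/-- The `n`-fold prolongation `I_j[n]` of the divisor at infinity, where `j = i + 2`, at level
`j + n`. -/
def prolongedDivisor (K : Type u) [Field K] {A : Type v} [CommRing A] [Algebra K A]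
    (x : Fin 2 → A) (i : ℕ) : (n : ℕ) → Set (S K x (i + 2 + n))
  | 0 => divisorAtInfinity K x i
  | n + 1 => (level K x (i + 2 + n)).prolong (prolongedDivisor K x i n)

/-- Code words, read from left to right; `none` is the symbol `R` and `some j` is the symbol `V_j`. The
first symbol is `R`, and for `j ≥ 2` the symbol in position `j` is `R` or `V_j` or the preceding
symbol. -/
def IsCodeWord (W : List (Option ℕ)) : Prop :=
  (∀ a, W[0]? = some a → a = none) ∧
  ∀ i a b, W[i]? = some a → W[i + 1]? = some b → b = none ∨ b = some (i + 2) ∨ b = a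

/-- The intersection locus of the code word `W` at level `k`: the intersection of the inverse images of
the `I_j[n - 1]`, where `j = i + 2` runs through the subscripts of `W` and `n` is the number of
occurrences of `V_j`. -/
def intersectionLocus (x : Fin 2 → A) (k : ℕ) (W : List (Option ℕ)) : Set (S K x k) :=
  {p | ∀ i n, W.count (some (i + 2)) = n + 1 → ∃ q ∈ prolongedDivisor K x i n, LiesOver x p q}

/-- The codimension of the intersection locus of `W`, namely the number of symbols other than `R`. -/
def codim (W : List (Option ℕ)) : ℕ := W.countP Option.isSome

/-- The point `p` at level `k` belongs to the stratum of the code word `W`: it belongs to the intersection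
locus of `W` and to none of the intersection loci of lower dimension. -/
def InStratum (x : Fin 2 → A) (k : ℕ) (W : List (Option ℕ)) (p : S K x k) : Prop :=
  W.length = k ∧ IsCodeWord W ∧ p ∈ intersectionLocus x k W ∧
  ∀ W', W'.length = k → IsCodeWord W' → codim W < codim W' → p ∉ intersectionLocus x k W'

/-- `W` is the code word of the stratum containing the node `N(w)` at level `k`. -/
def IsNodeWord (x : Fin 2 → A) (o : A →ₐ[K] K) (k : ℕ) (w : List (Fin 2))
    (W : List (Option ℕ)) : Prop :=
  ∃ p ∈ node x o k w, InStratum x k W p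

/-- `W` is the code word of the stratum containing the points of the twig `Z` at level `k` which are
not nodes. -/
def IsTwigWord (x : Fin 2 → A) (o : A →ₐ[K] K) (k : ℕ) (Z : Set (S K x k))
    (W : List (Option ℕ)) : Prop :=
  (∃ p ∈ Z, ∀ w, p ∉ node x o k w) ∧ ∀ p ∈ Z, (∀ w, p ∉ node x o k w) → InStratum x k W p

end Tower

/-! Along the prolonged hyperbolas, `x₁ x₂` is in every chart a constant times a monomial in the two
active coordinates. Logarithmic differentiation of this monomial, with `b` the letter opposite to
`a`, gives `e_a x_b + e_b x_a y = 0` for the new coordinate `y = dx_b / dx_a`. Eliminating `x_b`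
produces the exponents `e_a + e_b`, `e_b` of the next chart, which is the recursion of `expo`. These
relations cut out the `monomialLocus` of the chart. Its points are given by a point of `U` and
values of the active coordinates in which `x₁`, `x₂` are prescribed monomials. The prolonged curves
are the fibres `x₁ x₂ = t ≠ 0` in it (`curve_chart`). Since the points with `x₁ x₂ ≠ 0` are dense
(`exists_point_ne_zero`), the closure of the family is the graph of `x₁ x₂`, so the central member
is the locus `x₁ x₂ = 0` (`mem_nodalProlongation`), where an active coordinate vanishes.

In the chart `w a` the axis `x_a = 0` lies in the fibre over the node `N(w)`. Its tangent directions
kill `dx_a`, so its prolongations are again axes `x_a = 0`, in the charts `w a b`, `w a b b`, and so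
on. The axes for the two choices of `a` glue to the twig `T(w)` (`twigSet`). It is closed and its
proper relatively closed subsets are finite, so it is irreducible, and it is the only component with
its label (`isTwig_twigSet`, `eq_twigSet_of_isTwigWithLabel`).

The divisors at infinity have equations of the same shape: `I_{i+2}[n]` meets only charts `v a b ⋯
b` with `v` of length `i` and `n + 1` letters `b`, and lies in `x_a = 0` there
(`prolongedDivisor_chart`). Hence a point lies on at most one such prolongation of its own level.
Recording this divisor level by level gives the word `code` of the point, and `inStratum_iff` shows
that it is the only code word whose stratum contains the point. At a point of `T(w)` that is not a
node the coordinate `x_b` is nonzero, which forces the symbol `R` just after the code word of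
`N(w)`. At every later level the twig lies on a prolongation of `I_{j+2}`, where `j` is the length
of `w` (`code_of_mem_axis`). -/

lemma opp_opp (a : Fin 2) : opp (opp a) = a := by revert a; decide

lemma opp_ne (a : Fin 2) : opp a ≠ a := by revert a; decide

lemma ne_opp (a : Fin 2) : a ≠ opp a := (opp_ne a).symm

lemma eq_or_eq_opp (a b : Fin 2) : b = a ∨ b = opp a := by revert a b; decide

lemma forall_letter {P : Fin 2 → Prop} (a : Fin 2) : (∀ i, P i) ↔ P a ∧ P (opp a) :=
  ⟨fun h => ⟨h _, h _⟩, fun h i => by rcases eq_or_eq_opp a i with rfl | rfl; exacts [h.1, h.2]⟩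

lemma sum_letters {M : Type*} [AddCommMonoid M] (f : Fin 2 → M) (a : Fin 2) :
    ∑ i, f i = f a + f (opp a) := by
  rw [Fin.sum_univ_two]
  fin_cases a
  · rfl
  · exact add_comm _ _

/-! ### Atlases, regular functions and point derivations -/

namespace Stage

variable {K : Type u} [Field K]

/-- The properties of the stages of the monster tower: the charts form an atlas, and on each chart the
differentials of the active coordinates are coordinates on the fibres of the focal bundle. -/
structure Charted (X : Stage.{u, v} K) : Prop where
  cover : ∀ q, ∃ w, q ∈ X.dom w
  change : ∀ {w w' q}, q ∈ X.dom w → q ∈ X.dom w' → ∀ f ∈ X.reg w', ∃ f₁ ∈ X.reg w, ∃ g ∈ X.reg w,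
    g q ≠ 0 ∧ ∀ z ∈ X.dom w, g z ≠ 0 → z ∈ X.dom w' ∧ f z = f₁ z / g z
  act_mem : ∀ w i, X.act w i ∈ X.reg w
  foc_le : ∀ q, X.foc q ≤ X.T q
  partials : ∀ {w f}, f ∈ X.reg w → ∃ g : Fin 2 → X.Pt → K, (∀ i, g i ∈ X.reg w) ∧
    ∀ q ∈ X.dom w, ∀ D ∈ X.foc q, D f = ∑ i, g i q * D (X.act w i)
  exists_foc : ∀ {w q}, q ∈ X.dom w → ∀ α : Fin 2 → K, ∃ D ∈ X.foc q, ∀ i, D (X.act w i) = α i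

section Tangent

variable {P : Type v} {dom : List (Fin 2) → Set P} {reg : List (Fin 2) → Subalgebra K (P → K)}

lemma regularAt_of_mem {w : List (Fin 2)} {q : P} (hq : q ∈ dom w) {f : P → K} (hf : f ∈ reg w) :
    RegularAt dom reg q f :=
  ⟨w, hq, f, hf, 1, one_mem _, by simp, fun z _ _ => by simp⟩

variable {q : P} {D : (P → K) → K}

lemma tangent_add (hD : D ∈ tangent dom reg q) {f g : P → K} (hf : RegularAt dom reg q f)
    (hg : RegularAt dom reg q g) : D (f + g) = D f + D g := hD.2.2.1 f g hf hg

lemma tangent_mul (hD : D ∈ tangent dom reg q) {f g : P → K} (hf : RegularAt dom reg q f)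
    (hg : RegularAt dom reg q g) : D (f * g) = f q * D g + g q * D f := hD.2.2.2 f g hf hg

lemma tangent_const (hD : D ∈ tangent dom reg q) (c : K) : D (fun _ => c) = 0 := hD.2.1 c

lemma tangent_algebraMap (hD : D ∈ tangent dom reg q) (c : K) :
    D (algebraMap K (P → K) c) = 0 := hD.2.1 c

lemma tangent_zero (hD : D ∈ tangent dom reg q) : D 0 = 0 := hD.2.1 0

variable {w : List (Fin 2)}

/-- A tangent vector takes the same value on two regular functions which agree near the point. -/
lemma tangent_congr (hD : D ∈ tangent dom reg q) (hq : q ∈ dom w) {f h : P → K}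
    (hf : RegularAt dom reg q f) (hh : RegularAt dom reg q h) {g : P → K} (hg : g ∈ reg w)
    (hgq : g q ≠ 0) (hfh : ∀ z ∈ dom w, g z ≠ 0 → f z = h z) : D f = D h := by
  classical
  -- The indicator function of a basic open set is regular at its points, being `g / g` there.
  -- Multiplied by it, `f` and `h` become equal everywhere, and the product rule compares `D f` with
  -- `D h`.
  let e : P → K := fun z => if z ∈ dom w ∧ g z ≠ 0 then 1 else 0
  have he : RegularAt dom reg q e :=
    ⟨w, hq, g, hg, g, hg, hgq, fun z hz hgz => by simp [e, hz, hgz]⟩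
  have hef : e * f = e * h := by
    funext z
    by_cases hz : z ∈ dom w ∧ g z ≠ 0
    · simp [e, hz, hfh z hz.1 hz.2]
    · simp [e, hz]
  have heq : e q = 1 := by simp [e, hq, hgq]
  have h1 := tangent_mul hD he hf
  have h2 := tangent_mul hD he hh
  rw [hef, h2, heq, hfh q hq hgq] at h1
  linear_combination -h1

/-- Differentiation of a quotient. -/
lemma tangent_div (hD : D ∈ tangent dom reg q) (hq : q ∈ dom w) {f g h : P → K} (hf : f ∈ reg w)
    (hg : g ∈ reg w) (hgq : g q ≠ 0) (hh : ∀ z ∈ dom w, g z ≠ 0 → h z = f z / g z) :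
    D f = h q * D g + g q * D h := by
  have hr : RegularAt dom reg q h := ⟨w, hq, f, hf, g, hg, hgq, hh⟩
  rw [← tangent_mul hD hr (regularAt_of_mem hq hg)]
  refine tangent_congr hD hq (regularAt_of_mem hq hf) ?_ hg hgq fun z hz hgz => ?_
  · exact ⟨w, hq, f * g, mul_mem hf hg, g, hg, hgq, fun z hz hgz => by simp [hh z hz hgz, hgz]⟩
  · simp [hh z hz hgz, hgz]

/-- By the quotient rule a point derivation is determined by its values on numerators and
denominators, which may all be taken from one chart. -/
lemma tangent_ext_chart (hq : q ∈ dom w) {D' : (P → K) → K}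
    (hD : D ∈ tangent dom reg q) (hD' : D' ∈ tangent dom reg q)
    (hreg : ∀ h, RegularAt dom reg q h → ∃ f ∈ reg w, ∃ g ∈ reg w, g q ≠ 0 ∧
      ∀ z ∈ dom w, g z ≠ 0 → h z = f z / g z)
    (h : ∀ f ∈ reg w, D f = D' f) : D = D' := by
  funext k
  by_cases hk : RegularAt dom reg q k
  · obtain ⟨f, hf, g, hg, hgq, hz⟩ := hreg k hk
    have h1 := tangent_div hD hq hf hg hgq hz
    have h2 := tangent_div hD' hq hf hg hgq hz
    rw [h f hf, h g hg] at h1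
    exact mul_left_cancel₀ hgq (by linear_combination h2 - h1)
  · rw [hD.1 k hk, hD'.1 k hk]

lemma regularAt_chart_form (hq : q ∈ dom w)
    (change : ∀ {w'}, q ∈ dom w' → ∀ f ∈ reg w', ∃ f₁ ∈ reg w, ∃ g ∈ reg w,
      g q ≠ 0 ∧ ∀ z ∈ dom w, g z ≠ 0 → z ∈ dom w' ∧ f z = f₁ z / g z)
    (h : P → K) (hh : RegularAt dom reg q h) :
    ∃ f ∈ reg w, ∃ g ∈ reg w, g q ≠ 0 ∧ ∀ z ∈ dom w, g z ≠ 0 → h z = f z / g z := by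
  obtain ⟨w', hq', f, hf, g, hg, hgq, hz⟩ := hh
  obtain ⟨f₁, hf₁, f₂, hf₂, hf₂q, hf'⟩ := change hq' f hf
  obtain ⟨g₁, hg₁, g₂, hg₂, hg₂q, hg'⟩ := change hq' g hg
  have hg₁q : g₁ q ≠ 0 := by
    have := (hg' q hq hg₂q).2
    rintro h0
    simp [h0] at this
    exact hgq this
  -- The quotient `(f₁/f₂) / (g₁/g₂)`, expanded by `f₂ * g₂`: where the new denominator is nonzero,
  -- both changes of chart are valid.
  refine ⟨f₁ * g₂ * (f₂ * g₂), mul_mem (mul_mem hf₁ hg₂) (mul_mem hf₂ hg₂), f₂ * g₁ * (f₂ * g₂),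
    mul_mem (mul_mem hf₂ hg₁) (mul_mem hf₂ hg₂), ?_, fun z hz' hne => ?_⟩
  · simp [*]
  · simp only [Pi.mul_apply, ne_eq, mul_eq_zero, not_or] at hne
    obtain ⟨⟨n1, n2⟩, n3, n4⟩ := hne
    have hgz : g z ≠ 0 := by
      rw [(hg' z hz' n4).2]
      exact div_ne_zero n2 n4
    rw [hz z (hg' z hz' n4).1 hgz, (hg' z hz' n4).2, (hf' z hz' n1).2]
    simp only [Pi.mul_apply]
    field_simp

/-- A derivation of the coordinate ring of a chart extends to a tangent vector. It is given on
an algebra `R` which represents the coordinate ring. -/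
lemma exists_tangent (hq : q ∈ dom w)
    (hreg : ∀ h, RegularAt dom reg q h → ∃ f ∈ reg w, ∃ g ∈ reg w, g q ≠ 0 ∧
      ∀ z ∈ dom w, g z ≠ 0 → h z = f z / g z)
    {R : Type*} [CommRing R] [Algebra K R] (π : R →ₐ[K] (P → K)) (hπ : π.range = reg w)
    (δ : R → K) (hc : ∀ c, δ (algebraMap K R c) = 0) (hadd : ∀ r s, δ (r + s) = δ r + δ s)
    (hmul : ∀ r s, δ (r * s) = π r q * δ s + π s q * δ r)
    (hker : ∀ r, (∀ z ∈ dom w, π r z = 0) → δ r = 0) :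
    ∃ D ∈ tangent dom reg q, ∀ r, D (π r) = δ r := by
  classical
  have hmem : ∀ r, π r ∈ reg w := fun r => hπ ▸ ⟨r, rfl⟩
  have hreg' : ∀ h, RegularAt dom reg q h → ∃ r s : R, π s q ≠ 0 ∧
      ∀ z ∈ dom w, π s z ≠ 0 → h z = π r z / π s z := by
    intro h hh
    obtain ⟨f, hf, g, hg, hgq, hz⟩ := hreg h hh
    rw [← hπ] at hf hg
    obtain ⟨r, rfl⟩ := hf
    obtain ⟨s, rfl⟩ := hg
    exact ⟨r, s, hgq, hz⟩
  have hsub : ∀ r s, δ (r - s) = δ r - δ s := fun r s => by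
    rw [eq_sub_iff_add_eq, ← hadd, sub_add_cancel]
  choose! num den hden hrep using hreg'
  -- The value is forced by the quotient rule. The claim `hkey` says that it does not depend on the
  -- fraction chosen to represent `h`.
  let D : (P → K) → K := fun h => if RegularAt dom reg q h then
    (δ (num h) - h q * δ (den h)) / π (den h) q else 0
  have hkey : ∀ h r s, RegularAt dom reg q h → π s q ≠ 0 →
      (∀ z ∈ dom w, π s z ≠ 0 → h z = π r z / π s z) →
      D h = (δ r - h q * δ s) / π s q := by
    intro h r s hh hs hrs
    -- The cross difference of two fractions for `h` vanishes where both denominators are nonzero.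
    -- The factor `s * den h` makes it vanish on the whole chart.
    have h1 := hker ((r * den h - num h * s) * (s * den h)) (by
      intro z hz
      by_cases h1 : π s z = 0
      · simp [h1]
      by_cases h2 : π (den h) z = 0
      · simp [h2]
      have h3 := hrs z hz h1
      rw [hrep h hh z hz h2, div_eq_div_iff h2 h1] at h3
      simp only [map_mul, map_sub, Pi.mul_apply, Pi.sub_apply]
      linear_combination (-(π s z * π (den h) z)) * h3)
    have h2 := hrs q hq hs
    have h3 := hrep h hh q hq (hden h hh)
    rw [eq_div_iff hs] at h2
    rw [eq_div_iff (hden h hh)] at h3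
    rw [hmul] at h1
    simp only [hsub, map_sub, hmul, Pi.sub_apply, Pi.mul_apply, map_mul] at h1
    rw [← h2, ← h3] at h1
    simp only [D, if_pos hh]
    rw [div_eq_div_iff (hden h hh) hs]
    have hne : π s q * π (den h) q ≠ 0 := mul_ne_zero hs (hden h hh)
    exact mul_left_cancel₀ hne (by linear_combination -h1)
  refine ⟨D, ⟨fun h hh => if_neg hh, fun c => ?_, fun h₁ h₂ r₁ r₂ => ?_, fun h₁ h₂ r₁ r₂ => ?_⟩,
    fun r => ?_⟩
  · rw [hkey (fun _ => c) (algebraMap K R c) 1]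
    · have h1 : δ 1 = 0 := by simpa using hc 1
      simp [hc, h1]
    · exact regularAt_of_mem hq ((reg w).algebraMap_mem c)
    · simp
    · simp
  · have hden' := mul_ne_zero (hden _ r₁) (hden _ r₂)
    have hrep' : ∀ z ∈ dom w, π (den h₁ * den h₂) z ≠ 0 →
        (h₁ + h₂) z = π (num h₁ * den h₂ + num h₂ * den h₁) z / π (den h₁ * den h₂) z := by
      intro z hz hne
      simp only [map_mul, Pi.mul_apply, ne_eq, mul_eq_zero, not_or] at hne
      simp only [Pi.add_apply, hrep _ r₁ z hz hne.1, hrep _ r₂ z hz hne.2, map_add, map_mul,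
        Pi.mul_apply]
      have := hne.1
      have := hne.2
      field_simp
    have hs : π (den h₁ * den h₂) q ≠ 0 := by simpa using hden'
    rw [hkey (h₁ + h₂) _ _ ⟨w, hq, _, hmem _, _, hmem _, hs, hrep'⟩ hs hrep',
      hkey h₁ _ _ r₁ (hden _ r₁) (hrep _ r₁), hkey h₂ _ _ r₂ (hden _ r₂) (hrep _ r₂)]
    have e₁ := hrep _ r₁ q hq (hden _ r₁)
    have e₂ := hrep _ r₂ q hq (hden _ r₂)
    rw [eq_div_iff (hden _ r₁)] at e₁
    rw [eq_div_iff (hden _ r₂)] at e₂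
    simp only [hadd, hmul, Pi.add_apply, map_mul, Pi.mul_apply, ← e₁, ← e₂]
    have := hden _ r₁
    have := hden _ r₂
    field_simp
    ring
  · have hden' := mul_ne_zero (hden _ r₁) (hden _ r₂)
    have hrep' : ∀ z ∈ dom w, π (den h₁ * den h₂) z ≠ 0 →
        (h₁ * h₂) z = π (num h₁ * num h₂) z / π (den h₁ * den h₂) z := by
      intro z hz hne
      simp only [map_mul, Pi.mul_apply, ne_eq, mul_eq_zero, not_or] at hne
      simp only [Pi.mul_apply, hrep _ r₁ z hz hne.1, hrep _ r₂ z hz hne.2, map_mul,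
        div_mul_div_comm]
    have hs : π (den h₁ * den h₂) q ≠ 0 := by simpa using hden'
    rw [hkey (h₁ * h₂) _ _ ⟨w, hq, _, hmem _, _, hmem _, hs, hrep'⟩ hs hrep',
      hkey h₁ _ _ r₁ (hden _ r₁) (hrep _ r₁), hkey h₂ _ _ r₂ (hden _ r₂) (hrep _ r₂)]
    have e₁ := hrep _ r₁ q hq (hden _ r₁)
    have e₂ := hrep _ r₂ q hq (hden _ r₂)
    rw [eq_div_iff (hden _ r₁)] at e₁
    rw [eq_div_iff (hden _ r₂)] at e₂
    simp only [hmul, map_mul, Pi.mul_apply, ← e₁, ← e₂]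
    have := hden _ r₁
    have := hden _ r₂
    field_simp
    ring
  · rw [hkey (π r) r 1 (regularAt_of_mem hq (hmem r)) (by simp) (by simp)]
    have h1 : δ 1 = 0 := by simpa using hc 1
    simp [h1]

end Tangent

namespace Charted

variable {X : Stage.{u, v} K} (hX : X.Charted)
include hX

lemma chart_form {w : List (Fin 2)} {q : X.Pt} (hq : q ∈ X.dom w) (h : X.Pt → K) (hh : X.Reg q h) :
    ∃ f ∈ X.reg w, ∃ g ∈ X.reg w, g q ≠ 0 ∧ ∀ z ∈ X.dom w, g z ≠ 0 → h z = f z / g z :=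
  regularAt_chart_form hq (fun hq' => hX.change hq hq') h hh

lemma foc_ext {w : List (Fin 2)} {q : X.Pt} (hq : q ∈ X.dom w) {D D' : (X.Pt → K) → K}
    (hD : D ∈ X.foc q) (hD' : D' ∈ X.foc q) (h : ∀ i, D (X.act w i) = D' (X.act w i)) : D = D' := by
  refine tangent_ext_chart hq (hX.foc_le q hD) (hX.foc_le q hD') (hX.chart_form hq) fun f hf => ?_
  obtain ⟨g, -, hg⟩ := hX.partials hf
  rw [hg q hq D hD, hg q hq D' hD']
  simp only [h]

/-- Every neighbourhood of a point of a chart contains a basic open set of this chart. -/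
lemma exists_basic {w : List (Fin 2)} {q : X.Pt} (hq : q ∈ X.dom w) {V : Set X.Pt} (hV : IsOpen V)
    (hqV : q ∈ V) : ∃ g ∈ X.reg w, g q ≠ 0 ∧ ∀ z ∈ X.dom w, g z ≠ 0 → z ∈ V := by
  induction hV with
  | basic V hV =>
    obtain ⟨w', f, hf, rfl⟩ := hV
    obtain ⟨f₁, hf₁, g, hg, hgq, hz⟩ := hX.change hq hqV.1 f hf
    have hqV' := hqV.2
    rw [(hz q hq hgq).2] at hqV'
    refine ⟨f₁ * g, mul_mem hf₁ hg, by simpa [hgq] using hqV', fun z hz' hne => ?_⟩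
    simp only [Pi.mul_apply, ne_eq, mul_eq_zero, not_or] at hne
    refine ⟨(hz z hz' hne.2).1, ?_⟩
    rw [(hz z hz' hne.2).2]
    exact div_ne_zero hne.1 hne.2
  | univ => exact ⟨1, one_mem _, by simp, fun _ _ _ => trivial⟩
  | inter V₁ V₂ _ _ ih₁ ih₂ =>
    obtain ⟨g₁, hg₁, h₁, hz₁⟩ := ih₁ hqV.1
    obtain ⟨g₂, hg₂, h₂, hz₂⟩ := ih₂ hqV.2
    refine ⟨g₁ * g₂, mul_mem hg₁ hg₂, mul_ne_zero h₁ h₂, fun z hz hne => ?_⟩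
    simp only [Pi.mul_apply, ne_eq, mul_eq_zero, not_or] at hne
    exact ⟨hz₁ z hz hne.1, hz₂ z hz hne.2⟩
  | sUnion S _ ih =>
    obtain ⟨V, hVS, hqV⟩ := hqV
    obtain ⟨g, hg, h, hz⟩ := ih V hVS hqV
    exact ⟨g, hg, h, fun z hz' hne => ⟨V, hVS, hz z hz' hne⟩⟩

end Charted

lemma isOpen_basic (X : Stage.{u, v} K) {w : List (Fin 2)} {f : X.Pt → K} (hf : f ∈ X.reg w) :
    IsOpen {q : X.Pt | q ∈ X.dom w ∧ f q ≠ 0} :=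
  TopologicalSpace.isOpen_generateFrom_of_mem ⟨w, f, hf, rfl⟩

lemma isOpen_dom (X : Stage.{u, v} K) (w : List (Fin 2)) : IsOpen (X.dom w) := by
  have := X.isOpen_basic (one_mem (X.reg w))
  simpa using this

section Directions

variable {X : Stage.{u, v} K}

lemma Dir.vec_mem (p : X.Dir) : p.vec ∈ X.foc p.pt := p.line.rep.2

lemma Dir.vec_ne_zero (p : X.Dir) : p.vec ≠ 0 := fun h =>
  p.line.rep_nonzero (Subtype.ext h)

lemma Dir.ext_vec {p p' : X.Dir} (h : p.pt = p'.pt) (c : K) (hc : p.vec = c • p'.vec) : p = p' := by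
  obtain ⟨q, l⟩ := p
  obtain ⟨q', l'⟩ := p'
  obtain rfl : q = q' := h
  congr 1
  rw [← l.mk_rep, ← l'.mk_rep, Projectivization.mk_eq_mk_iff']
  exact ⟨c, Subtype.ext hc.symm⟩

lemma exists_dir {q : X.Pt} {D : (X.Pt → K) → K} (hD : D ∈ X.foc q) (h0 : D ≠ 0) :
    ∃ p : X.Dir, p.pt = q ∧ ∃ c : K, c ≠ 0 ∧ p.vec = c • D := by
  have h0' : (⟨D, hD⟩ : X.foc q) ≠ 0 := fun h => h0 (congrArg Subtype.val h)
  refine ⟨⟨q, Projectivization.mk K _ h0'⟩, rfl, ?_⟩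
  obtain ⟨a, ha⟩ := Projectivization.exists_smul_eq_mk_rep K _ h0'
  exact ⟨a, a.ne_zero, (congrArg Subtype.val ha).symm⟩

end Directions

end Stage

/-! ### The projectivized focal bundle inherits the atlas -/

namespace Stage

variable {K : Type u} [Field K] {X : Stage.{u, v} K}

section Directions

variable {a : Fin 2} {w : List (Fin 2)}

lemma dirAct_self : X.dirAct (a :: w) a = fun p => X.act w a p.pt := by
  funext p
  simp [dirAct]

lemma dirAct_opp (p : X.Dir) :
    X.dirAct (a :: w) (opp a) p = p.vec (X.act w (opp a)) / p.vec (X.act w a) := by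
  simp [dirAct, opp_ne]

lemma pullback_mem_dirReg {f : X.Pt → K} (hf : f ∈ X.reg w) (a : Fin 2) :
    (fun p : X.Dir => f p.pt) ∈ X.dirReg (a :: w) :=
  Algebra.subset_adjoin (Or.inl ⟨f, hf, rfl⟩)

lemma dirAct_mem (a : Fin 2) : X.dirAct (a :: w) (opp a) ∈ X.dirReg (a :: w) :=
  Algebra.subset_adjoin (Or.inr rfl)

/-- Induction on the elements of the coordinate ring of a chart of the projectivized bundle. -/
lemma dirReg_induction {p : (f : X.Dir → K) → f ∈ X.dirReg (a :: w) → Prop}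
    (pull : ∀ f (hf : f ∈ X.reg w), p (fun z => f z.pt) (pullback_mem_dirReg hf a))
    (new : p (X.dirAct (a :: w) (opp a)) (dirAct_mem a))
    (add : ∀ f g hf hg, p f hf → p g hg → p (f + g) (add_mem hf hg))
    (mul : ∀ f g hf hg, p f hf → p g hg → p (f * g) (mul_mem hf hg))
    {f : X.Dir → K} (hf : f ∈ X.dirReg (a :: w)) : p f hf := by
  refine Algebra.adjoin_induction (p := p) ?_ ?_ (fun f g hf hg => add f g hf hg)
    (fun f g hf hg => mul f g hf hg) hf
  · rintro f (⟨g, hg, rfl⟩ | rfl)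
    exacts [pull g hg, new]
  · exact fun c => pull _ ((X.reg w).algebraMap_mem c)

variable (hX : X.Charted)
include hX

lemma Charted.dir_ext {p p' : X.Dir} (hp : p ∈ X.dirDom (a :: w)) (hp' : p' ∈ X.dirDom (a :: w))
    (h : p.pt = p'.pt) (hy : X.dirAct (a :: w) (opp a) p = X.dirAct (a :: w) (opp a) p') :
    p = p' := by
  refine Dir.ext_vec h (p.vec (X.act w a) / p'.vec (X.act w a)) (hX.foc_ext hp.1 p.vec_mem
    (h ▸ Submodule.smul_mem _ _ p'.vec_mem) ((forall_letter a).2 ⟨?_, ?_⟩))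
  · simp [hp'.2]
  · rw [dirAct_opp, dirAct_opp, div_eq_div_iff hp.2 hp'.2] at hy
    simp only [Pi.smul_apply, smul_eq_mul]
    rw [div_mul_eq_mul_div, eq_div_iff hp'.2, hy, mul_comm]

/-- A point of the projectivized bundle is given by its projection and the new coordinate. -/
lemma Charted.exists_dir_chart {q : X.Pt} (hq : q ∈ X.dom w) (a : Fin 2) (s : K) :
    ∃ p : X.Dir, p.pt = q ∧ p ∈ X.dirDom (a :: w) ∧ X.dirAct (a :: w) (opp a) p = s := by
  obtain ⟨D, hD, hα⟩ := hX.exists_foc hq fun i => if i = a then 1 else s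
  have ha := hα a
  have hb := hα (opp a)
  simp only [if_true, opp_ne, if_false] at ha hb
  obtain ⟨p, rfl, c, hc, hp⟩ := exists_dir hD (by rintro rfl; simp at ha)
  refine ⟨p, rfl, ⟨hq, ?_⟩, ?_⟩
  · simp [hp, ha, hc]
  · simp [dirAct_opp, hp, ha, hb, hc]

/-- A nonzero focal vector cannot kill both active coordinates, so the two charts `a :: w` and `opp
a :: w` together cover the fibres over the chart `w`. -/
lemma Charted.mem_dirDom_of_pt {p : X.Dir} (hp : p.pt ∈ X.dom w) (a : Fin 2) :
    p ∈ X.dirDom (a :: w) ∨ p ∈ X.dirDom (opp a :: w) := by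
  by_contra! h
  refine p.vec_ne_zero (hX.foc_ext hp p.vec_mem (Submodule.zero_mem _)
    ((forall_letter a).2 ⟨?_, ?_⟩))
  · by_contra h0
    exact h.1 ⟨hp, h0⟩
  · by_contra h0
    exact h.2 ⟨hp, h0⟩

/-- The value of a focal direction on a regular function, in terms of an active coordinate. -/
lemma Charted.exists_vec_eq (a : Fin 2) {f : X.Pt → K} (hf : f ∈ X.reg w) :
    ∃ H ∈ X.dirReg (a :: w), ∀ z ∈ X.dirDom (a :: w), z.vec f = z.vec (X.act w a) * H z := by
  obtain ⟨g, hg, hgD⟩ := hX.partials hf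
  refine ⟨(fun z => g a z.pt) + (fun z => g (opp a) z.pt) * X.dirAct (a :: w) (opp a),
    add_mem (pullback_mem_dirReg (hg a) a)
      (mul_mem (pullback_mem_dirReg (hg _) a) (dirAct_mem a)), fun z hz => ?_⟩
  rw [hgD _ hz.1 _ z.vec_mem, sum_letters _ a]
  simp only [Pi.add_apply, Pi.mul_apply, dirAct_opp]
  have := hz.2
  field_simp

/-- The quotient rule applied to `f = f₁ / g` in the chart `w` accounts for the square in the
denominator. -/
lemma Charted.exists_vec_frac {w' : List (Fin 2)} (a : Fin 2) {q : X.Pt} (hq : q ∈ X.dom w)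
    (hq' : q ∈ X.dom w') {f : X.Pt → K} (hf : f ∈ X.reg w') :
    ∃ H ∈ X.dirReg (a :: w), ∃ g ∈ X.reg w, g q ≠ 0 ∧ ∀ z ∈ X.dirDom (a :: w), g z.pt ≠ 0 →
      z.pt ∈ X.dom w' ∧ z.vec f = z.vec (X.act w a) * (H z / g z.pt ^ 2) := by
  obtain ⟨f₁, hf₁, g, hg, hgq, hz⟩ := hX.change hq hq' f hf
  obtain ⟨F, hF, hF'⟩ := hX.exists_vec_eq a hf₁
  obtain ⟨G, hG, hG'⟩ := hX.exists_vec_eq a hg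
  refine ⟨(fun z => g z.pt) * F - (fun z => f₁ z.pt) * G, sub_mem
    (mul_mem (pullback_mem_dirReg hg a) hF) (mul_mem (pullback_mem_dirReg hf₁ a) hG), g, hg, hgq,
    fun z hz' hgz => ⟨(hz _ hz'.1 hgz).1, ?_⟩⟩
  have h := tangent_div (hX.foc_le _ z.vec_mem) hz'.1 hf₁ hg hgz fun y hy hgy => (hz y hy hgy).2
  rw [hF' z hz', hG' z hz', (hz _ hz'.1 hgz).2] at h
  simp only [Pi.sub_apply, Pi.mul_apply]
  field_simp at h ⊢
  linear_combination -h

/-- Differentials of functions of `w'` are, over the chart `a :: w`, multiples of the differential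
of `x_a(w)` by fractions. In the new coordinate of the other chart, a ratio of two differentials,
this common factor cancels. -/
lemma Charted.next_change {w w' : List (Fin 2)} {p : X.Dir} (hp : p ∈ X.dirDom w)
    (hp' : p ∈ X.dirDom w') {f : X.Dir → K} (hf : f ∈ X.dirReg w') :
    ∃ f₁ ∈ X.dirReg w, ∃ g ∈ X.dirReg w, g p ≠ 0 ∧
      ∀ z ∈ X.dirDom w, g z ≠ 0 → z ∈ X.dirDom w' ∧ f z = f₁ z / g z := by
  obtain _ | ⟨a, w⟩ := w
  · exact absurd hp id
  obtain _ | ⟨b, w'⟩ := w'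
  · exact absurd hp' id
  obtain ⟨H, hH, h, hh, hhq, hHh⟩ := hX.exists_vec_frac a hp.1 hp'.1 (hX.act_mem w' b)
  have hHp : H p ≠ 0 := by
    have := hp'.2
    rw [(hHh p hp hhq).2] at this
    intro h0
    simp [h0] at this
  have hdom : ∀ z ∈ X.dirDom (a :: w), (H * fun z : X.Dir => h z.pt) z ≠ 0 → z ∈ X.dirDom (b :: w') := by
    intro z hz hne
    simp only [Pi.mul_apply, ne_eq, mul_eq_zero, not_or] at hne
    refine ⟨(hHh z hz hne.2).1, ?_⟩
    rw [(hHh z hz hne.2).2]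
    exact mul_ne_zero hz.2 (div_ne_zero hne.1 (pow_ne_zero _ hne.2))
  have hdom_mem := mul_mem hH (pullback_mem_dirReg hh a)
  -- The factor `H * h` in a denominator ensures that the point lies in the second chart. It remains
  -- to write `f` as a fraction, which can be done generator by generator.
  suffices hs : ∃ f₁ ∈ X.dirReg (a :: w), ∃ g ∈ X.dirReg (a :: w), g p ≠ 0 ∧
      ∀ z ∈ X.dirDom (a :: w), g z ≠ 0 → f z = f₁ z / g z by
    obtain ⟨f₁, hf₁, g, hg, hgp, hz⟩ := hs
    refine ⟨f₁ * (H * fun z => h z.pt), mul_mem hf₁ hdom_mem, g * (H * fun z => h z.pt),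
      mul_mem hg hdom_mem, mul_ne_zero hgp (mul_ne_zero hHp hhq), fun z hz' hne => ?_⟩
    rw [Pi.mul_apply] at hne
    have n1 := left_ne_zero_of_mul hne
    have n2 := right_ne_zero_of_mul hne
    refine ⟨hdom z hz' n2, ?_⟩
    rw [Pi.mul_apply, Pi.mul_apply g, hz z hz' n1, mul_div_mul_right _ _ n2]
  induction hf using dirReg_induction with
  | pull f hf =>
    obtain ⟨f₁, hf₁, g, hg, hgq, hz⟩ := hX.change hp.1 hp'.1 f hf
    exact ⟨_, pullback_mem_dirReg hf₁ a, _, pullback_mem_dirReg hg a, hgq,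
      fun z hz' hne => (hz z.pt hz'.1 hne).2⟩
  | new =>
    obtain ⟨G, hG, g, hg, hgq, hGg⟩ := hX.exists_vec_frac a hp.1 hp'.1 (hX.act_mem w' (opp b))
    -- The ratio of `G / g ^ 2` and `H / h ^ 2` is `G * h ^ 2 / (H * g ^ 2)`. It is expanded by `h`
    -- so that a nonzero denominator implies `h ≠ 0`.
    refine ⟨G * (fun z => h z.pt) ^ 3, mul_mem hG (pow_mem (pullback_mem_dirReg hh a) 3),
      H * (fun z => g z.pt) ^ 2 * (fun z => h z.pt), mul_mem (mul_mem hH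
        (pow_mem (pullback_mem_dirReg hg a) 2)) (pullback_mem_dirReg hh a), ?_, fun z hz hne => ?_⟩
    · simp [hHp, hgq, hhq]
    · simp only [Pi.mul_apply, Pi.pow_apply, ne_eq, mul_eq_zero, not_or, pow_eq_zero_iff,
        OfNat.ofNat_ne_zero, not_false_eq_true] at hne
      obtain ⟨⟨n1, n2⟩, n3⟩ := hne
      rw [dirAct_opp, (hHh z hz n3).2, (hGg z hz n2).2]
      have := hz.2
      simp only [Pi.mul_apply, Pi.pow_apply]
      field_simp
  | add f g hf hg ihf ihg =>
    obtain ⟨f₁, hf₁, f₂, hf₂, hfp, hfz⟩ := ihf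
    obtain ⟨g₁, hg₁, g₂, hg₂, hgp, hgz⟩ := ihg
    refine ⟨f₁ * g₂ + g₁ * f₂, add_mem (mul_mem hf₁ hg₂) (mul_mem hg₁ hf₂), f₂ * g₂,
      mul_mem hf₂ hg₂, mul_ne_zero hfp hgp, fun z hz hne => ?_⟩
    have n1 := left_ne_zero_of_mul hne
    have n2 := right_ne_zero_of_mul hne
    simp only [Pi.add_apply, Pi.mul_apply, hfz z hz n1, hgz z hz n2]
    rw [div_add_div _ _ n1 n2, mul_comm (f₂ z) (g₁ z)]
  | mul f g hf hg ihf ihg =>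
    obtain ⟨f₁, hf₁, f₂, hf₂, hfp, hfz⟩ := ihf
    obtain ⟨g₁, hg₁, g₂, hg₂, hgp, hgz⟩ := ihg
    refine ⟨f₁ * g₁, mul_mem hf₁ hg₁, f₂ * g₂,
      mul_mem hf₂ hg₂, mul_ne_zero hfp hgp, fun z hz hne => ?_⟩
    have n1 := left_ne_zero_of_mul hne
    have n2 := right_ne_zero_of_mul hne
    simp only [Pi.mul_apply, hfz z hz n1, hgz z hz n2, div_mul_div_comm]

/-- On focal vectors the differential of `x_b(w)`, `b` opposite to `a`, is `y` times that of
`x_a(w)`. Therefore pullbacks have differentials proportional to that of the retained coordinate,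
and only the new coordinate contributes a second direction. -/
lemma Charted.next_partials {f : X.Dir → K} (hf : f ∈ X.dirReg (a :: w)) :
    ∃ g : Fin 2 → X.Dir → K, (∀ i, g i ∈ X.dirReg (a :: w)) ∧
      ∀ p ∈ X.dirDom (a :: w), ∀ D ∈ X.dirFoc p, D f = ∑ i, g i p * D (X.dirAct (a :: w) i) := by
  suffices hs : ∃ f₁ ∈ X.dirReg (a :: w), ∃ f₂ ∈ X.dirReg (a :: w), ∀ p ∈ X.dirDom (a :: w),
      ∀ D ∈ X.dirFoc p, D f =
        f₁ p * D (X.dirAct (a :: w) a) + f₂ p * D (X.dirAct (a :: w) (opp a)) by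
    obtain ⟨f₁, hf₁, f₂, hf₂, h⟩ := hs
    refine ⟨fun i => if i = a then f₁ else f₂, fun i => by dsimp only; split_ifs <;> assumption,
      fun p hp D hD => ?_⟩
    rw [sum_letters _ a, h p hp D hD]
    simp [opp_ne]
  induction hf using dirReg_induction with
  | pull f hf =>
    obtain ⟨g, hg, hgD⟩ := hX.partials hf
    refine ⟨(fun z => g a z.pt) + (fun z => g (opp a) z.pt) * X.dirAct (a :: w) (opp a),
      add_mem (pullback_mem_dirReg (hg a) a)
        (mul_mem (pullback_mem_dirReg (hg _) a) (dirAct_mem a)), 0, zero_mem _, fun p hp D hD => ?_⟩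
    obtain ⟨c, hc⟩ := hD.2
    rw [dirAct_self, hc _ (regularAt_of_mem hp.1 hf), hc _ (regularAt_of_mem hp.1 (hX.act_mem w a)),
      hgD _ hp.1 _ p.vec_mem, sum_letters _ a]
    simp only [Pi.add_apply, Pi.mul_apply, dirAct_opp, Pi.zero_apply]
    have := hp.2
    field_simp
    ring
  | new => exact ⟨0, zero_mem _, 1, one_mem _, fun p _ D _ => by simp⟩
  | add f g hf hg ihf ihg =>
    obtain ⟨f₁, hf₁, f₂, hf₂, hf'⟩ := ihf
    obtain ⟨g₁, hg₁, g₂, hg₂, hg'⟩ := ihg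
    refine ⟨f₁ + g₁, add_mem hf₁ hg₁, f₂ + g₂, add_mem hf₂ hg₂, fun p hp D hD => ?_⟩
    rw [tangent_add hD.1 (regularAt_of_mem hp hf) (regularAt_of_mem hp hg), hf' p hp D hD,
      hg' p hp D hD]
    simp only [Pi.add_apply]
    ring
  | mul f g hf hg ihf ihg =>
    obtain ⟨f₁, hf₁, f₂, hf₂, hf'⟩ := ihf
    obtain ⟨g₁, hg₁, g₂, hg₂, hg'⟩ := ihg
    refine ⟨f * g₁ + g * f₁, add_mem (mul_mem hf hg₁) (mul_mem hg hf₁), f * g₂ + g * f₂,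
      add_mem (mul_mem hf hg₂) (mul_mem hg hf₂), fun p hp D hD => ?_⟩
    rw [tangent_mul hD.1 (regularAt_of_mem hp hf) (regularAt_of_mem hp hg), hf' p hp D hD,
      hg' p hp D hD]
    simp only [Pi.add_apply, Pi.mul_apply]
    ring

/-- A tangent vector is focal as soon as this can be seen on the coordinate ring of a chart. -/
lemma Charted.mem_dirFoc {p : X.Dir} (hp : p ∈ X.dirDom (a :: w)) {D : (X.Dir → K) → K}
    (hD : D ∈ tangent X.dirDom X.dirReg p) (c : K)
    (h : ∀ f ∈ X.reg w, D (fun z => f z.pt) = c * p.vec f) : D ∈ X.dirFoc p := by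
  refine ⟨hD, c, fun k hk => ?_⟩
  obtain ⟨f, hf, g, hg, hgp, hz⟩ := hX.chart_form hp.1 k hk
  have h1 := tangent_div (hX.foc_le _ p.vec_mem) hp.1 hf hg hgp hz
  have h2 := tangent_div hD hp (pullback_mem_dirReg hf a) (pullback_mem_dirReg hg a) hgp
    (h := fun z => k z.pt) fun z hz' hne => hz _ hz'.1 hne
  rw [h f hf, h g hg] at h2
  exact mul_left_cancel₀ hgp (by linear_combination c * h1 - h2)

omit hX in
variable (X a w) in
/-- Polynomials in the new coordinate over the coordinate ring of a chart, as functions. -/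
noncomputable def polyFun : Polynomial (X.reg w) →ₐ[K] (X.Dir → K) :=
  Polynomial.eval₂AlgHom (AlgHom.mk' (RingHom.mk ⟨⟨fun (f : X.reg w) (z : X.Dir) => f.1 z.pt, rfl⟩,
    fun _ _ => rfl⟩ rfl (fun _ _ => rfl)) (fun _ _ => rfl)) (X.dirAct (a :: w) (opp a))
    (fun _ => Commute.all _ _)

omit hX in
lemma polyFun_C (f : X.reg w) : polyFun X a w (Polynomial.C f) = fun z => f.1 z.pt := by
  simp [polyFun]

omit hX in
lemma polyFun_X : polyFun X a w Polynomial.X = X.dirAct (a :: w) (opp a) := by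
  simp [polyFun]

omit hX in
lemma polyFun_range : (polyFun X a w).range = X.dirReg (a :: w) := by
  apply le_antisymm
  · rintro _ ⟨P, rfl⟩
    induction P using Polynomial.induction_on' with
    | add P Q hP hQ => rw [map_add]; exact add_mem hP hQ
    | monomial n f =>
      have : polyFun X a w (Polynomial.monomial n f) =
          (fun z => f.1 z.pt) * X.dirAct (a :: w) (opp a) ^ n := by
        simp [polyFun, Polynomial.eval₂_monomial]
      exact this ▸ mul_mem (pullback_mem_dirReg f.2 a) (pow_mem (dirAct_mem a) n)
  · refine Algebra.adjoin_le ?_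
    rintro _ (⟨f, hf, rfl⟩ | rfl)
    · exact ⟨Polynomial.C ⟨f, hf⟩, by simp [polyFun]⟩
    · exact ⟨Polynomial.X, by simp [polyFun]⟩

/-- The chart is a product with an affine line, so a derivation of its ring may be prescribed as a
multiple of `p.vec` on the pullbacks and arbitrarily on the new coordinate. It is built as the
`ε`-part of a homomorphism from polynomials to the dual numbers. -/
lemma Charted.next_exists_foc [Infinite K] {p : X.Dir} (hp : p ∈ X.dirDom (a :: w))
    (α : Fin 2 → K) : ∃ D ∈ X.dirFoc p, ∀ i, D (X.dirAct (a :: w) i) = α i := by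
  -- This multiple of `p.vec` takes the value `α a` on the retained coordinate.
  set c := α a / p.vec (X.act w a) with hc
  have hT := hX.foc_le _ p.vec_mem
  have hr : ∀ f : X.reg w, X.Reg p.pt f := fun f => regularAt_of_mem hp.1 f.2
  let φ : X.reg w →+* DualNumber K :=
    { toFun := fun f => (f.1 p.pt, c * p.vec f.1)
      map_one' := by
        refine TrivSqZeroExt.ext rfl ?_
        change c * p.vec (fun _ => 1) = 0
        rw [tangent_const hT, mul_zero]
      map_zero' := by
        refine TrivSqZeroExt.ext rfl ?_
        change c * p.vec (fun _ => 0) = 0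
        rw [tangent_const hT, mul_zero]
      map_add' := fun f g => by
        refine TrivSqZeroExt.ext rfl ?_
        change c * p.vec (f.1 + g.1) = c * p.vec f.1 + c * p.vec g.1
        rw [tangent_add hT (hr f) (hr g), mul_add]
      map_mul' := fun f g => by
        refine TrivSqZeroExt.ext rfl ?_
        change c * p.vec (f.1 * g.1) = f.1 p.pt * (c * p.vec g.1) + (c * p.vec f.1) * g.1 p.pt
        rw [tangent_mul hT (hr f) (hr g)]
        ring }
  let y : DualNumber K := (X.dirAct (a :: w) (opp a) p, α (opp a))
  let Φ : Polynomial (X.reg w) →+* DualNumber K := Polynomial.eval₂RingHom φ y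
  have hfst : ∀ P, (Φ P).fst = polyFun X a w P p := by
    intro P
    have : (TrivSqZeroExt.fstHom K K K).toRingHom.comp Φ =
        (Pi.evalRingHom (fun _ : X.Dir => K) p).comp (polyFun X a w).toRingHom := by
      refine Polynomial.ringHom_ext (fun f => ?_) ?_
      · change (Φ (Polynomial.C f)).fst = polyFun X a w (Polynomial.C f) p
        rw [polyFun_C, Polynomial.coe_eval₂RingHom, Polynomial.eval₂_C]
        rfl
      · change (Φ Polynomial.X).fst = polyFun X a w Polynomial.X p
        rw [polyFun_X, Polynomial.coe_eval₂RingHom, Polynomial.eval₂_X]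
        rfl
    exact congrArg (fun f => f P) this
  -- Different polynomials may define the same function. One that vanishes on the chart vanishes on
  -- each affine line over a point of the base, and since `K` is infinite all its coefficients are
  -- zero functions there.
  have hker : ∀ P, (∀ z ∈ X.dirDom (a :: w), polyFun X a w P z = 0) → (Φ P).snd = 0 := by
    intro P hP
    have hcoef : ∀ n, ∀ q ∈ X.dom w, (P.coeff n).1 q = 0 := by
      intro n q hq
      let ev : X.reg w →+* K := (Pi.evalRingHom (fun _ : X.Pt => K) q).comp (X.reg w).val.toRingHom
      have h0 : P.map ev = 0 := by
        refine Polynomial.funext fun s => ?_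
        obtain ⟨z, rfl, hz, rfl⟩ := hX.exists_dir_chart hq a s
        have h1 := hP z hz
        have : (Pi.evalRingHom (fun _ : X.Dir => K) z).comp (polyFun X a w).toRingHom =
            Polynomial.eval₂RingHom ev (X.dirAct (a :: w) (opp a) z) := by
          refine Polynomial.ringHom_ext (fun f => ?_) ?_
          · change polyFun X a w (Polynomial.C f) z = _
            rw [polyFun_C, Polynomial.coe_eval₂RingHom, Polynomial.eval₂_C]
            rfl
          · change polyFun X a w Polynomial.X z = _
            rw [polyFun_X, Polynomial.coe_eval₂RingHom, Polynomial.eval₂_X]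
        rw [Polynomial.eval_map, Polynomial.eval_zero, ← h1]
        exact (congrArg (fun f => f P) this).symm
      have := congrArg (fun Q => Polynomial.coeff Q n) h0
      simpa [Polynomial.coeff_map, ev] using this
    have hφ : ∀ n, φ (P.coeff n) = 0 := by
      intro n
      refine TrivSqZeroExt.ext (hcoef n _ hp.1) ?_
      change c * p.vec (P.coeff n).1 = 0
      rw [tangent_congr hT hp.1 (hr _) (regularAt_of_mem hp.1 (zero_mem _)) (one_mem _) (by simp)
        fun z hz _ => hcoef n z hz, tangent_zero hT, mul_zero]
    have : Φ P = 0 := by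
      change P.eval₂ φ y = 0
      rw [Polynomial.eval₂_eq_sum]
      simp [Polynomial.sum, hφ]
    rw [this]
    rfl
  obtain ⟨D, hD, hDP⟩ := exists_tangent hp
    (regularAt_chart_form hp fun hp' f hf => hX.next_change hp hp' hf) (polyFun X a w) polyFun_range (fun P => (Φ P).snd)
    (fun e => by
      rw [Polynomial.algebraMap_apply, Polynomial.coe_eval₂RingHom, Polynomial.eval₂_C]
      change c * p.vec (fun _ => e) = 0
      rw [tangent_const hT, mul_zero]) (fun P Q => by simp)
    (fun P Q => by rw [map_mul, TrivSqZeroExt.snd_mul, hfst, hfst, smul_eq_mul, op_smul_eq_smul,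
      smul_eq_mul]) hker
  have hpull : ∀ f ∈ X.reg w, D (fun z => f z.pt) = c * p.vec f := by
    intro f hf
    have h1 := hDP (Polynomial.C ⟨f, hf⟩)
    rw [polyFun_C, Polynomial.coe_eval₂RingHom, Polynomial.eval₂_C] at h1
    exact h1
  refine ⟨D, hX.mem_dirFoc hp hD c hpull, (forall_letter a).2 ⟨?_, ?_⟩⟩
  · rw [dirAct_self, hpull _ (hX.act_mem w a), hc, div_mul_cancel₀ _ hp.2]
  · have h1 := hDP Polynomial.X
    rw [polyFun_X, Polynomial.coe_eval₂RingHom, Polynomial.eval₂_X] at h1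
    exact h1

/-- The projectivization of the focal bundle again has an atlas with the same properties. -/
lemma Charted.next [Infinite K] : X.next.Charted where
  cover p := by
    obtain ⟨w, hw⟩ := hX.cover (Dir.pt p)
    obtain h | h := hX.mem_dirDom_of_pt hw 0
    exacts [⟨0 :: w, h⟩, ⟨opp 0 :: w, h⟩]
  change hp hp' f hf := hX.next_change hp hp' hf
  act_mem w i := by
    obtain _ | ⟨a, w⟩ := w
    · exact zero_mem (⊥ : Subalgebra K (X.Dir → K))
    · obtain rfl | rfl := eq_or_eq_opp a i
      · change X.dirAct (i :: w) i ∈ X.dirReg (i :: w)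
        rw [dirAct_self]
        exact pullback_mem_dirReg (hX.act_mem w i) i
      · exact dirAct_mem a
  foc_le p D hD := hD.1
  partials {w f} hf := by
    obtain _ | ⟨a, w⟩ := w
    · exact ⟨fun _ => 0, fun _ => zero_mem _, fun q hq => absurd hq id⟩
    · exact hX.next_partials hf
  exists_foc {w p} hp α := by
    obtain _ | ⟨a, w⟩ := w
    · exact absurd hp id
    · exact hX.next_exists_foc hp α

end Directions
end Stage

/-! ### The surface as the bottom stage -/

section Nullstellensatz

variable {K : Type u} [Field K] {A : Type v} [CommRing A] [Algebra K A]

/-- A form of the Nullstellensatz: a function which vanishes at all the points of the zero locus of an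
ideal belongs to the radical of the ideal. -/
lemma mem_radical_of_forall_algHom [IsAlgClosed K] [Algebra.FiniteType K A] (I : Ideal A) (f : A)
    (h : ∀ q : A →ₐ[K] K, (∀ a ∈ I, q a = 0) → q f = 0) : f ∈ I.radical := by
  have := isJacobsonRing_of_finiteType (A := K) (B := A)
  rw [Ideal.radical_eq_jacobson, Ideal.jacobson, Ideal.mem_sInf]
  rintro M ⟨hIM, hM⟩
  let _ := Ideal.Quotient.field M
  have : Module.Finite K (A ⧸ M) := finite_of_finite_type_of_isJacobsonRing K (A ⧸ M)
  have hb : Function.Bijective (algebraMap K (A ⧸ M)) :=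
    IsAlgClosed.algebraMap_bijective_of_isIntegral
  let e : K ≃ₐ[K] A ⧸ M := AlgEquiv.ofBijective (Algebra.ofId K _) hb
  have h0 := h (e.symm.toAlgHom.comp (Ideal.Quotient.mkₐ K M)) fun a ha => by
    simp [Ideal.Quotient.eq_zero_iff_mem.2 (hIM ha)]
  rw [← Ideal.Quotient.eq_zero_iff_mem]
  simpa using h0

/-- In characteristic zero the radical of a differential ideal is differential. -/
lemma derivation_mem_radical [CharZero K] (D : Derivation K A A) {I : Ideal A}
    (hD : ∀ a ∈ I, D a ∈ I) {a : A} (ha : a ∈ I.radical) : D a ∈ I.radical := by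
  obtain ⟨n, hn⟩ := ha
  have key : ∀ m j, a ^ m * D a ^ j ∈ I → D a ∈ I.radical := by
    intro m
    induction m with
    | zero => exact fun j hj => ⟨j, by simpa using hj⟩
    | succ m ih =>
      intro j hj
      refine ih (j + 2) ?_
      have h1 := I.mul_mem_left (D a) (hD _ hj)
      have h2 := I.mul_mem_left (j * D (D a)) hj
      have e : D a * D (a ^ (m + 1) * D a ^ j) - j * D (D a) * (a ^ (m + 1) * D a ^ j) =
          algebraMap K A (m + 1 : K) * (a ^ m * D a ^ (j + 2)) := by
        obtain _ | j := j
        · simp [Derivation.leibniz_pow]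
          ring
        · simp [Derivation.leibniz, Derivation.leibniz_pow]
          ring
      have h3 := I.mul_mem_left (algebraMap K A (m + 1 : K)⁻¹) (e ▸ I.sub_mem h1 h2)
      rwa [← mul_assoc, ← map_mul, inv_mul_cancel₀ (by exact_mod_cast m.succ_ne_zero), map_one,
        one_mul] at h3
  exact key n 0 (by simpa using hn)

end Nullstellensatz

section Partials

variable {K : Type u} [Field K] {A : Type v} [CommRing A] [Algebra K A] {x : Fin 2 → A}

/-- The derivations dual to the local coordinates. -/
lemma exists_partials
    (hx : LinearIndependent A (fun i => KaehlerDifferential.D K A (x i)))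
    (hx' : Submodule.span A (Set.range (fun i => KaehlerDifferential.D K A (x i))) = ⊤) :
    ∃ δ : Fin 2 → Derivation K A A, (∀ i j, δ i (x j) = if i = j then 1 else 0) ∧
      ∀ (q : A →ₐ[K] K) (E : A → K), (∀ a b, E (a + b) = E a + E b) →
        (∀ a b, E (a * b) = q a * E b + q b * E a) → (∀ c, E (algebraMap K A c) = 0) →
        ∀ a, E a = ∑ i, q (δ i a) * E (x i) := by
  let b := Module.Basis.mk hx hx'.ge
  refine ⟨fun i => (b.coord i).compDer (KaehlerDifferential.D K A), fun i j => ?_,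
    fun q E hadd hmul hc a => ?_⟩
  · have : KaehlerDifferential.D K A (x j) = b j := by simp [b]
    simp [this, Finsupp.single_apply, eq_comm]
  -- With `K` an `A`-module through `q`, the functional `E` is a derivation into `K` and factors
  -- through the differentials, where it is evaluated in the basis of the `d x_i`.
  · let _ : Module A K := Module.compHom K (q : A →+* K)
    have hsmul : ∀ (a : A) (k : K), a • k = q a * k := fun a k => rfl
    have : IsScalarTower K A K := ⟨fun c a k => by
      rw [hsmul, hsmul, map_smul, smul_eq_mul, smul_eq_mul, mul_assoc]⟩
    let L : A →ₗ[K] K :=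
      { toFun := E
        map_add' := hadd
        map_smul' := fun c a => by
          rw [Algebra.smul_def, hmul, hc, mul_zero, add_zero, AlgHom.commutes]
          rfl }
    let E' : Derivation K A K := Derivation.mk' L fun a b => by
      simp only [hsmul]
      exact hmul a b
    have h1 : ∀ a, E a = E'.liftKaehlerDifferential (KaehlerDifferential.D K A a) := fun a =>
      (E'.liftKaehlerDifferential_comp_D a).symm
    have h2 := b.sum_repr (KaehlerDifferential.D K A a)
    rw [h1 a, ← h2, map_sum]
    refine Finset.sum_congr rfl fun i _ => ?_
    rw [map_smul, hsmul, h1 (x i)]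
    simp [b]

end Partials

section Base

open Stage

variable {K : Type u} [Field K] {A : Type v} [CommRing A] [Algebra K A] {x : Fin 2 → A}

/-- The derivations dual to the local coordinates, and the expression of tangent vectors by them. -/
lemma exists_dual_derivations
    (hx : LinearIndependent A (fun i => KaehlerDifferential.D K A (x i)))
    (hx' : Submodule.span A (Set.range (fun i => KaehlerDifferential.D K A (x i))) = ⊤) :
    ∃ δ : Fin 2 → Derivation K A A, (∀ i j, δ i (x j) = if i = j then 1 else 0) ∧
      ∀ q : A →ₐ[K] K, ∀ D ∈ (baseStage x).foc q, ∀ a,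
        D (fun q : A →ₐ[K] K => q a) = ∑ i, q (δ i a) * D (fun q : A →ₐ[K] K => q (x i)) := by
  obtain ⟨δ, hδ, hE⟩ := exists_partials hx hx'
  refine ⟨δ, hδ, fun q D hD a => ?_⟩
  have hr : ∀ a : A, RegularAt (baseStage x).dom (baseStage x).reg q
      (fun q : A →ₐ[K] K => q a) := fun a => regularAt_of_mem
    (dom := (baseStage (K := K) x).dom) (reg := (baseStage x).reg) (w := []) rfl ⟨a, rfl⟩
  refine hE q (fun a => D fun q : A →ₐ[K] K => q a) (fun a b => ?_) (fun a b => ?_) (fun c => ?_) a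
  · rw [← tangent_add hD (hr a) (hr b)]
    congr 1
    funext q
    simp
  · refine Eq.trans ?_ (tangent_mul hD (hr a) (hr b))
    congr 1
    funext q
    simp
  · simp only [AlgHom.commutes]
    exact tangent_const hD c

/-- The coordinate derivations of `A` supply tangent vectors with arbitrary values on `x₁`, `x₂`.
They descend from `A` to functions on points, because by the Nullstellensatz the kernel is the
nilradical and this is stable under derivations. -/
lemma base_charted [IsAlgClosed K] [CharZero K] [Algebra.FiniteType K A]
    (hx : LinearIndependent A (fun i => KaehlerDifferential.D K A (x i)))
    (hx' : Submodule.span A (Set.range (fun i => KaehlerDifferential.D K A (x i))) = ⊤) :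
    (baseStage (K := K) x).Charted := by
  obtain ⟨δ, hδ, hE⟩ := exists_dual_derivations hx hx'
  have change : ∀ {w w' : List (Fin 2)} {q : (baseStage (K := K) x).Pt}, q ∈ (baseStage x).dom w →
      q ∈ (baseStage x).dom w' → ∀ f ∈ (baseStage x).reg w', ∃ f₁ ∈ (baseStage (K := K) x).reg w,
      ∃ g ∈ (baseStage x).reg w,
      g q ≠ 0 ∧ ∀ z ∈ (baseStage x).dom w, g z ≠ 0 → z ∈ (baseStage x).dom w' ∧
        f z = f₁ z / g z :=
    fun hq hq' f hf => ⟨f, hf, 1, one_mem _, by simp, fun z hz _ => ⟨hq', by simp⟩⟩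
  refine ⟨fun q => ⟨[], rfl⟩, change, fun w i => ⟨x i, rfl⟩, fun q => le_rfl, ?_, ?_⟩
  · rintro w _ ⟨a, rfl⟩
    exact ⟨fun i (q : A →ₐ[K] K) => q (δ i a), fun i => ⟨δ i a, rfl⟩,
      fun q _ D hD => hE q D hD a⟩
  · intro w (q : A →ₐ[K] K) hq α
    obtain ⟨D, hD, hDa⟩ := exists_tangent (w := w) hq
      (regularAt_chart_form hq fun hq' => change hq hq')
      (AlgHom.pi fun q : A →ₐ[K] K => q) rfl (fun a => ∑ i, α i * q (δ i a))
      (fun c => by simp) (fun r s => by simp [mul_add, Finset.sum_add_distrib])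
      (fun r s => by
        change ∑ i, α i * q (δ i (r * s)) =
          q r * ∑ i, α i * q (δ i s) + q s * ∑ i, α i * q (δ i r)
        simp [mul_add]
        ring) (fun r hr => by
        have hnil : r ∈ (⊥ : Ideal A).radical :=
          mem_radical_of_forall_algHom ⊥ r fun q' _ => hr q' hq
        have : ∀ i, q (δ i r) = 0 := fun i => by
          obtain ⟨n, hn⟩ := derivation_mem_radical (δ i) (I := ⊥) (by simp) hnil
          have := congrArg q ((Submodule.mem_bot A).1 hn)
          rw [map_pow, map_zero] at this
          exact eq_zero_of_pow_eq_zero this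
        simp [this])
    refine ⟨D, hD, fun i => (hDa (x i)).trans ?_⟩
    simp [hδ, eq_comm]

end Base

section Levels

variable {K : Type u} [Field K] {A : Type v} [CommRing A] [Algebra K A] {x : Fin 2 → A}

lemma level_charted [IsAlgClosed K] [CharZero K] [Algebra.FiniteType K A]
    (hx : LinearIndependent A (fun i => KaehlerDifferential.D K A (x i)))
    (hx' : Submodule.span A (Set.range (fun i => KaehlerDifferential.D K A (x i))) = ⊤) :
    ∀ k, (level K x k).Charted
  | 0 => base_charted hx hx'
  | k + 1 => (level_charted hx hx' k).next

lemma length_of_mem_dom {k : ℕ} {w : List (Fin 2)} {p : S K x k} (hp : p ∈ (level K x k).dom w) :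
    w.length = k := by
  induction k generalizing w with
  | zero =>
    obtain rfl : w = [] := hp
    rfl
  | succ k ih =>
    obtain _ | ⟨a, w⟩ := w
    · exact absurd hp id
    · rw [List.length_cons, ih (p := proj x p) hp.1]

end Levels

/-! ### Vectors tangent to a subset -/

namespace Stage

variable {K : Type u} [Field K] {X : Stage.{u, v} K}

/-- The vector `D` at `q` is tangent to `Z`: it annihilates the regular functions vanishing on `Z`. -/
def IsTangentTo (X : Stage.{u, v} K) (Z : Set X.Pt) (q : X.Pt) (D : (X.Pt → K) → K) : Prop :=
  ∀ h, X.Reg q h → (∀ z ∈ Z, h z = 0) → D h = 0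

lemma isTangentTo_univ {q : X.Pt} {D : (X.Pt → K) → K} (hD : D ∈ X.T q) :
    X.IsTangentTo Set.univ q D := fun h _ hh => by
  obtain rfl : h = 0 := funext fun z => hh z trivial
  exact tangent_zero hD

/-- A vector tangent to `Z` annihilates the functions on a chart which vanish on `Z` there. -/
lemma IsTangentTo.eq_zero {Z : Set X.Pt} {q : X.Pt} {D : (X.Pt → K) → K} (h : X.IsTangentTo Z q D)
    (hD : D ∈ X.T q) {w : List (Fin 2)} (hq : q ∈ X.dom w) {f : X.Pt → K} (hf : f ∈ X.reg w)
    (hfZ : ∀ z ∈ Z, z ∈ X.dom w → f z = 0) : D f = 0 := by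
  classical
  -- Cutting `f` off by zero outside the chart gives a function that vanishes on all of `Z` and
  -- agrees with `f` near `q`.
  let k : X.Pt → K := fun z => if z ∈ X.dom w then f z else 0
  have hk : X.Reg q k :=
    ⟨w, hq, f, hf, 1, one_mem _, by simp, fun z hz _ => by simp [k, hz]⟩
  rw [tangent_congr hD hq (regularAt_of_mem hq hf) hk (one_mem _) (by simp)
    fun z hz _ => by simp [k, hz]]
  refine h k hk fun z hz => ?_
  by_cases hzw : z ∈ X.dom w
  · simp [k, hzw, hfZ z hz hzw]
  · simp [k, hzw]

variable {a : Fin 2} {w : List (Fin 2)}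

/-- Elimination of the new coordinate by means of a linear equation. -/
lemma exists_eliminate {ρ σ : X.Pt → K} (hρ : ρ ∈ X.reg w) (hσ : σ ∈ X.reg w) {f : X.Dir → K}
    (hf : f ∈ X.dirReg (a :: w)) : ∃ n : ℕ, ∃ F ∈ X.reg w, ∃ Q ∈ X.dirReg (a :: w),
      (fun z : X.Dir => σ z.pt) ^ n * f = (fun z => F z.pt) +
        ((fun z => σ z.pt) * X.dirAct (a :: w) (opp a) - fun z => ρ z.pt) * Q := by
  have hσ' := pullback_mem_dirReg (X := X) hσ a
  have hρ' := pullback_mem_dirReg (X := X) hρ a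
  have hL := sub_mem (mul_mem hσ' (dirAct_mem (X := X) (w := w) a)) hρ'
  induction hf using dirReg_induction with
  | pull f hf => exact ⟨0, f, hf, 0, zero_mem _, by simp⟩
  | new => exact ⟨1, ρ, hρ, 1, one_mem _, by simp⟩
  | add f g hf hg ihf ihg =>
    obtain ⟨n, F, hF, Q, hQ, h⟩ := ihf
    obtain ⟨m, G, hG, R, hR, h'⟩ := ihg
    refine ⟨n + m, σ ^ m * F + σ ^ n * G,
      add_mem (mul_mem (pow_mem hσ _) hF) (mul_mem (pow_mem hσ _) hG),
      (fun z => σ z.pt) ^ m * Q + (fun z => σ z.pt) ^ n * R,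
      add_mem (mul_mem (pow_mem hσ' _) hQ) (mul_mem (pow_mem hσ' _) hR), ?_⟩
    have e : (fun z : X.Dir => (σ ^ m * F + σ ^ n * G) z.pt) =
      (fun z => σ z.pt) ^ m * (fun z => F z.pt) + (fun z => σ z.pt) ^ n * fun z => G z.pt := rfl
    rw [e]
    linear_combination (fun z : X.Dir => σ z.pt) ^ m * h + (fun z : X.Dir => σ z.pt) ^ n * h'
  | mul f g hf hg ihf ihg =>
    obtain ⟨n, F, hF, Q, hQ, h⟩ := ihf
    obtain ⟨m, G, hG, R, hR, h'⟩ := ihg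
    refine ⟨n + m, F * G, mul_mem hF hG,
      (fun z => F z.pt) * R + Q * ((fun z => σ z.pt) ^ m * g),
      add_mem (mul_mem (pullback_mem_dirReg hF a) hR) (mul_mem hQ (mul_mem (pow_mem hσ' _) hg)),
      ?_⟩
    have e : (fun z : X.Dir => (F * G) z.pt) = (fun z => F z.pt) * fun z => G z.pt := rfl
    rw [e]
    linear_combination (fun z : X.Dir => σ z.pt) ^ m * g * h + (fun z : X.Dir => F z.pt) * h'

/-- Tangency to a subset of the projectivized bundle which over a chart is the graph, over a subset `Z`
of the base, of a solution of a linear equation for the new coordinate. -/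
lemma Charted.isTangentTo_next (hX : X.Charted) {Z : Set X.Pt} {Z' : Set X.Dir}
    {ρ σ : X.Pt → K} (hρ : ρ ∈ X.reg w) (hσ : σ ∈ X.reg w)
    (hZ' : ∀ q ∈ Z, q ∈ X.dom w → ∃ p ∈ Z', p.pt = q ∧ p ∈ X.dirDom (a :: w) ∧
      σ q * X.dirAct (a :: w) (opp a) p = ρ q)
    {p : X.Dir} (hpZ : p ∈ Z') (hp : p ∈ X.dirDom (a :: w)) (hσp : σ p.pt ≠ 0)
    (hpρ : σ p.pt * X.dirAct (a :: w) (opp a) p = ρ p.pt) (hvec : X.IsTangentTo Z p.pt p.vec)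
    {D : (X.Dir → K) → K} (hD : D ∈ X.dirFoc p)
    (hDρ : σ p.pt * D (X.dirAct (a :: w) (opp a)) + X.dirAct (a :: w) (opp a) p *
      D (fun z => σ z.pt) = D (fun z => ρ z.pt)) :
    X.next.IsTangentTo Z' p D := by
  intro (h : X.Dir → K) (hh : RegularAt X.dirDom X.dirReg p h) (hZh : ∀ z ∈ Z', h z = 0)
  obtain ⟨f, hf, g, hg, hgp, hz⟩ :=
    regularAt_chart_form hp (fun hp' f hf => hX.next_change hp hp' hf) h hh
  have hr : ∀ {f : X.Dir → K}, f ∈ X.dirReg (a :: w) → RegularAt X.dirDom X.dirReg p f :=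
    fun hf => regularAt_of_mem hp hf
  have hT := hD.1
  have hσ' := pullback_mem_dirReg (X := X) hσ a
  have hρ' := pullback_mem_dirReg (X := X) hρ a
  have hy := dirAct_mem (X := X) (w := w) a
  -- Here `σ ^ n * f * g = F + (σ y - ρ) Q`. Over `Z` there are points of `Z'` at which `f * g` and
  -- `σ y - ρ` vanish, so `F` vanishes on `Z` and is killed by tangency of `p.vec`. The vector `D`
  -- kills the linear equation by hypothesis, hence it kills `f * g`, and then `f / g`.
  obtain ⟨n, F, hF, Q, hQ, he⟩ := exists_eliminate (a := a) hρ hσ (mul_mem hf hg)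
  have hfg : ∀ z ∈ Z', z ∈ X.dirDom (a :: w) → (f * g) z = 0 := by
    intro z hzZ hzw
    by_cases h0 : g z = 0
    · simp [h0]
    · have := hz z hzw h0
      rw [hZh z hzZ, eq_comm, div_eq_zero_iff, or_iff_left h0] at this
      simp [this]
  have hFZ : ∀ z ∈ Z, z ∈ X.dom w → F z = 0 := by
    intro z hzZ hzw
    obtain ⟨z', hz', rfl, hz'w, hz'ρ⟩ := hZ' z hzZ hzw
    have := congrFun he z'
    simp only [Pi.mul_apply, Pi.add_apply, Pi.sub_apply, Pi.pow_apply, hz'ρ, sub_self, zero_mul,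
      add_zero] at this
    rw [← this, ← Pi.mul_apply f g, hfg z' hz' hz'w, mul_zero]
  have hvF := hvec.eq_zero (hX.foc_le _ p.vec_mem) hp.1 hF hFZ
  obtain ⟨c, hc⟩ := hD.2
  have hDF : D (fun z => F z.pt) = 0 := by
    rw [hc F (regularAt_of_mem hp.1 hF), hvF, mul_zero]
  have hL := sub_mem (mul_mem hσ' hy) hρ'
  have hDL : D ((fun z => σ z.pt) * X.dirAct (a :: w) (opp a) - fun z => ρ z.pt) = 0 := by
    have h1 := tangent_add hT (hr hL) (hr hρ')
    rw [sub_add_cancel, tangent_mul hT (hr hσ') (hr hy), hDρ] at h1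
    linear_combination -h1
  have h1 := congrArg D he
  rw [tangent_mul hT (hr (pow_mem hσ' n)) (hr (mul_mem hf hg)), hfg p hpZ hp,
    tangent_add hT (hr (pullback_mem_dirReg hF a)) (hr (mul_mem hL hQ)), hDF,
    tangent_mul hT (hr hL) (hr hQ), hDL] at h1
  simp only [Pi.sub_apply, Pi.mul_apply, Pi.pow_apply, hpρ, sub_self, zero_mul, mul_zero,
    add_zero] at h1
  have h2 := (mul_eq_zero.1 h1).resolve_left (pow_ne_zero n hσp)
  have hfp : f p = 0 := by
    have := hz p hp hgp
    rwa [hZh p hpZ, eq_comm, div_eq_zero_iff, or_iff_left hgp] at this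
  rw [tangent_mul hT (hr hf) (hr hg), hfp, zero_mul, zero_add] at h2
  have h3 := (mul_eq_zero.1 h2).resolve_left hgp
  have h4 := tangent_div hT hp hf hg hgp hz
  rw [h3, hZh p hpZ, zero_mul, zero_add] at h4
  exact (mul_eq_zero.1 h4.symm).resolve_left hgp

end Stage

open Stage

/-! ### Density of the points with nonzero parameters -/

section Density

variable {K : Type u} [Field K] {A : Type v} [CommRing A] [Algebra K A] {x : Fin 2 → A}

open MvPolynomial in
/-- A derivation of the coefficients, with prescribed values on the variables, extends to polynomials. -/
lemma exists_extend_derivation {σ : Type*} (d : Derivation K A (MvPolynomial σ A))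
    (y : σ → MvPolynomial σ A) :
    ∃ Δ : MvPolynomial σ A → MvPolynomial σ A, (∀ F G, Δ (F + G) = Δ F + Δ G) ∧
      (∀ F G, Δ (F * G) = F * Δ G + G * Δ F) ∧ (∀ i, Δ (X i) = y i) ∧ ∀ a, Δ (C a) = d a := by
  let φ : A →+* DualNumber (MvPolynomial σ A) :=
    { toFun := fun a => (C a, d a)
      map_one' := by
        refine TrivSqZeroExt.ext ?_ ?_
        · exact C_1
        · exact d.map_one_eq_zero
      map_zero' := by
        refine TrivSqZeroExt.ext ?_ ?_
        · exact C_0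
        · exact map_zero d
      map_add' := fun a b => by
        refine TrivSqZeroExt.ext ?_ ?_
        · exact C_add
        · exact map_add d a b
      map_mul' := fun a b => by
        refine TrivSqZeroExt.ext ?_ ?_
        · exact C_mul
        · change d (a * b) = C a * d b + d a * C b
          rw [d.leibniz, smul_eq_C_mul, smul_eq_C_mul, mul_comm (d a)] }
  -- A derivation is the `ε`-part of a homomorphism to the dual numbers, so the universal property
  -- of the polynomial ring provides the extension.
  let Ψ : MvPolynomial σ A →+* DualNumber (MvPolynomial σ A) :=
    eval₂Hom φ fun i => (X i, y i)
  have hΨC : ∀ a, Ψ (C a) = (C a, d a) := eval₂Hom_C _ _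
  have hΨX : ∀ i, Ψ (X i) = (X i, y i) := eval₂Hom_X' _ _
  have hfst : ∀ F, (Ψ F).fst = F := by
    intro F
    have : (TrivSqZeroExt.fstHom (MvPolynomial σ A) (MvPolynomial σ A)
        (MvPolynomial σ A)).toRingHom.comp Ψ = RingHom.id _ := by
      refine MvPolynomial.ringHom_ext (fun a => ?_) fun i => ?_
      · change (Ψ (C a)).fst = C a
        rw [hΨC]
        rfl
      · change (Ψ (X i)).fst = X i
        rw [hΨX]
        rfl
    exact congrArg (fun f => f F) this
  refine ⟨fun F => (Ψ F).snd, fun F G => by simp, fun F G => ?_, fun i => ?_, fun a => ?_⟩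
  · change (Ψ (F * G)).snd = F * (Ψ G).snd + G * (Ψ F).snd
    rw [map_mul, TrivSqZeroExt.snd_mul, hfst, hfst, smul_eq_mul, op_smul_eq_smul, smul_eq_mul]
  · change (Ψ (X i)).snd = y i
    rw [hΨX]
    rfl
  · change (Ψ (C a)).snd = d a
    rw [hΨC]
    rfl

open MvPolynomial in
/-- If the local coordinates are expressed as polynomials in two parameters, then the points at which
the parameters do not vanish are dense. -/
lemma exists_point_ne_zero [IsAlgClosed K] [CharZero K] [Algebra.FiniteType K A]
    (hx : LinearIndependent A (fun i => KaehlerDifferential.D K A (x i)))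
    (hx' : Submodule.span A (Set.range (fun i => KaehlerDifferential.D K A (x i))) = ⊤)
    (m : Fin 2 → MvPolynomial (Fin 2) K) (G : MvPolynomial (Fin 2) A) (q : A →ₐ[K] K)
    (z : Fin 2 → K) (hq : ∀ i, q (x i) = eval z (m i)) (hG : eval₂ (q : A →+* K) z G ≠ 0) :
    ∃ (q' : A →ₐ[K] K) (z' : Fin 2 → K), (∀ i, q' (x i) = eval z' (m i)) ∧
      eval₂ (q' : A →+* K) z' G ≠ 0 ∧ ∀ i, z' i ≠ 0 := by
  obtain ⟨δ, hδ, -⟩ := exists_dual_derivations hx hx'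
  -- The ideal of the fibre product of the surface and the parameter plane over the coordinate
  -- plane.
  let I : Ideal (MvPolynomial (Fin 2) A) := Ideal.span (Set.range fun i => C (x i) - map (algebraMap K A) (m i))
  let P : MvPolynomial (Fin 2) A →+* K := eval₂Hom (q : A →+* K) z
  have hPX : ∀ i, P (X i) = z i := fun i => by simp [P]
  have hPI : ∀ F ∈ I, P F = 0 := by
    have : I ≤ RingHom.ker P := by
      refine Ideal.span_le.2 ?_
      rintro _ ⟨i, rfl⟩
      have h1 : (q : A →+* K).comp (algebraMap K A) = RingHom.id K := q.comp_algebraMap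
      rw [SetLike.mem_coe, RingHom.mem_ker, map_sub, eval₂Hom_C, coe_eval₂Hom, eval₂_map, h1,
        ← coe_eval₂Hom, RingHom.coe_coe, hq, sub_eq_zero]
      rfl
    exact fun F hF => this hF
  -- The partial derivative along a parameter lifts to the fibre product, because the `d x_i` form a
  -- basis. The coefficients `c` below are those of the chain rule.
  have hΔ : ∀ j, ∃ Δ : MvPolynomial (Fin 2) A → MvPolynomial (Fin 2) A, (∀ F G, Δ (F * G) = F * Δ G + G * Δ F) ∧
      (∀ i, Δ (X i) = if i = j then 1 else 0) ∧ ∀ F ∈ I, Δ F ∈ I := by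
    intro j
    let c : Fin 2 → MvPolynomial (Fin 2) A := fun i => map (algebraMap K A) (pderiv j (m i))
    let E : Fin 2 → Derivation K A (MvPolynomial (Fin 2) A) := fun i =>
      (Algebra.linearMap A (MvPolynomial (Fin 2) A)).compDer (δ i)
    let d : Derivation K A (MvPolynomial (Fin 2) A) := c 0 • E 0 + c 1 • E 1
    have hd : ∀ a, d a = ∑ i, c i * C (δ i a) := by
      intro a
      rw [Fin.sum_univ_two]
      rfl
    obtain ⟨Δ, hadd, hmul, hX, hC⟩ := exists_extend_derivation d fun i => if i = j then 1 else 0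
    refine ⟨Δ, hmul, hX, fun F hF => ?_⟩
    have hK : ∀ p : MvPolynomial (Fin 2) K,
        Δ (map (algebraMap K A) p) = map (algebraMap K A) (pderiv j p) := by
      intro p
      induction p using MvPolynomial.induction_on with
      | C a => simp [hC]
      | add p p' h h' => rw [map_add, hadd, h, h', map_add, map_add]
      | mul_X p i h =>
        rw [map_mul, hmul, h, map_X, hX, Derivation.leibniz, pderiv_X, map_add, smul_eq_mul,
          smul_eq_mul, map_mul, map_mul, map_X]
        congr 1
        by_cases hij : i = j
        · simp [hij]
        · simp [hij]
    have hsub : ∀ F G, Δ (F - G) = Δ F - Δ G := fun F G => by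
      rw [eq_sub_iff_add_eq, ← hadd, sub_add_cancel]
    induction hF using Submodule.span_induction with
    | mem F hF =>
      obtain ⟨i, rfl⟩ := hF
      rw [hsub, hK, hC, hd]
      simp [hδ, c]
    | zero =>
      have : Δ 0 = 0 := by simpa using hadd 0 0
      rw [this]
      exact I.zero_mem
    | add F G _ _ hF hG => exact hadd F G ▸ I.add_mem hF hG
    | smul a F hF h =>
      rw [smul_eq_mul, hmul]
      exact I.add_mem (I.mul_mem_left _ h) (I.mul_mem_right _ hF)
  -- A power of a parameter can be cancelled at the given point. If the parameter is nonzero there,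
  -- evaluation suffices. Otherwise `Δ` is applied repeatedly, each time lowering the exponent of `X
  -- j`.
  have hpow : ∀ j (M : MvPolynomial (Fin 2) A), (∀ Δ : MvPolynomial (Fin 2) A → MvPolynomial (Fin 2) A, (∀ F G, Δ (F * G) = F * Δ G + G * Δ F) →
      (∀ i, Δ (X i) = if i = j then 1 else 0) → Δ M = 0) →
      (∀ H, M * H ∈ I → P H = 0) → ∀ n H, M * X j ^ n * H ∈ I → P H = 0 := by
    intro j M hM hMI n
    by_cases hz : z j = 0
    · obtain ⟨Δ, hmul, hX, hI⟩ := hΔ j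
      induction n with
      | zero => exact fun H h => hMI H (by simpa using h)
      | succ n ih =>
        intro H h
        have hXn : ∀ n : ℕ, Δ (X j ^ (n + 1)) = ((n : MvPolynomial (Fin 2) A) + 1) * X j ^ n := by
          intro n
          induction n with
          | zero => simp [hX]
          | succ n ih =>
            rw [pow_succ, hmul, ih, hX]
            push_cast
            simp
            ring
        have h1 := hI _ h
        rw [hmul, hmul, hM Δ hmul hX, hXn] at h1
        -- At the point the term with `X j` vanishes, so only `(n + 1) H` survives, and `n + 1` is
        -- nonzero in `K`.
        have h2 := ih (((n : MvPolynomial (Fin 2) A) + 1) * H + X j * Δ H) (by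
          convert h1 using 1
          ring)
        rw [map_add, map_mul, map_mul, hPX, hz, zero_mul, add_zero] at h2
        refine (mul_eq_zero.1 h2).resolve_left ?_
        rw [map_add, map_natCast, map_one]
        exact_mod_cast n.succ_ne_zero
    · intro H h
      have := hMI (X j ^ n * H) (by rwa [← mul_assoc])
      rw [map_mul, map_pow, hPX] at this
      exact (mul_eq_zero.1 this).resolve_left (pow_ne_zero n hz)
  by_contra! hno
  -- If no point as required exists, the product of `G` with both parameters vanishes on the whole
  -- fibre product. Cancelling the parameters then contradicts `hG`.
  have hrad : X 0 * X 1 * G ∈ I.radical := by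
    refine mem_radical_of_forall_algHom (K := K) I _ fun Q hQ => ?_
    let q' : A →ₐ[K] K := Q.comp (Algebra.ofId A (MvPolynomial (Fin 2) A) |>.restrictScalars K)
    have hQe : ∀ F, Q F = eval₂ (q' : A →+* K) (fun i => Q (X i)) F := by
      intro F
      have : Q.toRingHom = eval₂Hom (q' : A →+* K) (fun i => Q (X i)) := by
        refine MvPolynomial.ringHom_ext (fun a => ?_) fun i => ?_
        · change Q (C a) = eval₂Hom _ _ (C a)
          rw [eval₂Hom_C]
          rfl
        · simp
      exact congrArg (fun f => f F) this
    by_contra h0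
    rw [map_mul, map_mul, mul_eq_zero, mul_eq_zero, not_or, not_or] at h0
    obtain ⟨i, hi⟩ := hno q' (fun i => Q (X i)) (fun i => by
      have := hQ _ (Ideal.subset_span ⟨i, rfl⟩)
      have h1 : (q' : A →+* K).comp (algebraMap K A) = RingHom.id K := q'.comp_algebraMap
      rw [map_sub, sub_eq_zero, hQe (map _ _), eval₂_map, h1] at this
      exact this) (by rw [← hQe]; exact h0.2)
    fin_cases i
    exacts [h0.1.1 hi, h0.1.2 hi]
  obtain ⟨n, hn⟩ := hrad
  have h1 := hpow 0 1 (fun Δ hmul hX => by simpa using hmul 1 1) (fun H h => hPI H (by simpa using h))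
  have h2 := hpow 1 (X 0 ^ n) (fun Δ hmul hX => by
    have h1 : Δ 1 = 0 := by simpa using hmul 1 1
    clear hn
    induction n with
    | zero => simpa using h1
    | succ n ih => rw [pow_succ, hmul, ih, hX]; simp) (fun H h => h1 n H (by simpa using h)) n (G ^ n)
    (by simpa [mul_pow] using hn)
  rw [map_pow] at h2
  exact hG (eq_zero_of_pow_eq_zero h2)

end Density

/-! ### The monomial locus and the prolonged hyperbolas -/

section Locus

variable {K : Type u} [Field K] {A : Type v} [CommRing A] [Algebra K A]

/-- The exponents `e₁`, `e₂` for which `x₁ x₂` is, on the prolongations of the curves `x₁ x₂ = t`, a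
constant multiple of `x₁(w) ^ e₁ * x₂(w) ^ e₂`. -/
def expo : List (Fin 2) → Fin 2 → ℕ
  | [] => fun _ => 1
  | a :: w => fun i => if i = a then expo w a + expo w (opp a) else expo w i

lemma expo_pos (w : List (Fin 2)) (i : Fin 2) : 0 < expo w i := by
  induction w generalizing i with
  | nil => exact one_pos
  | cons a w ih =>
    simp only [expo]
    split_ifs
    exacts [Nat.add_pos_left (ih a) _, ih i]

lemma expo_ne_zero [CharZero K] (w : List (Fin 2)) (i : Fin 2) : (expo w i : K) ≠ 0 :=
  Nat.cast_ne_zero.2 (expo_pos w i).ne'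

lemma expo_self (a : Fin 2) (w : List (Fin 2)) :
    expo (a :: w) a = expo w a + expo w (opp a) := by
  simp [expo]

lemma expo_opp (a : Fin 2) (w : List (Fin 2)) : expo (a :: w) (opp a) = expo w (opp a) := by
  simp [expo, opp_ne]

variable (x : Fin 2 → A)

/-- The point of the surface over which a point of the tower lies. -/
def basePt : (k : ℕ) → S K x k → (A →ₐ[K] K)
  | 0, p => p
  | k + 1, p => basePt k (proj x p)

/-- The value of `x₁ x₂` at the point of the surface under `p`. -/
def baseProd {k : ℕ} (p : S K x k) : K := basePt x k p (x 0) * basePt x k p (x 1)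

/-- The locus in a chart of the points at which the new coordinates are related to the previous ones
as they are on the prolongations of the curves `x₁ x₂ = t`. -/
def monomialLocus : (k : ℕ) → List (Fin 2) → Set (S K x k)
  | 0, w => {_p | w = []}
  | _ + 1, [] => ∅
  | k + 1, a :: w => {p | proj x p ∈ monomialLocus k w ∧ p ∈ (level K x (k + 1)).dom (a :: w) ∧
      expo w a * (level K x k).act w (opp a) (proj x p) +
        expo w (opp a) * (level K x k).act w a (proj x p) *
          (level K x (k + 1)).act (a :: w) (opp a) p = 0}

variable {x}

lemma mem_level_dom {k : ℕ} {a : Fin 2} {w : List (Fin 2)} {p : S K x (k + 1)} :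
    p ∈ (level K x (k + 1)).dom (a :: w) ↔ proj x p ∈ (level K x k).dom w ∧
      Dir.vec (X := level K x k) p ((level K x k).act w a) ≠ 0 := Iff.rfl

lemma level_act_self {k : ℕ} (a : Fin 2) (w : List (Fin 2)) (p : S K x (k + 1)) :
    (level K x (k + 1)).act (a :: w) a p = (level K x k).act w a (proj x p) :=
  congrFun (dirAct_self (X := level K x k)) p

lemma level_act_opp {k : ℕ} (a : Fin 2) (w : List (Fin 2)) (p : S K x (k + 1)) :
    (level K x (k + 1)).act (a :: w) (opp a) p =
      Dir.vec (X := level K x k) p ((level K x k).act w (opp a)) /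
        Dir.vec (X := level K x k) p ((level K x k).act w a) :=
  dirAct_opp (X := level K x k) p

lemma mem_dom_of_mem_monomialLocus {k : ℕ} {w : List (Fin 2)} {p : S K x k}
    (hp : p ∈ monomialLocus x k w) : p ∈ (level K x k).dom w := by
  obtain _ | k := k
  · exact hp
  · obtain _ | ⟨a, w⟩ := w
    · exact absurd hp id
    · exact hp.2.1

/-- The relation `e_a x_b + e_b x_a y = 0` has nonzero coefficients, so `x_a y = 0` exactly when
`x_b = 0`, and `x_a = 0` implies both. The products of the active coordinates at consecutive levels
thus vanish simultaneously. -/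
lemma monomialLocus_prod [CharZero K] {k : ℕ} {w : List (Fin 2)} {p : S K x k}
    (hp : p ∈ monomialLocus x k w) :
    ∏ i, (level K x k).act w i p = 0 ↔ baseProd x p = 0 := by
  induction k generalizing w with
  | zero =>
    rw [Fin.prod_univ_two]
    rfl
  | succ k ih =>
    obtain _ | ⟨a, w⟩ := w
    · exact absurd hp id
    obtain ⟨h1, h2, h3⟩ := hp
    refine Iff.trans ?_ (ih h1)
    have ha := expo_ne_zero (K := K) w a
    have hb := expo_ne_zero (K := K) w (opp a)
    have hprod : ∀ f : Fin 2 → K, ∏ i, f i = f a * f (opp a) := fun f =>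
      sum_letters (M := Additive K) f a
    rw [hprod, hprod, level_act_self]
    generalize (level K x k).act w (opp a) (proj x p) = v at *
    generalize (level K x k).act w a (proj x p) = s at *
    generalize (level K x (k + 1)).act (a :: w) (opp a) p = y at *
    constructor
    · intro h
      rw [mul_assoc, h, mul_zero, add_zero] at h3
      rw [(mul_eq_zero.1 h3).resolve_left ha, mul_zero]
    · intro h
      rcases mul_eq_zero.1 h with rfl | rfl
      · rw [zero_mul]
      · rw [mul_zero, zero_add, mul_assoc] at h3
        exact (mul_eq_zero.1 h3).resolve_left hb

lemma act_ne_zero_of_mem_monomialLocus [CharZero K] {k : ℕ} {w : List (Fin 2)} {p : S K x k}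
    (hp : p ∈ monomialLocus x k w) (h : baseProd x p ≠ 0) (i : Fin 2) :
    (level K x k).act w i p ≠ 0 := fun h0 =>
  h ((monomialLocus_prod hp).1 (Finset.prod_eq_zero (Finset.mem_univ i) h0))

variable [IsAlgClosed K] [CharZero K] [Algebra.FiniteType K A]
    (hx : LinearIndependent A (fun i => KaehlerDifferential.D K A (x i)))
    (hx' : Submodule.span A (Set.range (fun i => KaehlerDifferential.D K A (x i))) = ⊤)
include hx hx'

/-- The tangent directions to the curve `x₁ x₂ = t` on the surface. -/
lemma isTangentTo_curve_zero {t : K} (ht : t ≠ 0) {q : A →ₐ[K] K} (hq : q ∈ curve x t 0)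
    {D : ((A →ₐ[K] K) → K) → K} (hD : D ∈ (baseStage x).foc q) :
    (baseStage x).IsTangentTo (curve x t 0) q D ↔
      ∑ i, q (x (opp i)) * D (fun q : A →ₐ[K] K => q (x i)) = 0 := by
  obtain ⟨δ, hδ, hDδ⟩ := exists_dual_derivations hx hx'
  have hq' : q (x 0) * q (x 1) = t := hq
  rw [Fin.sum_univ_two]
  change _ ↔ q (x 1) * _ + q (x 0) * _ = 0
  have hdom : q ∈ (baseStage (K := K) x).dom [] := rfl
  constructor
  · intro h
    have h1 := h.eq_zero hD hdom (f := fun q : A →ₐ[K] K => q (x 0 * x 1 - algebraMap K A t))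
      ⟨_, rfl⟩ (fun z hz _ => by
        have hz' : (show A →ₐ[K] K from z) (x 0) * (show A →ₐ[K] K from z) (x 1) = t := hz
        change (show A →ₐ[K] K from z) (x 0 * x 1 - algebraMap K A t) = 0
        rw [map_sub, map_mul, hz', AlgHom.commutes, Algebra.algebraMap_self_apply, sub_self])
    rw [hDδ q D hD, Fin.sum_univ_two] at h1
    simpa [Derivation.leibniz, hδ] using h1
  · intro h k hk hkZ
    obtain ⟨f, ⟨f, rfl⟩, g, ⟨g, rfl⟩, hgq, hz⟩ := (base_charted hx hx').chart_form hdom k hk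
    change q g ≠ 0 at hgq
    have hkq := hkZ q hq
    set I : Ideal A := Ideal.span {x 0 * x 1 - algebraMap K A t} with hI
    have hrad : f * g ∈ I.radical := by
      refine mem_radical_of_forall_algHom (K := K) I _ fun z hzI => ?_
      have h1 := hzI _ (Ideal.subset_span rfl)
      rw [map_sub, map_mul, AlgHom.commutes, sub_eq_zero] at h1
      rw [map_mul]
      by_cases h0 : z g = 0
      · rw [h0, mul_zero]
      · have := hz z rfl h0
        rw [hkZ z h1, eq_comm, div_eq_zero_iff] at this
        have h2 : z f = 0 := this.resolve_right h0
        rw [h2, zero_mul]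
    -- The tangent field of the hyperbolas: it annihilates `x₁ x₂ - t`, hence preserves the ideal
    -- and its radical. As `x 0` is nonzero at `q`, every `D` satisfying the linear equation is a
    -- multiple of its value at `q`.
    let Δ : Derivation K A A := x 0 • δ 0 - x 1 • δ 1
    have hΔ : Δ (f * g) ∈ I.radical := by
      refine derivation_mem_radical Δ (fun a ha => ?_) hrad
      have h0 : Δ (x 0 * x 1 - algebraMap K A t) = 0 := by
        simp [Δ, Derivation.leibniz, hδ]
        ring
      obtain ⟨b, rfl⟩ := Ideal.mem_span_singleton'.1 ha
      rw [Derivation.leibniz, h0, smul_zero, zero_add, smul_eq_mul]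
      exact I.mul_mem_right _ (Ideal.subset_span rfl)
    have hΔq : q (Δ (f * g)) = 0 := by
      obtain ⟨n, hn⟩ := hΔ
      obtain ⟨b, hb⟩ := Ideal.mem_span_singleton'.1 hn
      have := congrArg q hb
      rw [map_mul, map_sub, map_mul, AlgHom.commutes, Algebra.algebraMap_self_apply, hq', sub_self,
        mul_zero, map_pow] at this
      exact eq_zero_of_pow_eq_zero this.symm
    have hDfg : D (fun q : A →ₐ[K] K => q (f * g)) = 0 := by
      have h0 : q (x 0) ≠ 0 := by rintro h0; simp [h0, eq_comm, ht] at hq'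
      rw [hDδ q D hD, Fin.sum_univ_two]
      simp only [Δ, Derivation.sub_apply, Derivation.smul_apply, map_sub, smul_eq_mul, map_mul]
        at hΔq ⊢
      refine mul_left_cancel₀ h0 ?_
      linear_combination D (fun q : A →ₐ[K] K => q (x 0)) * hΔq + q (δ 1 (f * g)) * h
    have hf0 : q f = 0 := by
      have := hz q rfl hgq
      rw [hkq, eq_comm, div_eq_zero_iff] at this
      exact this.resolve_right hgq
    have hr : ∀ a : A, RegularAt (baseStage x).dom (baseStage x).reg q
      (fun q : A →ₐ[K] K => q a) := fun a => regularAt_of_mem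
        (dom := (baseStage (K := K) x).dom) (reg := (baseStage x).reg) hdom ⟨a, rfl⟩
    have h1 := tangent_mul hD (hr f) (hr g)
    have h2 : (fun q : A →ₐ[K] K => q f) * (fun q : A →ₐ[K] K => q g) =
        fun q : A →ₐ[K] K => q (f * g) := by
      funext q
      simp
    rw [h2, hDfg, hf0, zero_mul, zero_add] at h1
    have h3 := tangent_div hD hdom (f := fun q : A →ₐ[K] K => q f) (g := fun q : A →ₐ[K] K => q g)
      ⟨f, rfl⟩ ⟨g, rfl⟩ hgq hz
    rw [hkq, zero_mul, zero_add, (mul_eq_zero.1 h1.symm).resolve_left hgq] at h3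
    exact (mul_eq_zero.1 h3.symm).resolve_left hgq

/-- The prolongations of the curves `x₁ x₂ = t` and their tangent directions, in a chart. -/
lemma curve_chart {t : K} (ht : t ≠ 0) {k : ℕ} {w : List (Fin 2)} {p : S K x k}
    (hp : p ∈ (level K x k).dom w) :
    (p ∈ curve x t k ↔ p ∈ monomialLocus x k w ∧ baseProd x p = t) ∧
      (p ∈ curve x t k → ∀ D ∈ (level K x k).foc p, (level K x k).IsTangentTo (curve x t k) p D ↔
        ∑ i, expo w i * (level K x k).act w (opp i) p * D ((level K x k).act w i) = 0) := by
  induction k generalizing w with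
  | zero =>
    obtain rfl : w = [] := hp
    refine ⟨⟨fun h => ⟨rfl, h⟩, fun h => h.2⟩, fun hpc D hD => ?_⟩
    refine (isTangentTo_curve_zero hx hx' ht hpc hD).trans ?_
    simp only [expo, Nat.cast_one, one_mul]
    rfl
  | succ k ih =>
    obtain _ | ⟨a, w⟩ := w
    · exact absurd hp id
    have hX := level_charted hx hx' k
    -- A direction is tangent to the lower curve if `e_a x_b dx_a + e_b x_a dx_b = 0`. Division by
    -- `dx_a`, which is nonzero in this chart, gives the relation for the new coordinate.
    have h1 : ∀ p ∈ (level K x (k + 1)).dom (a :: w),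
        p ∈ curve x t (k + 1) ↔ p ∈ monomialLocus x (k + 1) (a :: w) ∧ baseProd x p = t := by
      intro p hp
      have hp' := mem_level_dom.1 hp
      have : p ∈ curve x t (k + 1) ↔ proj x p ∈ curve x t k ∧
        (level K x k).IsTangentTo (curve x t k) (proj x p) (Dir.vec (X := level K x k) p) := Iff.rfl
      rw [this, and_congr_right fun h => (ih hp'.1).2 h _ (Dir.vec_mem (X := level K x k) p),
        (ih hp'.1).1]
      have e : p ∈ monomialLocus x (k + 1) (a :: w) ↔ proj x p ∈ monomialLocus x k w ∧
        p ∈ (level K x (k + 1)).dom (a :: w) ∧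
        expo w a * (level K x k).act w (opp a) (proj x p) +
        expo w (opp a) * (level K x k).act w a (proj x p) *
          (level K x (k + 1)).act (a :: w) (opp a) p = 0 := Iff.rfl
      rw [e, sum_letters _ a, opp_opp, level_act_opp]
      have hv := hp'.2
      generalize Dir.vec (X := level K x k) p ((level K x k).act w a) = s at *
      generalize Dir.vec (X := level K x k) p ((level K x k).act w (opp a)) = r at *
      have e2 : (expo w a * (level K x k).act w (opp a) (proj x p) * s +
          expo w (opp a) * (level K x k).act w a (proj x p) * r = 0) ↔
          (expo w a * (level K x k).act w (opp a) (proj x p) +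
          expo w (opp a) * (level K x k).act w a (proj x p) * (r / s) = 0) := by
        have e4 : expo w a * (level K x k).act w (opp a) (proj x p) * s +
          expo w (opp a) * (level K x k).act w a (proj x p) * r =
          (expo w a * (level K x k).act w (opp a) (proj x p) +
          expo w (opp a) * (level K x k).act w a (proj x p) * (r / s)) * s := by
          field_simp
        rw [e4, mul_eq_zero, or_iff_left hv]
      rw [e2]
      have e3 : baseProd x p = baseProd x (proj x p) := rfl
      rw [e3]
      tauto
    refine ⟨h1 p hp, fun hpc D hD => ?_⟩
    have hp' := mem_level_dom.1 hp
    have hpZ := ((h1 p hp).1 hpc)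
    let X := level K x k
    let q : X.Dir := p
    have hu : X.act w a ∈ X.reg w := hX.act_mem w a
    have hv : X.act w (opp a) ∈ X.reg w := hX.act_mem w (opp a)
    -- The relation is read as `σ y = ρ` with `σ = e_b x_a` and `ρ = -e_a x_b`. On the curve `σ` is
    -- nonzero because `t` is, so the prolongation is a graph.
    have hσ : (expo w (opp a) : K) • X.act w a ∈ X.reg w := Subalgebra.smul_mem _ hu _
    have hρ : (-(expo w a) : K) • X.act w (opp a) ∈ X.reg w := Subalgebra.smul_mem _ hv _
    have hσ' := pullback_mem_dirReg (X := X) hσ a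
    have hρ' := pullback_mem_dirReg (X := X) hρ a
    have hy := dirAct_mem (X := X) (w := w) a
    have hT : D ∈ tangent X.dirDom X.dirReg q := hD.1
    have hdom : q ∈ X.dirDom (a :: w) := hp
    have hr : ∀ {f : X.Dir → K}, f ∈ X.dirReg (a :: w) → RegularAt X.dirDom X.dirReg q f :=
      fun hf => regularAt_of_mem hdom hf
    obtain ⟨c, hc⟩ := hD.2
    have hc' : ∀ f ∈ X.reg w, D (fun z : X.Dir => f z.pt) = c * q.vec f :=
      fun f hf => hc f (regularAt_of_mem hp'.1 hf)
    have hsmul : ∀ (e : K) (f : X.Pt → K), f ∈ X.reg w → q.vec (e • f) = e * q.vec f := by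
      intro e f hf
      have h2 := tangent_mul (hX.foc_le _ (Dir.vec_mem (X := X) q))
        (regularAt_of_mem hp'.1 ((X.reg w).algebraMap_mem e)) (regularAt_of_mem hp'.1 hf)
      rw [tangent_algebraMap (hX.foc_le _ (Dir.vec_mem (X := X) q)), mul_zero, add_zero,
        ← Algebra.smul_def] at h2
      exact h2
    have hDσ : D (fun z : X.Dir => ((expo w (opp a) : K) • X.act w a) z.pt) =
        expo w (opp a) * D (X.dirAct (a :: w) a) := by
      rw [hc' _ hσ, hsmul _ _ hu, dirAct_self, hc' _ hu]
      ring
    have hDρ : D (fun z : X.Dir => ((-(expo w a) : K) • X.act w (opp a)) z.pt) =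
        -expo w a * (X.dirAct (a :: w) (opp a) q * D (X.dirAct (a :: w) a)) := by
      rw [hc' _ hρ, hsmul _ _ hv, dirAct_self, hc' _ hu, dirAct_opp]
      have : q.vec (X.act w a) ≠ 0 := hp'.2
      field_simp
    -- Differentiating `σ y = ρ` and substituting `dx_b = y dx_a` gives `(e_a + e_b) y dx_a + e_b
    -- x_a dy = 0`, whose coefficients are the exponents of the new chart.
    have hiff : (∑ i, expo (a :: w) i * (level K x (k + 1)).act (a :: w) (opp i) p *
          D ((level K x (k + 1)).act (a :: w) i) = 0) ↔
        ((expo w (opp a) : K) • X.act w a) q.pt * D (X.dirAct (a :: w) (opp a)) +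
          X.dirAct (a :: w) (opp a) q *
            D (fun z : X.Dir => ((expo w (opp a) : K) • X.act w a) z.pt) =
          D (fun z : X.Dir => ((-(expo w a) : K) • X.act w (opp a)) z.pt) := by
      rw [hDσ, hDρ, sum_letters _ a, opp_opp, level_act_self, expo_self, expo_opp, ← sub_eq_zero
        (a := _ + _ * (_ * _))]
      push_cast
      refine Eq.congr_left ?_
      change _ = (expo w (opp a) : K) * X.act w a q.pt * _ + _ - _
      change (_ + _ : K) * X.dirAct (a :: w) (opp a) q * D (X.dirAct (a :: w) a) +
        _ * X.act w a q.pt * D (X.dirAct (a :: w) (opp a)) = _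
      ring
    have hgraph : ∀ z : X.Dir, z ∈ X.dirDom (a :: w) → z.pt ∈ monomialLocus x k w →
        (z ∈ monomialLocus x (k + 1) (a :: w) ↔ ((expo w (opp a) : K) • X.act w a) z.pt *
          X.dirAct (a :: w) (opp a) z = ((-(expo w a) : K) • X.act w (opp a)) z.pt) := by
      intro z hz hzm
      have : z ∈ monomialLocus x (k + 1) (a :: w) ↔ z.pt ∈ monomialLocus x k w ∧
        z ∈ X.dirDom (a :: w) ∧
        expo w a * X.act w (opp a) z.pt +
        expo w (opp a) * X.act w a z.pt * X.dirAct (a :: w) (opp a) z = 0 := Iff.rfl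
      rw [this]
      simp only [hz, hzm, true_and, Pi.smul_apply, smul_eq_mul, neg_mul]
      rw [eq_neg_iff_add_eq_zero, add_comm]
    have hne : ∀ z ∈ curve x t k, z ∈ X.dom w → z ∈ monomialLocus x k w ∧ baseProd x z = t ∧
        ((expo w (opp a) : K) • X.act w a) z ≠ 0 := by
      intro z hz hzw
      have h2 := (ih hzw).1.1 hz
      refine ⟨h2.1, h2.2, ?_⟩
      exact mul_ne_zero (expo_ne_zero _ _)
        (act_ne_zero_of_mem_monomialLocus h2.1 (h2.2 ▸ ht) a)
    rw [hiff]
    constructor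
    · intro h
      have h2 : D ((fun z : X.Dir => ((expo w (opp a) : K) • X.act w a) z.pt) *
          X.dirAct (a :: w) (opp a) -
          fun z : X.Dir => ((-(expo w a) : K) • X.act w (opp a)) z.pt) = 0 :=
        h.eq_zero (X := level K x (k + 1)) (w := a :: w) hT hdom (sub_mem (mul_mem hσ' hy) hρ') (fun z hz hzw => by
        have h3 := hne (Dir.pt (X := X) z) hz.1 hzw.1
        have h4 := (hgraph z hzw h3.1).1 ((h1 z hzw).1 hz).1
        exact sub_eq_zero.2 h4)
      have h3 := tangent_add hT (hr (sub_mem (mul_mem hσ' hy) hρ')) (hr hρ')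
      rw [sub_add_cancel, tangent_mul hT (hr hσ') (hr hy)] at h3
      exact h3.trans (by rw [add_eq_right]; exact h2)
    · intro h
      have h3 := hne (Dir.pt (X := X) q) hpc.1 hp'.1
      refine hX.isTangentTo_next hρ hσ (fun z hz hzw => ?_) hpc hdom h3.2.2
        ((hgraph q hdom h3.1).1 hpZ.1) hpc.2 hD h
      have h4 := hne z hz hzw
      obtain ⟨z', rfl, hz', hz'y⟩ := hX.exists_dir_chart hzw a
        (((-(expo w a) : K) • X.act w (opp a)) z / ((expo w (opp a) : K) • X.act w a) z)
      have h5 : ((expo w (opp a) : K) • X.act w a) z'.pt * X.dirAct (a :: w) (opp a) z' =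
          ((-(expo w a) : K) • X.act w (opp a)) z'.pt := by
        rw [hz'y, mul_div_cancel₀ _ h4.2.2]
      exact ⟨z', (h1 z' hz').2 ⟨(hgraph z' hz' h4.1).2 h5, h4.2.1⟩, rfl, hz', h5⟩

end Locus

/-! ### Coordinates on the monomial locus -/

section Parametrization

variable {K : Type u} [Field K] {A : Type v} [CommRing A] [Algebra K A] {x : Fin 2 → A}

open MvPolynomial in
/-- The active coordinates of the chart `w` in terms of those of the chart `a :: w`, on the monomial
locus. -/
noncomputable def monomialSubst (K : Type u) [Field K] (R : Type*) [CommRing R] [Algebra K R]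
    (a : Fin 2) (w : List (Fin 2)) : Fin 2 → MvPolynomial (Fin 2) R :=
  fun i => if i = a then X a else
    C (algebraMap K R (-(expo w (opp a) / expo w a))) * (X a * X (opp a))

open MvPolynomial in
/-- The local coordinates of the surface in terms of the active coordinates of the chart `w`, on the
monomial locus. -/
noncomputable def baseMonomial (K : Type u) [Field K] :
    List (Fin 2) → Fin 2 → MvPolynomial (Fin 2) K
  | [] => X
  | a :: w => fun i => bind₁ (monomialSubst K K a w) (baseMonomial K w i)

lemma eval_monomialSubst {R : Type*} [CommRing R] [Algebra K R] (q : R →ₐ[K] K) (z : Fin 2 → K)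
    (a : Fin 2) (w : List (Fin 2)) (i : Fin 2) :
    MvPolynomial.eval₂ (q : R →+* K) z (monomialSubst K R a w i) =
      if i = a then z a else -(expo w (opp a) / expo w a) * (z a * z (opp a)) := by
  unfold monomialSubst
  split_ifs with h
  · simp
  · simp

variable [CharZero K]

lemma monomialLocus_cons {k : ℕ} {a : Fin 2} {w : List (Fin 2)} {p : S K x (k + 1)} :
    p ∈ monomialLocus x (k + 1) (a :: w) ↔ proj x p ∈ monomialLocus x k w ∧
      p ∈ (level K x (k + 1)).dom (a :: w) ∧
      (level K x k).act w (opp a) (proj x p) = -(expo w (opp a) / expo w a) *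
        ((level K x (k + 1)).act (a :: w) a p * (level K x (k + 1)).act (a :: w) (opp a) p) := by
  have h : p ∈ monomialLocus x (k + 1) (a :: w) ↔ proj x p ∈ monomialLocus x k w ∧
      p ∈ (level K x (k + 1)).dom (a :: w) ∧
      expo w a * (level K x k).act w (opp a) (proj x p) +
        expo w (opp a) * (level K x k).act w a (proj x p) *
          (level K x (k + 1)).act (a :: w) (opp a) p = 0 := Iff.rfl
  rw [h, level_act_self]
  refine and_congr_right fun _ => and_congr_right fun _ => ?_
  have := expo_ne_zero (K := K) w a
  generalize (level K x k).act w (opp a) (proj x p) = v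
  generalize (level K x k).act w a (proj x p) = s
  generalize (level K x (k + 1)).act (a :: w) (opp a) p = y
  constructor
  · intro h
    field_simp
    linear_combination h
  · rintro rfl
    field_simp
    ring

/-- The evaluation homomorphism `q` is arbitrary because the coefficients of the substitution come
from `K`. This serves both scalar polynomials and polynomials over `A`. -/
lemma act_proj_eq {k : ℕ} {a : Fin 2} {w : List (Fin 2)} {p : S K x (k + 1)}
    (hp : p ∈ monomialLocus x (k + 1) (a :: w)) (i : Fin 2) {R : Type*} [CommRing R] [Algebra K R]
    (q : R →ₐ[K] K) :
    (level K x k).act w i (proj x p) = MvPolynomial.eval₂ (q : R →+* K)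
      (fun i => (level K x (k + 1)).act (a :: w) i p) (monomialSubst K R a w i) := by
  rw [eval_monomialSubst]
  obtain rfl | rfl := eq_or_eq_opp a i
  · simp [level_act_self]
  · simp [opp_ne, (monomialLocus_cons.1 hp).2.2]

lemma eval₂_bind₁_monomialSubst {k : ℕ} {a : Fin 2} {w : List (Fin 2)} {p : S K x (k + 1)}
    (hp : p ∈ monomialLocus x (k + 1) (a :: w)) {R : Type*} [CommRing R] [Algebra K R]
    (q : R →ₐ[K] K) (G : MvPolynomial (Fin 2) R) :
    MvPolynomial.eval₂ (q : R →+* K) (fun i => (level K x (k + 1)).act (a :: w) i p)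
      (MvPolynomial.bind₁ (monomialSubst K R a w) G) =
      MvPolynomial.eval₂ (q : R →+* K) (fun i => (level K x k).act w i (proj x p)) G := by
  rw [← MvPolynomial.coe_eval₂Hom, MvPolynomial.eval₂Hom_bind₁, MvPolynomial.coe_eval₂Hom]
  congr 1
  funext i
  exact (act_proj_eq hp i q).symm

/-- On the monomial locus the functions on a chart are polynomials in the active coordinates. -/
lemma exists_poly_of_mem_reg {k : ℕ} {w : List (Fin 2)} {f : S K x k → K}
    (hf : f ∈ (level K x k).reg w) : ∃ G : MvPolynomial (Fin 2) A, ∀ p ∈ monomialLocus x k w,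
      f p = MvPolynomial.eval₂ (basePt x k p : A →+* K)
        (fun i => (level K x k).act w i p) G := by
  induction k generalizing w with
  | zero =>
    obtain ⟨a, rfl⟩ := hf
    refine ⟨MvPolynomial.C a, fun p _ => ?_⟩
    rw [MvPolynomial.eval₂_C]
    rfl
  | succ k ih =>
    obtain _ | ⟨a, w⟩ := w
    · exact ⟨0, fun p hp => absurd hp id⟩
    have hf' : f ∈ (level K x k).dirReg (a :: w) := hf
    clear hf
    induction hf' using dirReg_induction with
    | pull f hf =>
      obtain ⟨G, hG⟩ := ih hf
      refine ⟨MvPolynomial.bind₁ (monomialSubst K A a w) G, fun p hp => ?_⟩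
      rw [eval₂_bind₁_monomialSubst hp]
      exact hG _ hp.1
    | new => exact ⟨MvPolynomial.X (opp a), fun p hp => by rw [MvPolynomial.eval₂_X]; rfl⟩
    | add f g hf hg ihf ihg =>
      obtain ⟨F, hF⟩ := ihf
      obtain ⟨G, hG⟩ := ihg
      refine ⟨F + G, fun p hp => ?_⟩
      rw [MvPolynomial.eval₂_add, ← hF p hp, ← hG p hp]
      rfl
    | mul f g hf hg ihf ihg =>
      obtain ⟨F, hF⟩ := ihf
      obtain ⟨G, hG⟩ := ihg
      refine ⟨F * G, fun p hp => ?_⟩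
      rw [MvPolynomial.eval₂_mul, ← hF p hp, ← hG p hp]
      rfl

lemma basePt_eq_eval {k : ℕ} {w : List (Fin 2)} {p : S K x k} (hp : p ∈ monomialLocus x k w)
    (i : Fin 2) : basePt x k p (x i) =
      MvPolynomial.eval (fun i => (level K x k).act w i p) (baseMonomial K w i) := by
  induction k generalizing w with
  | zero =>
    obtain rfl : w = [] := hp
    rw [baseMonomial, MvPolynomial.eval_X]
    rfl
  | succ k ih =>
    obtain _ | ⟨a, w⟩ := w
    · exact absurd hp id
    · exact (ih hp.1).trans (eval₂_bind₁_monomialSubst hp (AlgHom.id K K) (baseMonomial K w i)).symm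

omit [CharZero K] in
lemma base_mem_reg {k : ℕ} {w : List (Fin 2)} (hw : w.length = k) (b : A) :
    (fun p : S K x k => basePt x k p b) ∈ (level K x k).reg w := by
  induction k generalizing w with
  | zero => exact ⟨b, rfl⟩
  | succ k ih =>
    obtain _ | ⟨a, w⟩ := w
    · simp at hw
    · exact pullback_mem_dirReg (X := level K x k) (ih (by simpa using hw)) a

omit [CharZero K] in
lemma baseProd_mem_reg {k : ℕ} {w : List (Fin 2)} (hw : w.length = k) :
    baseProd (K := K) x (k := k) ∈ (level K x k).reg w :=
  mul_mem (base_mem_reg hw (x 0)) (base_mem_reg hw (x 1))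

variable [IsAlgClosed K] [Algebra.FiniteType K A]
    (hx : LinearIndependent A (fun i => KaehlerDifferential.D K A (x i)))
    (hx' : Submodule.span A (Set.range (fun i => KaehlerDifferential.D K A (x i))) = ⊤)
include hx hx'

lemma exists_dir_level {k : ℕ} {w : List (Fin 2)} {q : S K x k} (hq : q ∈ (level K x k).dom w)
    (a : Fin 2) (s : K) : ∃ p : S K x (k + 1), proj x p = q ∧
      p ∈ (level K x (k + 1)).dom (a :: w) ∧ (level K x (k + 1)).act (a :: w) (opp a) p = s :=
  (level_charted hx hx' k).exists_dir_chart hq a s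

lemma dir_ext_level {k : ℕ} {a : Fin 2} {w : List (Fin 2)} {p p' : S K x (k + 1)}
    (hp : p ∈ (level K x (k + 1)).dom (a :: w)) (hp' : p' ∈ (level K x (k + 1)).dom (a :: w))
    (h : proj x p = proj x p')
    (hy : (level K x (k + 1)).act (a :: w) (opp a) p =
      (level K x (k + 1)).act (a :: w) (opp a) p') : p = p' :=
  (level_charted hx hx' k).dir_ext hp hp' h hy

/-- The points of the monomial locus, in terms of the active coordinates. -/
lemma exists_mem_monomialLocus {k : ℕ} {w : List (Fin 2)} (hw : w.length = k) (q : A →ₐ[K] K)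
    (z : Fin 2 → K) (hq : ∀ i, q (x i) = MvPolynomial.eval z (baseMonomial K w i)) :
    ∃ p ∈ monomialLocus x k w, basePt x k p = q ∧ ∀ i, (level K x k).act w i p = z i := by
  induction k generalizing w z with
  | zero =>
    obtain rfl := List.length_eq_zero_iff.1 hw
    exact ⟨q, rfl, rfl, fun i => (hq i).trans (MvPolynomial.eval_X i)⟩
  | succ k ih =>
    obtain _ | ⟨a, w⟩ := w
    · simp at hw
    -- The active coordinates one level below are forced by the monomial relation.
    let z' : Fin 2 → K := fun i => MvPolynomial.eval z (monomialSubst K K a w i)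
    have hz' : ∀ i, z' i = if i = a then z a else
        -(expo w (opp a) / expo w a) * (z a * z (opp a)) :=
      fun i => eval_monomialSubst (AlgHom.id K K) z a w i
    obtain ⟨p, hp, rfl, hpz⟩ := ih (by simpa using hw) z' fun i => by
      rw [hq i]
      exact MvPolynomial.eval₂Hom_bind₁ (RingHom.id K) z (monomialSubst K K a w) _
    obtain ⟨p', rfl, hp', hy⟩ := exists_dir_level hx hx' (mem_dom_of_mem_monomialLocus hp) a
      (z (opp a))
    have ha : (level K x (k + 1)).act (a :: w) a p' = z a := by
      rw [level_act_self, hpz, hz', if_pos rfl]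
    refine ⟨p', monomialLocus_cons.2 ⟨hp, hp', ?_⟩, rfl, (forall_letter a).2 ⟨ha, hy⟩⟩
    rw [hpz, hz', if_neg (opp_ne a), ha, hy]

/-- Active coordinates determine those of each lower level through the monomial relation. The base
point has to be compared separately, since distinct points of the surface may share their values of
`x₁` and `x₂`. -/
lemma monomialLocus_ext {k : ℕ} {w : List (Fin 2)} {p p' : S K x k} (hp : p ∈ monomialLocus x k w)
    (hp' : p' ∈ monomialLocus x k w) (hb : basePt x k p = basePt x k p')
    (h : ∀ i, (level K x k).act w i p = (level K x k).act w i p') : p = p' := by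
  induction k generalizing w with
  | zero => exact hb
  | succ k ih =>
    obtain _ | ⟨a, w⟩ := w
    · exact absurd hp id
    refine dir_ext_level hx hx' hp.2.1 hp'.2.1 (ih hp.1 hp'.1 hb fun i => ?_) (h _)
    rw [act_proj_eq hp i (AlgHom.id K K), act_proj_eq hp' i (AlgHom.id K K)]
    simp only [h]

/-- Near a point of a chart outside the monomial locus some function vanishing on this locus does not
vanish. -/
lemma exists_reg_of_notMem_monomialLocus {k : ℕ} {w : List (Fin 2)} {p : S K x k}
    (hp : p ∈ (level K x k).dom w) (hpm : p ∉ monomialLocus x k w) :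
    ∃ f ∈ (level K x k).reg w, f p ≠ 0 ∧ ∀ z ∈ monomialLocus x k w, f z = 0 := by
  induction k generalizing w with
  | zero => exact absurd hp hpm
  | succ k ih =>
    obtain _ | ⟨a, w⟩ := w
    · exact absurd hp id
    by_cases h : proj x p ∈ monomialLocus x k w
    · have hX := level_charted hx hx' k
      have hX' := level_charted hx hx' (k + 1)
      refine ⟨(fun z => expo w a * (level K x k).act w (opp a) (proj x z)) +
        (fun z => expo w (opp a) * (level K x k).act w a (proj x z)) *
          (level K x (k + 1)).act (a :: w) (opp a), add_mem ?_ (mul_mem ?_ (hX'.act_mem _ _)),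
        fun h0 => hpm ⟨h, hp, h0⟩, fun z hz => hz.2.2⟩
      · exact pullback_mem_dirReg (X := level K x k)
          (mul_mem (natCast_mem _ (expo w a)) (hX.act_mem w (opp a))) a
      · exact pullback_mem_dirReg (X := level K x k)
          (mul_mem (natCast_mem _ (expo w (opp a))) (hX.act_mem w a)) a
    · obtain ⟨f, hf, hfp, hfz⟩ := ih hp.1 h
      exact ⟨_, pullback_mem_dirReg (X := level K x k) hf a, hfp, fun z hz => hfz _ hz.1⟩

end Parametrization

/-! ### The product with the line, and the central member of the family -/

namespace Stage

variable {K : Type u} [Field K] {X : Stage.{u, v} K}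

/-- The value at a point and a parameter of a polynomial over the coordinate ring of a chart. -/
noncomputable def lineEval (X : Stage.{u, v} K) (w : List (Fin 2)) (z : X.Pt) (s : K) :
    Polynomial (X.reg w) →+* K :=
  Polynomial.eval₂RingHom
    ((Pi.evalRingHom (fun _ : X.Pt => K) z).comp (X.reg w).val.toRingHom) s

lemma lineEval_C {w : List (Fin 2)} (z : X.Pt) (s : K) (f : X.reg w) :
    X.lineEval w z s (Polynomial.C f) = f.1 z := Polynomial.eval₂_C _ _

lemma lineEval_X {w : List (Fin 2)} (z : X.Pt) (s : K) :
    X.lineEval w z s Polynomial.X = s := Polynomial.eval₂_X _ _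

lemma isOpen_line {w : List (Fin 2)} (F : Polynomial (X.reg w)) :
    @IsOpen _ X.zariskiLine {z : X.Pt × K | z.1 ∈ X.dom w ∧ X.lineEval w z.1 z.2 F ≠ 0} :=
  @TopologicalSpace.isOpen_generateFrom_of_mem _ _ _ ⟨w, F, rfl⟩

/-- Only the coefficients of a polynomial change with the chart, so a common denominator independent
of the parameter carries an open condition from one chart to another. -/
lemma Charted.exists_basic_line (hX : X.Charted) {w : List (Fin 2)} {q : X.Pt} (hq : q ∈ X.dom w)
    {t : K} {V : Set (X.Pt × K)} (hV : @IsOpen _ X.zariskiLine V) (hqV : (q, t) ∈ V) :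
    ∃ F : Polynomial (X.reg w), X.lineEval w q t F ≠ 0 ∧
      ∀ z ∈ X.dom w, ∀ s, X.lineEval w z s F ≠ 0 → (z, s) ∈ V := by
  induction hV with
  | basic V hV =>
    obtain ⟨w', F, rfl⟩ := hV
    have key : ∃ g ∈ X.reg w, g q ≠ 0 ∧ ∃ F₁ : Polynomial (X.reg w), ∀ z ∈ X.dom w, g z ≠ 0 →
        z ∈ X.dom w' ∧ ∀ s, X.lineEval w' z s F = X.lineEval w z s F₁ / g z := by
      have hqw := hqV.1
      clear hqV
      induction F using Polynomial.induction_on' with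
      | add F G hF hG =>
        obtain ⟨g₁, hg₁, h₁, F₁, hF₁⟩ := hF
        obtain ⟨g₂, hg₂, h₂, F₂, hF₂⟩ := hG
        refine ⟨g₁ * g₂, mul_mem hg₁ hg₂, mul_ne_zero h₁ h₂,
          F₁ * Polynomial.C ⟨g₂, hg₂⟩ + F₂ * Polynomial.C ⟨g₁, hg₁⟩, fun z hz hne => ?_⟩
        have n1 := left_ne_zero_of_mul hne
        have n2 := right_ne_zero_of_mul hne
        refine ⟨(hF₁ z hz n1).1, fun s => ?_⟩
        simp only [map_add, map_mul, (hF₁ z hz n1).2, (hF₂ z hz n2).2, lineEval_C, Pi.mul_apply]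
        field_simp
      | monomial n f =>
        obtain ⟨f₁, hf₁, g, hg, hgq, hz⟩ := hX.change hq hqw f.1 f.2
        refine ⟨g, hg, hgq, Polynomial.C ⟨f₁, hf₁⟩ * Polynomial.X ^ n, fun z hz' hne =>
          ⟨(hz z hz' hne).1, fun s => ?_⟩⟩
        rw [← Polynomial.C_mul_X_pow_eq_monomial, map_mul, map_mul, map_pow, map_pow, lineEval_C,
          lineEval_C, lineEval_X, lineEval_X, (hz z hz' hne).2, div_mul_eq_mul_div]
    obtain ⟨g, hg, hgq, F₁, hF₁⟩ := key
    have hF0 : X.lineEval w' q t F ≠ 0 := hqV.2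
    rw [(hF₁ q hq hgq).2] at hF0
    refine ⟨F₁ * Polynomial.C ⟨g, hg⟩, ?_, fun z hz s hne => ?_⟩
    · rw [map_mul, lineEval_C]
      exact mul_ne_zero (div_ne_zero_iff.1 hF0).1 hgq
    · rw [map_mul, lineEval_C] at hne
      have n1 := left_ne_zero_of_mul hne
      have n2 := right_ne_zero_of_mul hne
      refine ⟨(hF₁ z hz n2).1, ?_⟩
      change X.lineEval w' z s F ≠ 0
      rw [(hF₁ z hz n2).2]
      exact div_ne_zero n1 n2
  | univ => exact ⟨1, by simp, fun _ _ _ _ => trivial⟩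
  | inter V₁ V₂ _ _ ih₁ ih₂ =>
    obtain ⟨g₁, h₁, hz₁⟩ := ih₁ hqV.1
    obtain ⟨g₂, h₂, hz₂⟩ := ih₂ hqV.2
    refine ⟨g₁ * g₂, by rw [map_mul]; exact mul_ne_zero h₁ h₂, fun z hz s hne => ?_⟩
    rw [map_mul] at hne
    exact ⟨hz₁ z hz s (left_ne_zero_of_mul hne), hz₂ z hz s (right_ne_zero_of_mul hne)⟩
  | sUnion S _ ih =>
    obtain ⟨V, hVS, hqV⟩ := hqV
    obtain ⟨g, h, hz⟩ := ih V hVS hqV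
    exact ⟨g, h, fun z hz' s hne => ⟨V, hVS, hz z hz' s hne⟩⟩

end Stage

section NodalProlongation

variable {K : Type u} [Field K] {A : Type v} [CommRing A] [Algebra K A] {x : Fin 2 → A}
  [CharZero K] [IsAlgClosed K] [Algebra.FiniteType K A]
    (hx : LinearIndependent A (fun i => KaehlerDifferential.D K A (x i)))
    (hx' : Submodule.span A (Set.range (fun i => KaehlerDifferential.D K A (x i))) = ⊤)
include hx hx'

/-- The points with nonvanishing `x₁ x₂` are dense in the monomial locus. -/
lemma exists_baseProd_ne_zero {k : ℕ} {w : List (Fin 2)} {p : S K x k}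
    (hp : p ∈ monomialLocus x k w) {f : S K x k → K} (hf : f ∈ (level K x k).reg w)
    (hfp : f p ≠ 0) : ∃ p' ∈ monomialLocus x k w, f p' ≠ 0 ∧ baseProd x p' ≠ 0 := by
  obtain ⟨G, hG⟩ := exists_poly_of_mem_reg hf
  obtain ⟨q, z, hq, hGq, hz⟩ := exists_point_ne_zero hx hx' (baseMonomial K w) G (basePt x k p) _
    (basePt_eq_eval hp) (hG p hp ▸ hfp)
  obtain ⟨p', hp', rfl, hpz⟩ := exists_mem_monomialLocus hx hx'
    (length_of_mem_dom (mem_dom_of_mem_monomialLocus hp)) q z hq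
  refine ⟨p', hp', ?_, fun h0 => ?_⟩
  · rw [hG p' hp']
    simpa only [hpz] using hGq
  · obtain ⟨i, -, hi⟩ := Finset.prod_eq_zero_iff.1 ((monomialLocus_prod hp').2 h0)
    exact hz i (hpz i ▸ hi)

/-- The prolongation of the nodal curve, in a chart. -/
lemma mem_nodalProlongation {k : ℕ} {w : List (Fin 2)} {p : S K x k}
    (hp : p ∈ (level K x k).dom w) :
    p ∈ nodalProlongation K x k ↔ p ∈ monomialLocus x k w ∧ baseProd x p = 0 := by
  have hX := level_charted hx hx' k
  have hw := length_of_mem_dom hp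
  let _ : TopologicalSpace (S K x k × K) := (level K x k).zariskiLine
  have hmem : p ∈ nodalProlongation K x k ↔
      (p, (0 : K)) ∈ closure {z : S K x k × K | z.2 ≠ 0 ∧ z.1 ∈ curve x z.2 k} := Iff.rfl
  let b : (level K x k).reg w := ⟨_, baseProd_mem_reg hw⟩
  -- The polynomial `x₁ x₂ - t` vanishes on the family, hence on its closure.
  have hb : ∀ (z : S K x k) (s : K),
      (level K x k).lineEval w z s (Polynomial.C b + Polynomial.C (algebraMap K _ (-1)) * Polynomial.X) = baseProd x z - s := by
    intro z s
    rw [map_add, map_mul, lineEval_C, lineEval_C, lineEval_X, sub_eq_add_neg, ← neg_one_mul s]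
    rfl
  rw [hmem, mem_closure_iff]
  constructor
  · intro h
    constructor
    · by_contra hpm
      obtain ⟨f, hf, hfp, hfz⟩ := exists_reg_of_notMem_monomialLocus hx hx' hp hpm
      obtain ⟨⟨z, s⟩, ⟨hzw, hne⟩, hs, hz⟩ := h _
        (isOpen_line (X := level K x k) (Polynomial.C ⟨f, hf⟩)) ⟨hp, by rwa [lineEval_C]⟩
      rw [lineEval_C] at hne
      exact hne (hfz z ((curve_chart hx hx' hs hzw).1.1 hz).1)
    · by_contra hpm
      obtain ⟨⟨z, s⟩, ⟨hzw, hne⟩, hs, hz⟩ := h _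
        (isOpen_line (Polynomial.C b + Polynomial.C (algebraMap K _ (-1)) * Polynomial.X)) ⟨hp, by rwa [hb, sub_zero]⟩
      rw [hb] at hne
      exact hne (sub_eq_zero.2 ((curve_chart hx hx' hs hzw).1.1 hz).2)
  · rintro ⟨hpm, hp0⟩ V hV hpV
    obtain ⟨F, hF, hFV⟩ := hX.exists_basic_line hp hV hpV
    -- Substituting `t = x₁ x₂` restricts `F` to the graph, as a regular function on the chart that
    -- is nonzero at `p`. By density it is nonzero at a point of the locus with `x₁ x₂ ≠ 0`, and
    -- such a point lies on a curve of the family.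
    have hev : ∀ z : S K x k, (F.eval b).1 z = (level K x k).lineEval w z (baseProd x z) F := by
      intro z
      have : ((Pi.evalRingHom (fun _ : S K x k => K) z).comp
          ((level K x k).reg w).val.toRingHom).comp (Polynomial.evalRingHom b) =
          (level K x k).lineEval w z (baseProd x z) := by
        refine Polynomial.ringHom_ext (fun f => ?_) ?_
        · rw [lineEval_C, RingHom.comp_apply, Polynomial.coe_evalRingHom, Polynomial.eval_C]
          rfl
        · rw [lineEval_X, RingHom.comp_apply, Polynomial.coe_evalRingHom, Polynomial.eval_X]
          rfl
      exact congrArg (fun f => f F) this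
    obtain ⟨p', hp', hFp', hne⟩ := exists_baseProd_ne_zero hx hx' hpm (F.eval b).2
      (by rw [hev, hp0]; exact hF)
    rw [hev] at hFp'
    have hp'w := mem_dom_of_mem_monomialLocus hp'
    exact ⟨(p', baseProd x p'), hFV p' hp'w _ hFp', hne,
      (curve_chart hx hx' hne hp'w).1.2 ⟨hp', rfl⟩⟩

end NodalProlongation

/-! ### Axes, nodes and twigs -/

section Twigs

variable {K : Type u} [Field K] {A : Type v} [CommRing A] [Algebra K A]

/-- The coordinate axis `x_i = 0` in the monomial locus of the chart `c`, over the base point. -/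
def axis (x : Fin 2 → A) (o : A →ₐ[K] K) (k : ℕ) (c : List (Fin 2)) (i : Fin 2) : Set (S K x k) :=
  {p | p ∈ monomialLocus x k c ∧ basePt x k p = o ∧ (level K x k).act c i p = 0}

/-- The two charts, given by `a`, which cover the twig with label `w`, `m + 1` levels above its node. -/
def twigWord (m : ℕ) (w : List (Fin 2)) (a : Fin 2) : List (Fin 2) :=
  List.replicate m (opp a) ++ a :: w

lemma twigWord_succ (m : ℕ) (w : List (Fin 2)) (a : Fin 2) :
    twigWord (m + 1) w a = opp a :: twigWord m w a := rfl

lemma length_twigWord (m : ℕ) (w : List (Fin 2)) (a : Fin 2) :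
    (twigWord m w a).length = w.length + 1 + m := by
  simp [twigWord]
  ring

/-- The last run of equal letters identifies `opp a` and its length `m`. For `m = 0` the last letter
is `a` itself, and the same word could also end in a run of positive length for the other letter,
which `hm` excludes. -/
lemma twigWord_inj {m m' : ℕ} {w w' : List (Fin 2)} {a a' : Fin 2}
    (h : twigWord m w a = twigWord m' w' a') (hm : m = m' ∨ 0 < m ∧ 0 < m') :
    a = a' ∧ m = m' := by
  induction m generalizing m' with
  | zero =>
    obtain rfl : 0 = m' := by omega
    exact ⟨(List.cons.inj h).1, rfl⟩
  | succ m ih =>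
    obtain _ | m' := m'
    · omega
    have h' : twigWord m w a = twigWord m' w' a' := (List.cons.inj h).2
    have ha : a = a' := by rw [← opp_opp a, (List.cons.inj h).1, opp_opp]
    subst ha
    refine ⟨rfl, ?_⟩
    obtain _ | m := m <;> obtain _ | m' := m'
    · rfl
    · exact absurd (List.cons.inj h').1 (ne_opp a)
    · exact absurd (List.cons.inj h').1 (opp_ne a)
    · exact congrArg Nat.succ (ih h' (Or.inr ⟨by omega, by omega⟩)).2

/-- The twig with label `w`, `m + 1` levels above its node. -/
def twigSet (x : Fin 2 → A) (o : A →ₐ[K] K) (k m : ℕ) (w : List (Fin 2)) : Set (S K x k) :=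
  {p | ∃ a, p ∈ axis x o k (twigWord m w a) a}

variable {x : Fin 2 → A} {o : A →ₐ[K] K}

lemma axis_subset_dom {k : ℕ} {c : List (Fin 2)} {i : Fin 2} {p : S K x k}
    (hp : p ∈ axis x o k c i) : p ∈ (level K x k).dom c := mem_dom_of_mem_monomialLocus hp.1

/-- The new coordinate `dx_b / dx_a` vanishes at a node, whereas the competing chart requires `dx_b
≠ 0`. So each node lies in a single chart. -/
lemma eq_of_mem_node_of_mem_dom {k : ℕ} {w w' : List (Fin 2)} {p : S K x k}
    (hp : p ∈ node x o k w) (hp' : p ∈ (level K x k).dom w') : w' = w := by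
  induction k generalizing w w' with
  | zero =>
    obtain rfl : w' = [] := hp'
    obtain _ | _ := w
    exacts [rfl, absurd hp id]
  | succ k ih =>
    obtain _ | ⟨a, w⟩ := w
    · exact absurd hp id
    obtain _ | ⟨b, w'⟩ := w'
    · exact absurd hp' id
    obtain ⟨h1, h2, h3⟩ := hp
    obtain rfl := ih h1 (mem_level_dom.1 hp').1
    obtain rfl | rfl := eq_or_eq_opp a b
    · rfl
    · rw [level_act_opp, div_eq_zero_iff, or_iff_left (mem_level_dom.1 h2).2] at h3
      exact absurd h3 (mem_level_dom.1 hp').2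

lemma node_subset_dom {k : ℕ} {w : List (Fin 2)} {p : S K x k} (hp : p ∈ node x o k w) :
    p ∈ (level K x k).dom w := by
  obtain _ | k := k <;> obtain _ | ⟨a, w⟩ := w
  exacts [rfl, absurd hp id, absurd hp id, hp.2.1]

variable [CharZero K]

/-- The relation `x_b = const * x_a * y` makes the vanishing of both active coordinates propagate
down the tower. -/
lemma mem_node_iff (ho : ∀ i, o (x i) = 0) {k : ℕ} {w : List (Fin 2)} {p : S K x k} :
    p ∈ node x o k w ↔ p ∈ monomialLocus x k w ∧ basePt x k p = o ∧
      ∀ i, (level K x k).act w i p = 0 := by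
  induction k generalizing w with
  | zero =>
    obtain _ | ⟨a, w⟩ := w
    · refine ⟨?_, fun h => h.2.1⟩
      rintro rfl
      exact ⟨rfl, rfl, ho⟩
    · exact ⟨fun h => absurd h id, fun h => absurd h.1 (List.cons_ne_nil _ _)⟩
  | succ k ih =>
    obtain _ | ⟨a, w⟩ := w
    · exact ⟨fun h => absurd h id, fun h => absurd h.1 id⟩
    constructor
    · rintro ⟨h1, h2, h3⟩
      obtain ⟨h4, h5, h6⟩ := ih.1 h1
      refine ⟨monomialLocus_cons.2 ⟨h4, h2, ?_⟩, h5, (forall_letter a).2 ⟨?_, h3⟩⟩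
      · rw [h6, h3, mul_zero, mul_zero]
      · rw [level_act_self, h6]
    · rintro ⟨h1, h2, h3⟩
      obtain ⟨h4, h5, h6⟩ := monomialLocus_cons.1 h1
      refine ⟨ih.2 ⟨h4, h2, (forall_letter a).2 ⟨?_, ?_⟩⟩, h5, h3 _⟩
      · rw [← level_act_self, h3]
      · rw [h6, h3, zero_mul, mul_zero]

lemma basePt_eq_zero_of_act {k : ℕ} {w : List (Fin 2)} {p : S K x k}
    (hp : p ∈ monomialLocus x k w) (h : ∀ i, (level K x k).act w i p = 0) (i : Fin 2) :
    basePt x k p (x i) = 0 := by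
  induction k generalizing w with
  | zero => exact h i
  | succ k ih =>
    obtain _ | ⟨a, w⟩ := w
    · exact absurd hp id
    obtain ⟨h4, h5, h6⟩ := monomialLocus_cons.1 hp
    refine ih h4 ((forall_letter a).2 ⟨?_, ?_⟩)
    · rw [← level_act_self, h]
    · rw [h6, h, zero_mul, mul_zero]

/-- In the chart `opp a :: c` the coordinate with letter `a` is the new one, and the old `x_a` is a
multiple of it. -/
lemma proj_mem_axis {k : ℕ} {c : List (Fin 2)} {a : Fin 2} {p : S K x (k + 1)}
    (hp : p ∈ axis x o (k + 1) (opp a :: c) a) : proj x p ∈ axis x o k c a := by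
  obtain ⟨h1, h2, h3⟩ := hp
  obtain ⟨h4, h5, h6⟩ := monomialLocus_cons.1 h1
  refine ⟨h4, h2, ?_⟩
  rw [opp_opp, h3, mul_zero, mul_zero] at h6
  exact h6

lemma mem_axis_of_proj {k : ℕ} {c : List (Fin 2)} {a : Fin 2} {p : S K x (k + 1)}
    (hp : p ∈ (level K x (k + 1)).dom (opp a :: c)) (h0 : (level K x (k + 1)).act (opp a :: c) a p = 0)
    (h : proj x p ∈ axis x o k c a) : p ∈ axis x o (k + 1) (opp a :: c) a := by
  refine ⟨monomialLocus_cons.2 ⟨h.1, hp, ?_⟩, h.2.1, h0⟩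
  rw [opp_opp, h0, h.2.2, mul_zero, mul_zero]

/-- In the chart `a :: w` the coordinate `x_a` is the retained one, and the other coordinate of the
chart `w` is a multiple of it. Both vanish on the axis, so this axis is contracted. -/
lemma proj_mem_node {k : ℕ} {w : List (Fin 2)} (ho : ∀ i, o (x i) = 0) {a : Fin 2} {p : S K x (k + 1)}
    (hp : p ∈ axis x o (k + 1) (a :: w) a) : proj x p ∈ node x o k w := by
  obtain ⟨h1, h2, h3⟩ := hp
  obtain ⟨h4, h5, h6⟩ := monomialLocus_cons.1 h1
  refine (mem_node_iff ho).2 ⟨h4, h2, (forall_letter a).2 ⟨?_, ?_⟩⟩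
  · rw [← level_act_self, h3]
  · rw [h6, h3, zero_mul, mul_zero]

lemma mem_axis_of_proj_mem_node {k : ℕ} {w : List (Fin 2)} (ho : ∀ i, o (x i) = 0) {a : Fin 2}
    {p : S K x (k + 1)} (hp : p ∈ (level K x (k + 1)).dom (a :: w)) (h : proj x p ∈ node x o k w) :
    p ∈ axis x o (k + 1) (a :: w) a := by
  obtain ⟨h1, h2, h3⟩ := (mem_node_iff ho).1 h
  have h4 : (level K x (k + 1)).act (a :: w) a p = 0 := by rw [level_act_self, h3]
  exact ⟨monomialLocus_cons.2 ⟨h1, hp, by rw [h3, h4, zero_mul, mul_zero]⟩, h2, h4⟩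

omit [CharZero K] in
lemma length_of_mem_twigSet {k m : ℕ} {w : List (Fin 2)} {p : S K x k}
    (hp : p ∈ twigSet x o k m w) : k = w.length + 1 + m := by
  obtain ⟨a, ha⟩ := hp
  rw [← length_of_mem_dom (axis_subset_dom ha), length_twigWord]

lemma mem_node_of_mem_axis (ho : ∀ i, o (x i) = 0) {k : ℕ} {c : List (Fin 2)} {a : Fin 2}
    {p : S K x k} (hp : p ∈ axis x o k c a) :
    (level K x k).act c (opp a) p = 0 ↔ p ∈ node x o k c := by
  rw [mem_node_iff ho, forall_letter a]
  exact ⟨fun h => ⟨hp.1, hp.2.1, hp.2.2, h⟩, fun h => h.2.2.2⟩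

lemma notMem_node_of_mem_axis (ho : ∀ i, o (x i) = 0) {k : ℕ} {c : List (Fin 2)} {a : Fin 2}
    {p : S K x k} (hp : p ∈ axis x o k c a) :
    (level K x k).act c (opp a) p ≠ 0 ↔ ∀ w, p ∉ node x o k w := by
  refine ⟨fun h w hw => ?_, fun h h0 => h c ((mem_node_of_mem_axis ho hp).1 h0)⟩
  obtain rfl := eq_of_mem_node_of_mem_dom hw (axis_subset_dom hp)
  exact h ((mem_node_of_mem_axis ho hp).2 hw)

variable [IsAlgClosed K] [Algebra.FiniteType K A]
    (hx : LinearIndependent A (fun i => KaehlerDifferential.D K A (x i)))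
    (hx' : Submodule.span A (Set.range (fun i => KaehlerDifferential.D K A (x i))) = ⊤)
    (ho : ∀ i, o (x i) = 0)
include hx hx'

omit ho in
/-- There is exactly one node for each word. -/
lemma existsUnique_node {k : ℕ} {w : List (Fin 2)} (hw : w.length = k) :
    ∃! p, p ∈ node x o k w := by
  induction k generalizing w with
  | zero =>
    obtain rfl := List.length_eq_zero_iff.1 hw
    exact ⟨o, rfl, fun _ h => h⟩
  | succ k ih =>
    obtain _ | ⟨a, w⟩ := w
    · simp at hw
    obtain ⟨q, hq, huniq⟩ := ih (w := w) (by simpa using hw)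
    obtain ⟨p, rfl, hp, hy⟩ := exists_dir_level hx hx' (node_subset_dom hq) a 0
    exact ⟨p, ⟨hq, hp, hy⟩, fun p' hp' => dir_ext_level hx hx' hp'.2.1 hp (huniq _ hp'.1)
      (hp'.2.2.trans hy.symm)⟩

lemma dom_or_dom {k : ℕ} {w : List (Fin 2)} {p : S K x (k + 1)}
    (hp : proj x p ∈ (level K x k).dom w) (a : Fin 2) :
    p ∈ (level K x (k + 1)).dom (a :: w) ∨ p ∈ (level K x (k + 1)).dom (opp a :: w) :=
  (level_charted hx hx' k).mem_dirDom_of_pt hp a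

/-- Over a point of an axis which is not a node there is only one point of the prolongation of the nodal
curve, and it lies on the prolongation of the axis. -/
lemma mem_axis_of_mem_nodalProlongation {k : ℕ} {c : List (Fin 2)} {a : Fin 2} {p : S K x (k + 1)}
    (hp : p ∈ nodalProlongation K x (k + 1)) (h : proj x p ∈ axis x o k c a)
    (hne : (level K x k).act c (opp a) (proj x p) ≠ 0) :
    p ∈ axis x o (k + 1) (opp a :: c) a := by
  -- In the chart `a :: c` the relation with `x_a = 0` would make the other coordinate of `c`
  -- vanish. In the chart `opp a :: c` that coordinate is a nonzero factor, so the new coordinate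
  -- must be zero.
  rcases dom_or_dom hx hx' (axis_subset_dom h) a with hd | hd
  · have h1 := (monomialLocus_cons.1 ((mem_nodalProlongation hx hx' hd).1 hp).1).2.2
    rw [level_act_self, h.2.2, zero_mul, mul_zero] at h1
    exact absurd h1 hne
  · have h1 := (monomialLocus_cons.1 ((mem_nodalProlongation hx hx' hd).1 hp).1).2.2
    rw [opp_opp, h.2.2, level_act_self, eq_comm, neg_mul, neg_eq_zero, mul_eq_zero, mul_eq_zero,
      or_iff_right (div_ne_zero (expo_ne_zero _ _) (expo_ne_zero _ _)), or_iff_right hne] at h1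
    exact mem_axis_of_proj hd h1 h

include ho

lemma axis_subset_nodalProlongation {k : ℕ} {c : List (Fin 2)} {a : Fin 2} {p : S K x k}
    (hp : p ∈ axis x o k c a) : p ∈ nodalProlongation K x k :=
  (mem_nodalProlongation hx hx' (axis_subset_dom hp)).2
    ⟨hp.1, by rw [baseProd, hp.2.1, ho, zero_mul]⟩

/-- An axis is parametrized by the other active coordinate. -/
lemma exists_mem_axis {k m : ℕ} {w : List (Fin 2)} (hk : k = w.length + 1 + m) (a : Fin 2) (s : K) :
    ∃ p ∈ axis x o k (twigWord m w a) a, (level K x k).act (twigWord m w a) (opp a) p = s := by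
  induction m generalizing k with
  | zero =>
    subst hk
    obtain ⟨q, hq, -⟩ := existsUnique_node hx hx' (o := o) (w := w) rfl
    obtain ⟨p, rfl, hp, hy⟩ := exists_dir_level hx hx' (node_subset_dom hq) a s
    exact ⟨p, mem_axis_of_proj_mem_node ho hp hq, hy⟩
  | succ m ih =>
    subst hk
    obtain ⟨q, hq, hs⟩ := ih rfl
    obtain ⟨p, rfl, hp, hy⟩ := exists_dir_level hx hx' (axis_subset_dom hq) (opp a) 0
    rw [opp_opp] at hy
    refine ⟨p, mem_axis_of_proj hp hy hq, ?_⟩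
    rw [← hs]
    exact level_act_self _ _ _

omit ho in
lemma axis_ext {k : ℕ} {c : List (Fin 2)} {a : Fin 2} {p p' : S K x k} (hp : p ∈ axis x o k c a)
    (hp' : p' ∈ axis x o k c a)
    (h : (level K x k).act c (opp a) p = (level K x k).act c (opp a) p') : p = p' :=
  monomialLocus_ext hx hx' hp.1 hp'.1 (hp.2.1.trans hp'.2.1.symm)
    ((forall_letter a).2 ⟨hp.2.2.trans hp'.2.2.symm, h⟩)

/-- The points of a twig which are not nodes lie in both its charts. -/
lemma axis_switch {k m : ℕ} {w : List (Fin 2)} {a : Fin 2} {p : S K x k}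
    (hp : p ∈ axis x o k (twigWord m w a) a)
    (hne : (level K x k).act (twigWord m w a) (opp a) p ≠ 0) :
    p ∈ axis x o k (twigWord m w (opp a)) (opp a) ∧
      (level K x k).act (twigWord m w (opp a)) a p ≠ 0 := by
  have hk := length_of_mem_twigSet ⟨a, hp⟩
  induction m generalizing k with
  | zero =>
    subst hk
    have hne' : (level K x (w.length + 1)).act (a :: w) (opp a) p ≠ 0 := hne
    rw [level_act_opp] at hne'
    have hn := div_ne_zero_iff.1 hne'
    -- The two charts of the fibre over a node are related by `y ↦ 1 / y`.
    have hnode := proj_mem_node ho hp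
    refine ⟨mem_axis_of_proj_mem_node ho ⟨node_subset_dom hnode, hn.1⟩ hnode, ?_⟩
    have h1 := level_act_opp (opp a) w p
    rw [opp_opp] at h1
    exact fun h0 => div_ne_zero hn.2 hn.1 (h1.symm.trans h0)
  | succ m ih =>
    subst hk
    have h1 := proj_mem_axis hp
    have h2 : (level K x (w.length + 1 + m)).act (twigWord m w a) (opp a) (proj x p) ≠ 0 := by
      rw [← level_act_self]
      exact hne
    obtain ⟨h3, h4⟩ := ih h1 h2 rfl
    -- The projection is on both axes, and over it there is only one point of the nodal
    -- prolongation, which must therefore lie on both prolonged axes.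
    refine ⟨mem_axis_of_mem_nodalProlongation hx hx'
      (axis_subset_nodalProlongation hx hx' ho hp) h3
      ((opp_opp a).symm ▸ h4 : (level K x (w.length + 1 + m)).act (twigWord m w (opp a))
        (opp (opp a)) (proj x p) ≠ 0), fun h0 => h4 ?_⟩
    rw [← h0]
    have h5 := level_act_self (opp (opp a)) (twigWord m w (opp a)) p
    rw [opp_opp] at h5
    rw [twigWord_succ, opp_opp]
    exact h5.symm

lemma mem_axis_of_mem_twigSet {k m : ℕ} {w : List (Fin 2)} {a : Fin 2} {p : S K x k}
    (hp : p ∈ twigSet x o k m w) (hd : p ∈ (level K x k).dom (twigWord m w a)) :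
    p ∈ axis x o k (twigWord m w a) a := by
  obtain ⟨b, hb⟩ := hp
  obtain rfl | rfl := eq_or_eq_opp a b
  · exact hb
  by_cases h0 : (level K x k).act (twigWord m w (opp a)) (opp (opp a)) p = 0
  · have := eq_of_mem_node_of_mem_dom ((mem_node_of_mem_axis ho hb).1 h0) hd
    exact absurd (twigWord_inj this (Or.inl rfl)).1 (ne_opp a)
  · have := (axis_switch hx hx' ho hb h0).1
    rwa [opp_opp] at this

lemma twigSet_zero {k : ℕ} {w : List (Fin 2)} :
    twigSet x o (k + 1) 0 w = proj x ⁻¹' node x o k w := by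
  ext p
  constructor
  · rintro ⟨a, ha⟩
    exact proj_mem_node ho ha
  · intro hp
    rcases dom_or_dom hx hx' (node_subset_dom hp) 0 with h | h
    exacts [⟨0, mem_axis_of_proj_mem_node ho h hp⟩, ⟨opp 0, mem_axis_of_proj_mem_node ho h hp⟩]

/-- At a node of the twig below, only the chart of that node is available. Elsewhere both charts
force the same point. Written as conditions for both letters, membership is visibly closed, as
needed for `isClosed_twigSet`. -/
lemma mem_twigSet_succ {k m : ℕ} {w : List (Fin 2)} {p : S K x (k + 1)} :
    p ∈ twigSet x o (k + 1) (m + 1) w ↔ proj x p ∈ twigSet x o k m w ∧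
      ∀ a, p ∉ (level K x (k + 1)).dom (a :: twigWord m w a) ∧
        (p ∈ (level K x (k + 1)).dom (opp a :: twigWord m w a) →
          (level K x (k + 1)).act (opp a :: twigWord m w a) a p = 0) := by
  constructor
  · intro hp
    have hproj : proj x p ∈ twigSet x o k m w := by
      obtain ⟨a, ha⟩ := hp
      exact ⟨a, proj_mem_axis ha⟩
    have key : ∀ a, proj x p ∈ (level K x k).dom (twigWord m w a) →
        p ∈ axis x o (k + 1) (opp a :: twigWord m w a) a := by
      intro a hd
      have h1 := mem_axis_of_mem_twigSet hx hx' ho hproj hd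
      by_cases h0 : (level K x k).act (twigWord m w a) (opp a) (proj x p) = 0
      · obtain ⟨b, hb⟩ := hp
        have h2 := eq_of_mem_node_of_mem_dom ((mem_node_of_mem_axis ho h1).1 h0)
          (axis_subset_dom (proj_mem_axis hb))
        obtain rfl := (twigWord_inj h2 (Or.inl rfl)).1
        exact hb
      · obtain ⟨b, hb⟩ := hp
        exact mem_axis_of_mem_nodalProlongation hx hx'
          (axis_subset_nodalProlongation hx hx' ho hb) h1 h0
    refine ⟨hproj, fun a => ⟨fun hd => ?_, fun hd => (key a hd.1).2.2⟩⟩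
    have h1 := key a hd.1
    have h2 := level_act_opp (opp a) (twigWord m w a) p
    rw [opp_opp, h1.2.2, eq_comm, div_eq_zero_iff] at h2
    exact h2.elim hd.2 (axis_subset_dom h1).2
  · rintro ⟨⟨a, ha⟩, h⟩
    have hd := (dom_or_dom hx hx' (axis_subset_dom ha) a).resolve_left (h a).1
    exact ⟨a, mem_axis_of_proj hd ((h a).2 hd) ha⟩

lemma proj_image_twigSet_succ {k m : ℕ} {w : List (Fin 2)} :
    proj x '' twigSet x o (k + 1) (m + 1) w = twigSet x o k m w := by
  ext q
  constructor
  · rintro ⟨p, hp, rfl⟩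
    exact ((mem_twigSet_succ hx hx' ho).1 hp).1
  · rintro ⟨a, ha⟩
    obtain ⟨p, rfl, hp, hy⟩ := exists_dir_level hx hx' (axis_subset_dom ha) (opp a) 0
    rw [opp_opp] at hy
    exact ⟨p, ⟨a, mem_axis_of_proj hp hy ha⟩, rfl⟩

lemma proj_image_twigSet_zero {k : ℕ} {w : List (Fin 2)} :
    proj x '' twigSet x o (k + 1) 0 w = node x o k w := by
  rw [twigSet_zero hx hx' ho]
  refine Set.image_preimage_eq_iff.2 fun q hq => ?_
  obtain ⟨p, rfl, -⟩ := exists_dir_level hx hx' (node_subset_dom hq) 0 0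
  exact ⟨p, rfl⟩

end Twigs

/-- For the maximal ideal `m` of `o` and the ideal `J` of the coordinates, `a ↦ a - a(o)` is a
derivation modulo `J + m²` that kills the `x_i`. Since the `d x_i` span the differentials it is
zero, so `m ⊆ J + m²`. Nakayama's lemma then gives `r` with `r(o) = 1` and `r m ⊆ J`, which
separates `o` from the other zeros of the coordinates. -/
lemma exists_isolate {K : Type u} [Field K] {A : Type v} [CommRing A] [Algebra K A]
    [Algebra.FiniteType K A] {x : Fin 2 → A} {o : A →ₐ[K] K}
    (hx' : Submodule.span A (Set.range (fun i => KaehlerDifferential.D K A (x i))) = ⊤)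
    (ho : ∀ i, o (x i) = 0) :
    ∃ f : A, o f ≠ 0 ∧ ∀ q : A →ₐ[K] K, (∀ i, q (x i) = 0) → q f ≠ 0 → q = o := by
  let m : Ideal A := RingHom.ker o
  let J : Ideal A := Ideal.span (Set.range x)
  have hm : ∀ a, a - algebraMap K A (o a) ∈ m := fun a => by
    simp [m, RingHom.mem_ker]
  let π := (Ideal.Quotient.mk (J ⊔ m * m))
  let D : Derivation K A (A ⧸ (J ⊔ m * m)) := Derivation.mk'
    { toFun := fun a => π (a - algebraMap K A (o a))
      map_add' := fun a b => by
        rw [← map_add]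
        congr 1
        simp only [map_add]
        ring
      map_smul' := fun c a => by
        rw [RingHom.id_apply, Algebra.smul_def c (π _), IsScalarTower.algebraMap_apply K A (A ⧸ (J ⊔ m * m)),
          Ideal.Quotient.algebraMap_eq, ← map_mul]
        congr 1
        simp only [Algebra.smul_def, map_mul, AlgHom.commutes, Algebra.algebraMap_self,
          RingHom.id_apply]
        ring } fun a b => by
      simp only [LinearMap.coe_mk, AddHom.coe_mk, Algebra.smul_def a (π _),
        Algebra.smul_def b (π _), Ideal.Quotient.algebraMap_eq]
      rw [← map_mul, ← map_mul, ← map_add]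
      refine Ideal.Quotient.eq.2 (Ideal.mem_sup_right ?_)
      have := neg_mem (Ideal.mul_mem_mul (hm a) (hm b))
      convert this using 1
      simp only [map_mul]
      ring
  have hD : ∀ a, D a = 0 := by
    have h0 : D.liftKaehlerDifferential = 0 := by
      refine LinearMap.ext_on_range hx' fun i => ?_
      rw [Derivation.liftKaehlerDifferential_comp_D, LinearMap.zero_apply]
      refine Ideal.Quotient.eq_zero_iff_mem.2 (Ideal.mem_sup_left ?_)
      rw [ho, map_zero, sub_zero]
      exact Ideal.subset_span ⟨i, rfl⟩
    intro a
    rw [← Derivation.liftKaehlerDifferential_comp_D, h0, LinearMap.zero_apply]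
  have hle : m ≤ J ⊔ m * m := fun a ha => by
    have h1 := Ideal.Quotient.eq_zero_iff_mem.1 (hD a)
    rwa [show o a = 0 from ha, map_zero, sub_zero] at h1
  have : IsNoetherianRing A := Algebra.FiniteType.isNoetherianRing K A
  obtain ⟨r, hr, hrm⟩ := Submodule.exists_sub_one_mem_and_smul_eq_zero_of_fg_of_le_smul m
    (Submodule.map J.mkQ m) ((IsNoetherian.noetherian m).map _) (by
      rw [← Submodule.map_smul'']
      refine (Submodule.map_mono hle).trans ?_
      rw [Submodule.map_sup, Submodule.mkQ_map_self, bot_sup_eq]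
      rfl)
  have hor : o r = 1 := by
    have h1 : o (r - 1) = 0 := hr
    rwa [map_sub, map_one, sub_eq_zero] at h1
  refine ⟨r, hor ▸ one_ne_zero, fun q hq hqr => ?_⟩
  have hqJ : J ≤ RingHom.ker q := by
    refine Ideal.span_le.2 ?_
    rintro _ ⟨i, rfl⟩
    exact hq i
  ext a
  have h1 := hrm _ (Submodule.mem_map_of_mem (f := J.mkQ) (hm a))
  rw [← map_smul, Submodule.mkQ_apply, Submodule.Quotient.mk_eq_zero, smul_eq_mul] at h1
  have h2 : q (r * (a - algebraMap K A (o a))) = 0 := hqJ h1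
  rw [map_mul, mul_eq_zero, or_iff_right hqr, map_sub, AlgHom.commutes, sub_eq_zero] at h2
  exact h2

lemma Stage.isClosed_imp_eq_zero {K : Type u} [Field K] (X : Stage.{u, v} K) {w : List (Fin 2)}
    {f : X.Pt → K} (hf : f ∈ X.reg w) : IsClosed {q : X.Pt | q ∈ X.dom w → f q = 0} := by
  rw [← isOpen_compl_iff]
  convert X.isOpen_basic hf using 1
  ext q
  simp

/-- The preimage of a basic open set of the chart `w` is covered by its pullbacks to the two charts
over `w`. -/
lemma Stage.Charted.continuous_pt {K : Type u} [Field K] {X : Stage.{u, v} K} (hX : X.Charted) :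
    Continuous fun p : X.next.Pt => Dir.pt p := by
  refine continuous_generateFrom_iff.2 ?_
  rintro _ ⟨w, f, hf, rfl⟩
  have : (fun p : X.next.Pt => Dir.pt p) ⁻¹' {q | q ∈ X.dom w ∧ f q ≠ 0} =
      ⋃ a : Fin 2, {p : X.next.Pt | p ∈ X.next.dom (a :: w) ∧ f (Dir.pt p) ≠ 0} := by
    ext p
    simp only [Set.mem_preimage, Set.mem_ofPred_eq, Set.mem_iUnion]
    constructor
    · rintro ⟨h1, h2⟩
      rcases hX.mem_dirDom_of_pt h1 0 with h | h
      exacts [⟨_, h, h2⟩, ⟨_, h, h2⟩]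
    · rintro ⟨a, h1, h2⟩
      exact ⟨h1.1, h2⟩
  rw [this]
  exact isOpen_iUnion fun a => X.next.isOpen_basic (pullback_mem_dirReg hf a)

/-! ### The twigs are components, and their labels are unique -/

section TwigTopology

variable {K : Type u} [Field K] {A : Type v} [CommRing A] [Algebra K A] {x : Fin 2 → A}
  {o : A →ₐ[K] K} [CharZero K]

/-- Vanishing of `x_a` propagates down to the chart `a :: w`, and from there to all coordinates. The
base point is then a common zero of `x₁`, `x₂`, not necessarily `o`. -/
lemma basePt_eq_zero_of_act_twigWord {k m : ℕ} {w : List (Fin 2)} {a : Fin 2} {p : S K x k}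
    (hp : p ∈ monomialLocus x k (twigWord m w a))
    (h : (level K x k).act (twigWord m w a) a p = 0) (i : Fin 2) : basePt x k p (x i) = 0 := by
  induction m generalizing k with
  | zero =>
    obtain _ | k := k
    · exact absurd hp (List.cons_ne_nil _ _)
    obtain ⟨h4, h5, h6⟩ := monomialLocus_cons.1 hp
    refine basePt_eq_zero_of_act h4 ((forall_letter a).2 ⟨?_, ?_⟩) i
    · rw [← level_act_self]
      exact h
    · rw [h6, show (level K x (k + 1)).act (a :: w) a p = 0 from h, zero_mul, mul_zero]
  | succ m ih =>
    obtain _ | k := k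
    · exact absurd hp (List.cons_ne_nil _ _)
    obtain ⟨h4, h5, h6⟩ := monomialLocus_cons.1 hp
    have h' : (level K x (k + 1)).act (opp a :: twigWord m w a) a p = 0 := h
    have h6' : (level K x k).act (twigWord m w a) (opp (opp a)) (proj x p) = _ *
      (_ * (level K x (k + 1)).act (opp a :: twigWord m w a) (opp (opp a)) p) := h6
    rw [opp_opp, h', mul_zero, mul_zero] at h6'
    change basePt x k (proj x p) (x i) = 0
    exact ih h4 h6'

variable [IsAlgClosed K] [Algebra.FiniteType K A]
    (hx : LinearIndependent A (fun i => KaehlerDifferential.D K A (x i)))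
    (hx' : Submodule.span A (Set.range (fun i => KaehlerDifferential.D K A (x i))) = ⊤)
include hx hx'

lemma continuous_proj (k : ℕ) : Continuous (proj (K := K) x : S K x (k + 1) → S K x k) :=
  (level_charted hx hx' k).continuous_pt

lemma isClosed_node {k : ℕ} {w : List (Fin 2)} : IsClosed (node x o k w) := by
  induction k generalizing w with
  | zero =>
    obtain _ | ⟨a, w⟩ := w
    · have key : ∀ q : A →ₐ[K] K, q = o ↔ ∀ b, True → q (b - algebraMap K A (o b)) = 0 := by
        refine fun q => ⟨?_, fun h => AlgHom.ext fun b => ?_⟩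
        · rintro rfl b -
          simp
        · simpa [sub_eq_zero] using h b trivial
      have h : node x o 0 [] = ⋂ b : A, {q : (baseStage (K := K) x).Pt | q ∈ (baseStage x).dom [] →
          (fun q : A →ₐ[K] K => q (b - algebraMap K A (o b))) q = 0} := by
        refine Set.ext fun q => (key q).trans (Iff.trans ?_ Set.mem_iInter.symm)
        exact forall_congr' fun b => ⟨fun h _ => h trivial, fun h _ => h rfl⟩
      rw [h]
      exact isClosed_iInter fun b => (baseStage x).isClosed_imp_eq_zero ⟨_, rfl⟩
    · exact isClosed_empty
  | succ k ih =>
    obtain _ | ⟨a, w⟩ := w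
    · exact isClosed_empty
    have h : node x o (k + 1) (a :: w) = proj x ⁻¹' node x o k w ∩
        ((level K x (k + 1)).dom (opp a :: w))ᶜ ∩ {p : S K x (k + 1) |
          p ∈ (level K x (k + 1)).dom (a :: w) → (level K x (k + 1)).act (a :: w) (opp a) p = 0} := by
      ext p
      constructor
      · intro hp
        refine ⟨⟨hp.1, fun hd => ?_⟩, fun _ => hp.2.2⟩
        exact opp_ne a (List.cons.inj (eq_of_mem_node_of_mem_dom hp hd)).1
      · rintro ⟨⟨h1, h2⟩, h3⟩
        have hd := (dom_or_dom hx hx' (node_subset_dom h1) a).resolve_right h2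
        exact ⟨h1, hd, h3 hd⟩
    rw [h]
    exact ((ih.preimage (continuous_proj hx hx' k)).inter
      ((level K x (k + 1)).isOpen_dom _).isClosed_compl).inter
      ((level K x (k + 1)).isClosed_imp_eq_zero ((level_charted hx hx' (k + 1)).act_mem _ _))

variable (ho : ∀ i, o (x i) = 0)
include ho

lemma isClosed_twigSet {k m : ℕ} {w : List (Fin 2)} (hk : k = w.length + 1 + m) :
    IsClosed (twigSet x o k m w) := by
  induction m generalizing k with
  | zero =>
    subst hk
    exact twigSet_zero hx hx' ho ▸ (isClosed_node hx hx').preimage (continuous_proj hx hx' _)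
  | succ m ih =>
    subst hk
    have h : twigSet x o (w.length + 1 + m + 1) (m + 1) w = proj x ⁻¹' twigSet x o _ m w ∩
        ⋂ a, (((level K x (w.length + 1 + m + 1)).dom (a :: twigWord m w a))ᶜ ∩
          {p : S K x (w.length + 1 + m + 1) |
            p ∈ (level K x (w.length + 1 + m + 1)).dom (opp a :: twigWord m w a) →
            (level K x (w.length + 1 + m + 1)).act (opp a :: twigWord m w a) a p = 0}) := by
      ext p
      rw [mem_twigSet_succ hx hx' ho, Set.mem_inter_iff, Set.mem_iInter]
      rfl
    refine h ▸ ((ih rfl).preimage (continuous_proj hx hx' _)).inter (isClosed_iInter fun a => ?_)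
    exact ((level K x (w.length + 1 + m + 1)).isOpen_dom _).isClosed_compl.inter
      ((level K x (w.length + 1 + m + 1)).isClosed_imp_eq_zero
        ((level_charted hx hx' (w.length + 1 + m + 1)).act_mem _ _))

/-- On an axis a regular function is a polynomial in the remaining active coordinate, so a nonzero
one has finitely many zeros. The axis of one chart misses at most one point of the twig, a node of
the other chart. -/
lemma finite_twigSet_diff {k m : ℕ} {w : List (Fin 2)} {V : Set (S K x k)} (hV : IsOpen V)
    (h : (twigSet x o k m w ∩ V).Nonempty) : (twigSet x o k m w \ V).Finite := by
  obtain ⟨p, ⟨a, ha⟩, hpV⟩ := h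
  obtain ⟨g, hg, hgp, hgV⟩ := (level_charted hx hx' k).exists_basic (axis_subset_dom ha) hV hpV
  obtain ⟨G, hG⟩ := exists_poly_of_mem_reg hg
  let P : Polynomial K := MvPolynomial.eval₂ (Polynomial.C.comp (o : A →+* K))
    (fun i => if i = a then 0 else Polynomial.X) G
  have hP : ∀ p ∈ axis x o k (twigWord m w a) a,
      g p = P.eval ((level K x k).act (twigWord m w a) (opp a) p) := by
    intro p hp
    rw [hG p hp.1, hp.2.1, ← Polynomial.coe_evalRingHom, MvPolynomial.hom_eval₂]
    congr 1
    · ext b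
      simp
    · funext i
      obtain rfl | rfl := eq_or_eq_opp a i
      · simp [hp.2.2]
      · simp [opp_ne]
  have hP0 : P ≠ 0 := fun h0 => hgp (by rw [hP p ha, h0, Polynomial.eval_zero])
  have h1 : {p ∈ axis x o k (twigWord m w a) a | g p = 0}.Finite := by
    refine Set.Finite.of_finite_image (f := (level K x k).act (twigWord m w a) (opp a))
      ((Polynomial.finite_setOfPred_isRoot hP0).subset ?_)
      fun p hp p' hp' => axis_ext hx hx' hp.1 hp'.1
    rintro _ ⟨p, hp, rfl⟩
    exact (hP p hp.1).symm.trans hp.2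
  have h2 : (node x o k (twigWord m w (opp a))).Finite := by
    refine Set.Subsingleton.finite fun p hp p' hp' => ?_
    exact (existsUnique_node hx hx' (length_of_mem_dom (node_subset_dom hp))).unique hp hp'
  refine (h1.union h2).subset ?_
  rintro p' ⟨⟨b, hb⟩, hpV'⟩
  have key : ∀ p' ∈ axis x o k (twigWord m w a) a, p' ∉ V →
      p' ∈ {p ∈ axis x o k (twigWord m w a) a | g p = 0} :=
    fun p' h3 h4 => ⟨h3, by_contra fun h5 => h4 (hgV _ (axis_subset_dom h3) h5)⟩
  obtain rfl | rfl := eq_or_eq_opp a b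
  · exact Or.inl (key _ hb hpV')
  by_cases h0 : (level K x k).act (twigWord m w (opp a)) (opp (opp a)) p' = 0
  · exact Or.inr ((mem_node_of_mem_axis ho hb).1 h0)
  · have h3 := (axis_switch hx hx' ho hb h0).1
    rw [opp_opp] at h3
    exact Or.inl (key _ h3 hpV')

lemma infinite_twigSet {k m : ℕ} {w : List (Fin 2)} (hk : k = w.length + 1 + m) :
    (twigSet x o k m w).Infinite := by
  refine Set.Infinite.of_image ((level K x k).act (twigWord m w 0) (opp 0)) ?_
  refine Set.infinite_univ.mono fun s _ => ?_
  obtain ⟨p, hp, hs⟩ := exists_mem_axis hx hx' ho hk 0 s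
  exact ⟨p, ⟨0, hp⟩, hs⟩

lemma isIrreducible_twigSet {k m : ℕ} {w : List (Fin 2)} (hk : k = w.length + 1 + m) :
    IsIrreducible (twigSet x o k m w) := by
  have hinf := infinite_twigSet hx hx' ho hk
  refine ⟨hinf.nonempty, fun U V hU hV hTU hTV => ?_⟩
  have h1 := finite_twigSet_diff hx hx' ho hU hTU
  have h2 := finite_twigSet_diff hx hx' ho hV hTV
  obtain ⟨p, hp, hn⟩ := (hinf.sdiff (h1.union h2)).nonempty
  refine ⟨p, hp, ?_, ?_⟩
  · exact by_contra fun h => hn (Or.inl ⟨hp, h⟩)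
  · exact by_contra fun h => hn (Or.inr ⟨hp, h⟩)

lemma twigSet_subset_nodalProlongation {k m : ℕ} {w : List (Fin 2)} :
    twigSet x o k m w ⊆ nodalProlongation K x k := fun _ ⟨_, ha⟩ =>
  axis_subset_nodalProlongation hx hx' ho ha

/-- A larger irreducible subset of the nodal prolongation agrees with the twig on a nonempty open
part, which is dense in it. Closedness of the twig then gives equality. -/
lemma isTwig_twigSet {k m : ℕ} {w : List (Fin 2)} (hk : k = w.length + 1 + m) :
    IsTwig x k (twigSet x o k m w) := by
  refine ⟨⟨twigSet_subset_nodalProlongation hx hx' ho, isIrreducible_twigSet hx hx' ho hk⟩,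
    fun Y hY hTY => ?_⟩
  obtain ⟨f, hof, hf⟩ := exists_isolate hx' ho
  obtain ⟨p, hp, hp1⟩ := exists_mem_axis hx hx' ho hk 0 1
  -- The first factor removes the other axis, the second removes the points over common zeros of
  -- `x₁`, `x₂` other than `o`.
  let g : S K x k → K := fun p => (level K x k).act (twigWord m w 0) (opp 0) p * basePt x k p f
  have hg : g ∈ (level K x k).reg (twigWord m w 0) :=
    mul_mem ((level_charted hx hx' k).act_mem _ _)
      (base_mem_reg (by rw [length_twigWord, hk]) f)
  have hV := (level K x k).isOpen_basic hg
  have hne : (Y ∩ {q | q ∈ (level K x k).dom (twigWord m w 0) ∧ g q ≠ 0}).Nonempty := by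
    refine ⟨p, hTY ⟨0, hp⟩, axis_subset_dom hp, ?_⟩
    simp only [g, hp1, hp.2.1, one_mul]
    exact hof
  refine (subset_closure_inter_of_isPreirreducible_of_isOpen hY.2.2 hV hne).trans
    (closure_minimal ?_ (isClosed_twigSet hx hx' ho hk))
  rintro q ⟨hqY, hqd, hgq⟩
  obtain ⟨h1, h2⟩ := (mem_nodalProlongation hx hx' hqd).1 (hY.1 hqY)
  rw [mul_ne_zero_iff] at hgq
  rw [← monomialLocus_prod h1, Fin.prod_univ_two, mul_eq_zero] at h2
  have h3 := h2.resolve_right hgq.1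
  exact ⟨0, h1, hf _ (basePt_eq_zero_of_act_twigWord h1 h3) hgq.2, h3⟩

lemma isTwigWithLabel_twigSet {k m : ℕ} {w : List (Fin 2)} (hk : k = w.length + 1 + m) :
    IsTwigWithLabel x o k (twigSet x o k m w) w := by
  induction m generalizing k with
  | zero =>
    subst hk
    exact .emergent _ _ (isTwig_twigSet hx hx' ho rfl) (proj_image_twigSet_zero hx hx' ho)
  | succ m ih =>
    subst hk
    exact .retained _ _ (isTwig_twigSet hx hx' ho rfl)
      ((proj_image_twigSet_succ hx hx' ho).symm ▸ ih rfl)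

/-- A component collapsed to a node lies in the fibre over it, which is an irreducible subset of the
nodal prolongation. A component mapped onto a lower twig has only points of the prolonged twig over
the points with nonzero remaining coordinate. These form a dense open part, so it lies in the
prolonged twig. Maximality gives equality in both cases. -/
lemma eq_twigSet_of_isTwigWithLabel {k : ℕ} {Z : Set (S K x k)} {w : List (Fin 2)}
    (h : IsTwigWithLabel x o k Z w) : ∃ m, k = w.length + 1 + m ∧ Z = twigSet x o k m w := by
  induction h with
  | @emergent k Z w hZ hn =>
    obtain ⟨p, hp⟩ := hZ.1.2.1
    have hp' : proj x p ∈ node x o k w := hn ▸ Set.mem_image_of_mem _ hp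
    obtain rfl := length_of_mem_dom (node_subset_dom hp')
    refine ⟨0, rfl, hZ.eq_of_subset ⟨twigSet_subset_nodalProlongation hx hx' ho,
      isIrreducible_twigSet hx hx' ho rfl⟩ ?_⟩
    rw [twigSet_zero hx hx' ho, ← hn]
    exact Set.subset_preimage_image _ _
  | @retained k Z w hZ _ ih =>
    obtain ⟨m, rfl, hn⟩ := ih
    refine ⟨m + 1, rfl, hZ.eq_of_subset ⟨twigSet_subset_nodalProlongation hx hx' ho,
      isIrreducible_twigSet hx hx' ho rfl⟩ ?_⟩
    obtain ⟨q, hq, hq1⟩ := exists_mem_axis hx hx' ho (k := w.length + 1 + m) rfl 0 1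
    have hV := ((level K x (w.length + 1 + m)).isOpen_basic
      ((level_charted hx hx' (w.length + 1 + m)).act_mem (twigWord m w 0) (opp 0))).preimage
      (continuous_proj hx hx' _)
    obtain ⟨p, hp, rfl⟩ : q ∈ proj x '' Z := hn ▸ ⟨0, hq⟩
    refine (subset_closure_inter_of_isPreirreducible_of_isOpen hZ.1.2.2 hV
      ⟨p, hp, axis_subset_dom hq, hq1 ▸ one_ne_zero⟩).trans
      (closure_minimal ?_ (isClosed_twigSet hx hx' ho rfl))
    rintro z ⟨hz, hzd, hz0⟩
    refine ⟨0, mem_axis_of_mem_nodalProlongation hx hx' (hZ.1.1 hz) ?_ hz0⟩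
    exact mem_axis_of_mem_twigSet hx hx' ho (hn ▸ Set.mem_image_of_mem _ hz) hzd

end TwigTopology

/-! ### The divisors at infinity and their prolongations in charts -/

section Divisors

variable {K : Type u} [Field K]

lemma Stage.dirAct_of_opp {X : Stage.{u, v} K} {a : Fin 2} {w : List (Fin 2)} (p : X.Dir) :
    X.dirAct (opp a :: w) a p = p.vec (X.act w a) / p.vec (X.act w (opp a)) := by
  have h := dirAct_opp (a := opp a) (w := w) p
  rwa [opp_opp] at h

/-- In a chart the divisor at infinity is the zero locus of the last new coordinate, if the last two
letters of the chart are different; otherwise the chart does not meet it. -/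
lemma Stage.Charted.vertical_iff {X : Stage.{u, v} K} (hX : X.Charted) {a b : Fin 2}
    {w : List (Fin 2)} {p : X.next.Dir} (hp : p ∈ X.next.dirDom (b :: a :: w)) :
    (∀ h, X.Reg (Dir.pt (X := X) p.pt) h → p.vec (fun z : X.Dir => h z.pt) = 0) ↔
      b = opp a ∧ X.next.dirAct (opp a :: a :: w) a p = 0 := by
  -- The focal vector projects to `c` times the direction below. It is vertical when `c = 0`,
  -- equivalently when it kills the retained coordinate, on which that direction does not vanish.
  obtain ⟨-, c, hc⟩ := p.vec_mem
  have h1 : p.vec (X.next.act (a :: w) a) = c * Dir.vec (X := X) p.pt (X.act w a) := by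
    rw [← hc _ (regularAt_of_mem hp.1.1 (hX.act_mem w a))]
    exact congrArg _ dirAct_self
  have h2 : (∀ h, X.Reg (Dir.pt (X := X) p.pt) h → p.vec (fun z : X.Dir => h z.pt) = 0) ↔
      p.vec (X.next.act (a :: w) a) = 0 := by
    rw [h1, mul_eq_zero, or_iff_left hp.1.2]
    constructor
    · intro h
      have h3 := h _ (regularAt_of_mem hp.1.1 (hX.act_mem w a))
      rw [hc _ (regularAt_of_mem hp.1.1 (hX.act_mem w a))] at h3
      exact (mul_eq_zero.1 h3).resolve_right hp.1.2
    · rintro rfl h hh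
      rw [hc h hh, zero_mul]
  rw [h2, dirAct_of_opp]
  constructor
  · intro h
    refine ⟨(eq_or_eq_opp a b).resolve_left ?_, by rw [h, zero_div]⟩
    rintro rfl
    exact hp.2 h
  · rintro ⟨rfl, h⟩
    exact (div_eq_zero_iff.1 h).resolve_right hp.2

/-- Tangency to a subset of the projectivized bundle which over a chart is a section along which the new
coordinate vanishes. -/
lemma Stage.Charted.isTangentTo_zero_section [Infinite K] {X : Stage.{u, v} K} (hX : X.Charted)
    {a : Fin 2} {w : List (Fin 2)} {Z : Set X.Pt} {Z' : Set X.Dir}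
    (h0 : ∀ z ∈ Z', z ∈ X.dirDom (opp a :: w) → X.dirAct (opp a :: w) a z = 0)
    (hZ : ∀ q ∈ Z, q ∈ X.dom w → ∃ z ∈ Z', z.pt = q ∧ z ∈ X.dirDom (opp a :: w)) {p : X.Dir}
    (hpZ : p ∈ Z') (hp : p ∈ X.dirDom (opp a :: w)) (hvec : X.IsTangentTo Z p.pt p.vec)
    {D : (X.Dir → K) → K} (hD : D ∈ X.dirFoc p) :
    X.next.IsTangentTo Z' p D ↔ D (X.dirAct (opp a :: w) a) = 0 := by
  have hy : X.dirAct (opp a :: w) (opp (opp a)) = X.dirAct (opp a :: w) a := by rw [opp_opp]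
  have hT : D ∈ tangent X.dirDom X.dirReg p := hX.next.foc_le p hD
  refine ⟨fun h => IsTangentTo.eq_zero (X := X.next) (w := opp a :: w) h hT hp
    (hX.next.act_mem (opp a :: w) a) h0, fun h => ?_⟩
  -- The zero section is the graph of the solution of `1 * y = 0`.
  refine hX.isTangentTo_next (ρ := 0) (σ := 1) (zero_mem _) (one_mem _) ?_ hpZ hp one_ne_zero
    (by rw [hy, h0 p hpZ hp, mul_zero]; rfl) hvec hD ?_
  · intro q hq hqd
    obtain ⟨z, hz, rfl, hzd⟩ := hZ q hq hqd
    exact ⟨z, hz, rfl, hzd, by rw [hy, h0 z hz hzd, mul_zero]; rfl⟩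
  · rw [hy, h, h0 p hpZ hp, zero_mul, mul_zero, zero_add]
    exact (tangent_const hT 0).symm

variable {A : Type v} [CommRing A] [Algebra K A] {x : Fin 2 → A}
  [CharZero K] [IsAlgClosed K] [Algebra.FiniteType K A]
    (hx : LinearIndependent A (fun i => KaehlerDifferential.D K A (x i)))
    (hx' : Submodule.span A (Set.range (fun i => KaehlerDifferential.D K A (x i))) = ⊤)
include hx hx'

lemma mem_divisorAtInfinity_iff {i : ℕ} {a b : Fin 2} {w : List (Fin 2)} {p : S K x (i + 2)}
    (hp : p ∈ (level K x (i + 2)).dom (b :: a :: w)) : p ∈ divisorAtInfinity K x i ↔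
      b = opp a ∧ (level K x (i + 2)).act (opp a :: a :: w) a p = 0 :=
  (level_charted hx hx' i).vertical_iff hp

/-- The charts which meet a prolongation of a divisor at infinity, and the tangent directions of the
latter. -/
lemma prolongedDivisor_chart {i n : ℕ} {c : List (Fin 2)} {p : S K x (i + 2 + n)}
    (hd : p ∈ (level K x (i + 2 + n)).dom c) (hp : p ∈ prolongedDivisor K x i n) :
    ∃ a w, c = twigWord (n + 1) w a ∧ (level K x (i + 2 + n)).act c a p = 0 ∧
      ∀ D ∈ (level K x (i + 2 + n)).foc p,
        (level K x (i + 2 + n)).IsTangentTo (prolongedDivisor K x i n) p D ↔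
          D ((level K x (i + 2 + n)).act c a) = 0 := by
  induction n generalizing c with
  | zero =>
    obtain _ | ⟨b, c⟩ := c
    · exact absurd hd id
    obtain _ | ⟨a, w⟩ := c
    · exact absurd hd.1 id
    obtain ⟨rfl, h0⟩ := (mem_divisorAtInfinity_iff hx hx' hd).1 hp
    have hX := level_charted hx hx' (i + 1)
    -- In its chart the divisor is the zero section over the entire chart below, so tangency to the
    -- base set `Set.univ` is automatic.
    refine ⟨a, w, rfl, h0, fun D hD => hX.isTangentTo_zero_section (Z := Set.univ)
      (fun z hz hzd => ((mem_divisorAtInfinity_iff hx hx' hzd).1 hz).2) (fun q _ hq => ?_) hp hd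
      (isTangentTo_univ (hX.foc_le _ (Dir.vec_mem (X := level K x (i + 1)) p))) hD⟩
    obtain ⟨z, rfl, hzd, hz⟩ := exists_dir_level hx hx' hq (opp a) 0
    rw [opp_opp] at hz
    exact ⟨z, (mem_divisorAtInfinity_iff hx hx' hzd).2 ⟨rfl, hz⟩, rfl, hzd⟩
  | succ n ih =>
    obtain _ | ⟨b, c⟩ := c
    · exact absurd hd id
    have hX := level_charted hx hx' (i + 2 + n)
    -- A direction tangent to the divisor kills `x_a`. It therefore lies outside the chart with
    -- letter `a`, and in the other chart its new coordinate is zero.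
    have key : ∀ {b : Fin 2} {p : S K x (i + 2 + n + 1)}, p ∈ (level K x (i + 2 + n + 1)).dom (b :: c) →
        p ∈ prolongedDivisor K x i (n + 1) → ∃ a w, c = twigWord (n + 1) w a ∧ b = opp a ∧
          (level K x (i + 2 + n)).dirAct (opp a :: c) a p = 0 := by
      intro b p hd hp
      obtain ⟨a, w, rfl, -, hD⟩ := ih hd.1 hp.1
      have h1 := (hD _ (Dir.vec_mem (X := level K x (i + 2 + n)) p)).1 hp.2
      refine ⟨a, w, rfl, (eq_or_eq_opp a b).resolve_left ?_, ?_⟩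
      · rintro rfl
        exact hd.2 h1
      · exact (dirAct_of_opp (X := level K x (i + 2 + n)) p).trans (by rw [h1, zero_div])
    obtain ⟨a, w, rfl, rfl, h0⟩ := key hd hp
    refine ⟨a, w, rfl, h0, fun D hD => hX.isTangentTo_zero_section (Z := prolongedDivisor K x i n)
      (fun z hz hzd => ?_) (fun q hq hqd => ?_) hp hd hp.2 hD⟩
    · obtain ⟨a', w', h1, h2, h3⟩ := key hzd hz
      obtain rfl := (twigWord_inj h1 (Or.inl rfl)).1
      exact h3
    · obtain ⟨z, rfl, hzd, hz⟩ := exists_dir_level hx hx' hqd (opp a) 0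
      obtain ⟨a', w', h1, -, hD⟩ := ih hqd hq
      obtain rfl := (twigWord_inj h1 (Or.inl rfl)).1
      rw [opp_opp] at hz
      refine ⟨z, ⟨hq, (hD _ (Dir.vec_mem (X := level K x (i + 2 + n)) z)).2 ?_⟩, rfl, hzd⟩
      have h4 := dirAct_of_opp (X := level K x (i + 2 + n)) (a := a) (w := twigWord (n + 1) w a) z
      exact (div_eq_zero_iff.1 (h4.symm.trans hz)).resolve_right hzd.2

lemma mem_prolongedDivisor_succ {i n : ℕ} {a : Fin 2} {w : List (Fin 2)}
    {p : S K x (i + 2 + n + 1)}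
    (hd : p ∈ (level K x (i + 2 + n + 1)).dom (twigWord (n + 2) w a))
    (hp : proj x p ∈ prolongedDivisor K x i n)
    (h : (level K x (i + 2 + n + 1)).act (twigWord (n + 2) w a) a p = 0) :
    p ∈ prolongedDivisor K x i (n + 1) := by
  obtain ⟨a', w', h1, -, hD⟩ := prolongedDivisor_chart hx hx' hd.1 hp
  have h2 : twigWord (n + 1) w a = twigWord (n + 1) w' a' := h1
  obtain rfl := (twigWord_inj h2 (Or.inl rfl)).1
  refine ⟨hp, (hD _ (Dir.vec_mem (X := level K x (i + 2 + n)) p)).2 ?_⟩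
  have h4 := dirAct_of_opp (X := level K x (i + 2 + n)) (a := a) (w := twigWord (n + 1) w a) p
  exact (div_eq_zero_iff.1 (h4.symm.trans h)).resolve_right hd.2

lemma axis_subset_prolongedDivisor {o : A →ₐ[K] K} {i m : ℕ} {w : List (Fin 2)} {a : Fin 2}
    {p : S K x (i + 2 + m)} (hp : p ∈ axis x o (i + 2 + m) (twigWord (m + 1) w a) a) :
    p ∈ prolongedDivisor K x i m := by
  induction m with
  | zero =>
    exact (mem_divisorAtInfinity_iff hx hx' (axis_subset_dom hp)).2 ⟨rfl, hp.2.2⟩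
  | succ m ih =>
    exact mem_prolongedDivisor_succ hx hx' (axis_subset_dom hp) (ih (proj_mem_axis hp)) hp.2.2

end Divisors

/-! ### The code word of a point -/

section Code

variable {K : Type u} [Field K] {A : Type v} [CommRing A] [Algebra K A] {x : Fin 2 → A}

lemma LiesOver.le {k m : ℕ} {p : S K x k} {q : S K x m} (h : LiesOver x p q) : m ≤ k := by
  induction h with
  | refl => exact le_rfl
  | step _ _ _ ih => exact ih.trans (Nat.le_succ _)

lemma LiesOver.eq {k : ℕ} {p q : S K x k} (h : LiesOver x p q) : p = q := by
  cases h with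
  | refl => rfl
  | step _ _ h => exact absurd h.le (Nat.not_succ_le_self _)

lemma liesOver_proj_iff {k m : ℕ} (hm : m ≤ k) {p : S K x (k + 1)} {q : S K x m} :
    LiesOver x p q ↔ LiesOver x (proj x p) q := by
  refine ⟨fun h => ?_, .step p q⟩
  cases h with
  | refl => exact absurd hm (Nat.not_succ_le_self _)
  | step _ _ h => exact h

/-- The point `p` lies over the prolongation `I_{i + 2}[n]` of a divisor at infinity. -/
def OverDivisor (x : Fin 2 → A) {k : ℕ} (p : S K x k) (i n : ℕ) : Prop :=
  ∃ q ∈ prolongedDivisor K x i n, LiesOver x p q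

/-- The point `p` lies on some prolongation of the divisor at infinity `I_{i + 2}`. -/
def OnDivisor (x : Fin 2 → A) {k : ℕ} (p : S K x k) (i : ℕ) : Prop :=
  ∃ n, k = i + 2 + n ∧ OverDivisor x p i n

lemma OverDivisor.le {k i n : ℕ} {p : S K x k} (h : OverDivisor x p i n) : i + 2 + n ≤ k := by
  obtain ⟨q, -, hq⟩ := h
  exact hq.le

lemma overDivisor_iff_mem {i n : ℕ} {p : S K x (i + 2 + n)} :
    OverDivisor x p i n ↔ p ∈ prolongedDivisor K x i n :=
  ⟨fun ⟨_, hq, h⟩ => h.eq ▸ hq, fun h => ⟨p, h, .refl p⟩⟩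

lemma overDivisor_proj_iff {k i n : ℕ} {p : S K x (k + 1)} (h : i + 2 + n ≤ k) :
    OverDivisor x p i n ↔ OverDivisor x (proj x p) i n :=
  exists_congr fun _ => and_congr_right fun _ => liesOver_proj_iff h

lemma OverDivisor.proj {k i n : ℕ} {p : S K x (k + 1)} (h : OverDivisor x p i (n + 1))
    (hk : k + 1 = i + 2 + (n + 1)) : OverDivisor x (proj x p) i n := by
  obtain rfl : k = i + 2 + n := by omega
  exact overDivisor_iff_mem.2 (overDivisor_iff_mem.1 h).1

open scoped Classical in
/-- The last symbol of the code word of the stratum of `p`. -/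
noncomputable def lastSymbol (x : Fin 2 → A) {k : ℕ} (p : S K x k) : Option ℕ :=
  if h : ∃ i, OnDivisor x p i then some (h.choose + 2) else none

/-- The code word of the stratum of `p`. -/
noncomputable def code (x : Fin 2 → A) : (k : ℕ) → S K x k → List (Option ℕ)
  | 0, _ => []
  | k + 1, p => code x k (proj x p) ++ [lastSymbol x p]

lemma length_code {k : ℕ} (p : S K x k) : (code x k p).length = k := by
  induction k with
  | zero => rfl
  | succ k ih => simp [code, ih]

variable [CharZero K] [IsAlgClosed K] [Algebra.FiniteType K A]
    (hx : LinearIndependent A (fun i => KaehlerDifferential.D K A (x i)))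
    (hx' : Submodule.span A (Set.range (fun i => KaehlerDifferential.D K A (x i))) = ⊤)
include hx hx'

lemma OverDivisor.chart {k i n : ℕ} {p : S K x k} (h : OverDivisor x p i n) (hk : k = i + 2 + n)
    {c : List (Fin 2)} (hc : p ∈ (level K x k).dom c) :
    ∃ a w, c = twigWord (n + 1) w a ∧ (level K x k).act c a p = 0 := by
  subst hk
  obtain ⟨a, w, h1, h2, -⟩ := prolongedDivisor_chart hx hx' hc (overDivisor_iff_mem.1 h)
  exact ⟨a, w, h1, h2⟩

/-- A twig which has been prolonged at least once lies on a prolongation of a divisor at infinity. -/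
lemma overDivisor_of_mem_axis {o : A →ₐ[K] K} {k i m : ℕ} (hk : k = i + 2 + m) {w : List (Fin 2)}
    {a : Fin 2} {p : S K x k} (hp : p ∈ axis x o k (twigWord (m + 1) w a) a) :
    OverDivisor x p i m := by
  subst hk
  exact overDivisor_iff_mem.2 (axis_subset_prolongedDivisor hx hx' hp)

/-- The chart word of a point of `I_{i+2}[n]` ends in a run of exactly `n + 1` equal letters. So the
chart determines `n`, and the level then determines `i`. -/
lemma OnDivisor.unique {k i i' : ℕ} {p : S K x k} (h : OnDivisor x p i) (h' : OnDivisor x p i') :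
    i = i' := by
  obtain ⟨n, hk, hn⟩ := h
  obtain ⟨n', hk', hn'⟩ := h'
  obtain ⟨c, hc⟩ := (level_charted hx hx' k).cover p
  obtain ⟨a, w, rfl, -⟩ := hn.chart hx hx' hk hc
  obtain ⟨a', w', h1, -⟩ := hn'.chart hx hx' hk' hc
  have := (twigWord_inj h1 (Or.inr ⟨by omega, by omega⟩)).2
  omega

lemma lastSymbol_eq_iff {k i : ℕ} {p : S K x k} :
    lastSymbol x p = some (i + 2) ↔ OnDivisor x p i := by
  unfold lastSymbol
  split_ifs with h
  · rw [Option.some_inj, Nat.add_right_cancel_iff]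
    refine ⟨fun h1 => h1 ▸ h.choose_spec, fun h1 => h.choose_spec.unique hx hx' h1⟩
  · exact ⟨fun h1 => absurd h1 (by simp), fun h1 => absurd ⟨i, h1⟩ h⟩

omit [CharZero K] [IsAlgClosed K] [Algebra.FiniteType K A] hx hx' in
lemma lastSymbol_eq_none_or {k : ℕ} (p : S K x k) :
    lastSymbol x p = none ∨ ∃ i, lastSymbol x p = some (i + 2) := by
  unfold lastSymbol
  split_ifs with h
  exacts [Or.inr ⟨_, rfl⟩, Or.inl rfl]

/-- A point of a prolonged divisor projects to the previous prolongation. The symbol `V_{i+2}`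
therefore fills consecutive positions starting at `i + 2`, and their number tells how far the
prolongation is followed. -/
lemma overDivisor_iff_count {k i n : ℕ} {p : S K x k} :
    OverDivisor x p i n ↔ n + 1 ≤ (code x k p).count (some (i + 2)) := by
  induction k generalizing n with
  | zero =>
    refine ⟨fun h => absurd h.le (by omega), fun h => absurd h (by simp [code])⟩
  | succ k ih =>
    have hcount : (code x (k + 1) p).count (some (i + 2)) =
        (code x k (proj x p)).count (some (i + 2)) +
          [lastSymbol x p].count (some (i + 2)) := List.count_append
    rw [hcount]
    set c := (code x k (proj x p)).count (some (i + 2)) with hc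
    -- A run of `c > 0` symbols starting at position `i + 2` ends at position `i + 1 + c`.
    have hck : c = 0 ∨ i + 1 + c ≤ k := by
      obtain _ | d := c
      · exact Or.inl rfl
      · have := ((ih (p := proj x p) (n := d)).2 hc.le).le
        omega
    by_cases hs : OnDivisor x p i
    · rw [(lastSymbol_eq_iff hx hx').2 hs, List.count_singleton_self]
      obtain ⟨n₀, hk, hn₀⟩ := hs
      have h1 : n₀ ≤ c := by
        obtain _ | m := n₀
        · exact Nat.zero_le _
        · exact ih.1 (hn₀.proj hk)
      obtain rfl : n₀ = c := by omega
      by_cases hnk : i + 2 + n ≤ k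
      · rw [overDivisor_proj_iff hnk, ih]
        omega
      · refine ⟨fun h => ?_, fun h => ?_⟩
        · have := h.le
          omega
        · obtain rfl : n = c := by omega
          exact hn₀
    · rw [List.count_singleton, if_neg (by simpa using fun h => hs ((lastSymbol_eq_iff hx hx').1 h)),
        add_zero]
      by_cases hnk : i + 2 + n ≤ k
      · rw [overDivisor_proj_iff hnk, ih]
      · refine iff_of_false (fun h => hs ⟨n, ?_, h⟩) ?_
        · have := h.le
          omega
        · omega

end Code

/-! ### Combinatorics of code words -/

section CodeWords

lemma isCodeWord_snoc {W : List (Option ℕ)} {b : Option ℕ} : IsCodeWord (W ++ [b]) ↔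
    IsCodeWord W ∧ (W = [] → b = none) ∧
      ∀ a, W.getLast? = some a → b = none ∨ b = some (W.length + 1) ∨ b = a := by
  constructor
  · rintro ⟨h1, h2⟩
    refine ⟨⟨fun a ha => h1 a ?_, fun i a c ha hc => h2 i a c ?_ ?_⟩, ?_, fun a ha => ?_⟩
    · rw [List.getElem?_append_left (List.getElem?_eq_some_iff.1 ha).1, ha]
    · rw [List.getElem?_append_left (List.getElem?_eq_some_iff.1 ha).1, ha]
    · rw [List.getElem?_append_left (List.getElem?_eq_some_iff.1 hc).1, hc]
    · rintro rfl
      exact h1 b rfl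
    · rw [List.getLast?_eq_getElem?] at ha
      have hl := (List.getElem?_eq_some_iff.1 ha).1
      have h3 := h2 (W.length - 1) a b (by rw [List.getElem?_append_left hl, ha])
        (by rw [Nat.sub_add_cancel (by omega)]; simp)
      rwa [show W.length - 1 + 2 = W.length + 1 by omega] at h3
  · rintro ⟨⟨h1, h2⟩, h3, h4⟩
    refine ⟨fun a ha => ?_, fun i a c ha hc => ?_⟩
    · obtain rfl | hW := W.eq_nil_or_concat
      · simp only [List.nil_append, List.getElem?_cons_zero, Option.some_inj] at ha
        exact ha ▸ h3 rfl
      · refine h1 a ?_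
        rwa [List.getElem?_append_left] at ha
        obtain ⟨L, c, rfl⟩ := hW
        simp
    · have hi := (List.getElem?_eq_some_iff.1 hc).1
      rw [List.length_append, List.length_singleton] at hi
      rw [List.getElem?_append_left (by omega)] at ha
      by_cases hi' : i + 1 < W.length
      · rw [List.getElem?_append_left hi'] at hc
        exact h2 i a c ha hc
      · have hW : W.length = i + 1 := by omega
        rw [← hW, List.getElem?_concat_length, Option.some_inj] at hc
        subst hc
        have := h4 a (by rw [List.getLast?_eq_getElem?, hW, Nat.add_sub_cancel, ha])
        rwa [hW] at this

lemma IsCodeWord.symbol {W : List (Option ℕ)} (hW : IsCodeWord W) :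
    ∀ a ∈ W, a = none ∨ ∃ i, a = some (i + 2) := by
  induction W using List.reverseRecOn with
  | nil => simp
  | append_singleton W b ih =>
    obtain ⟨h1, h2, h3⟩ := isCodeWord_snoc.1 hW
    intro a ha
    obtain ha | ha := List.mem_append.1 ha
    · exact ih h1 a ha
    obtain rfl := List.mem_singleton.1 ha
    obtain rfl | hne := eq_or_ne W []
    · exact Or.inl (h2 rfl)
    have hl := List.length_pos_iff.2 hne
    obtain h | h | h := h3 _ (List.getLast?_eq_some_getLast hne)
    · exact Or.inl h
    · exact Or.inr ⟨W.length - 1, h.trans (congrArg some (by omega))⟩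
    · exact h ▸ ih h1 _ (List.getLast_mem hne)

/-- The last symbol of a code word is determined by the numbers of occurrences of the symbols. -/
lemma IsCodeWord.getLast?_eq_iff {W : List (Option ℕ)} (hW : IsCodeWord W) (i : ℕ) :
    (W.getLast? = some (some (i + 2)) ↔
      0 < W.count (some (i + 2)) ∧ i + 1 + W.count (some (i + 2)) = W.length) ∧
    (W.count (some (i + 2)) = 0 ∨ i + 1 + W.count (some (i + 2)) ≤ W.length) := by
  -- The symbols `V_{i+2}` form one block starting at position `i + 2`. The last symbol belongs to
  -- this block exactly when the block is nonempty and reaches the end of the word.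
  induction W using List.reverseRecOn with
  | nil => simp
  | append_singleton W b ih =>
    obtain ⟨h1, h2, h3⟩ := isCodeWord_snoc.1 hW
    obtain ⟨h4, h5⟩ := ih h1
    rw [List.getLast?_concat, Option.some_inj, List.count_append, List.length_append,
      List.length_singleton, List.count_singleton]
    by_cases hb : b = some (i + 2)
    · have hc : i + 1 + W.count (some (i + 2)) = W.length := by
        obtain rfl | hne := eq_or_ne W []
        · exact absurd (h2 rfl) (by simp [hb])
        obtain h | h | h := h3 _ (List.getLast?_eq_some_getLast hne)
        · simp [hb] at h
        · rw [hb, Option.some_inj] at h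
          omega
        · rw [List.getLast?_eq_some_getLast hne, ← h, hb] at h4
          exact (h4.1 rfl).2
      rw [if_pos (by simp [hb])]
      refine ⟨iff_of_true hb ?_, ?_⟩ <;> omega
    · rw [if_neg (by simpa using hb)]
      refine ⟨iff_of_false hb ?_, ?_⟩ <;> omega

/-- A code word is determined by the numbers of occurrences of its symbols and its length. -/
lemma IsCodeWord.ext {W W' : List (Option ℕ)} (hW : IsCodeWord W) (hW' : IsCodeWord W')
    (hl : W.length = W'.length) (h : ∀ i, W.count (some (i + 2)) = W'.count (some (i + 2))) :
    W = W' := by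
  induction W using List.reverseRecOn generalizing W' with
  | nil => exact (List.length_eq_zero_iff.1 hl.symm).symm
  | append_singleton W b ih =>
    obtain rfl | ⟨W', b', rfl⟩ := W'.eq_nil_or_concat'
    · simp at hl
    have h1 : ∀ i, b = some (i + 2) ↔ b' = some (i + 2) := fun i => by
      have h2 := (hW.getLast?_eq_iff i).1
      have h3 := (hW'.getLast?_eq_iff i).1
      rw [List.getLast?_concat, Option.some_inj] at h2 h3
      rw [h2, h3, h, hl]
    have hb : b = b' := by
      obtain h2 | ⟨i, h2⟩ := hW.symbol b (by simp)
      · obtain h3 | ⟨i, h3⟩ := hW'.symbol b' (by simp)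
        · rw [h2, h3]
        · rw [h3, (h1 i).2 h3]
      · rw [h2, (h1 i).1 h2]
    subst hb
    rw [ih (isCodeWord_snoc.1 hW).1 (isCodeWord_snoc.1 hW').1 (by simpa using hl) fun i => by
      simpa [List.count_append] using h i]

/-- The symbols of a code word other than `R` have subscript at least two, so the counts appearing
in intersection loci control all of them. -/
lemma IsCodeWord.subperm {W W' : List (Option ℕ)} (hW : IsCodeWord W)
    (h : ∀ i, W.count (some (i + 2)) ≤ W'.count (some (i + 2))) :
    (W.filter Option.isSome).Subperm (W'.filter Option.isSome) := by
  refine List.subperm_ext_iff.2 fun a ha => ?_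
  rw [List.mem_filter] at ha
  rw [List.count_filter ha.2, List.count_filter ha.2]
  obtain rfl | ⟨i, rfl⟩ := hW.symbol a ha.1
  · simp at ha
  · exact h i

/-- A code word with fewer occurrences of each symbol has smaller codimension, unless it is the same. -/
lemma IsCodeWord.codim_lt {W W' : List (Option ℕ)} (hW : IsCodeWord W) (hW' : IsCodeWord W')
    (hl : W.length = W'.length) (h : ∀ i, W.count (some (i + 2)) ≤ W'.count (some (i + 2)))
    (hne : W ≠ W') : codim W < codim W' := by
  have h1 := hW.subperm h
  refine lt_of_not_ge fun h2 => hne (hW.ext hW' hl fun i => ?_)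
  rw [codim, codim, List.countP_eq_length_filter, List.countP_eq_length_filter] at h2
  have h3 := (h1.perm_of_length_le h2).count_eq (some (i + 2))
  rwa [List.count_filter rfl, List.count_filter rfl] at h3

lemma IsCodeWord.codim_le {W W' : List (Option ℕ)} (hW : IsCodeWord W)
    (h : ∀ i, W.count (some (i + 2)) ≤ W'.count (some (i + 2))) : codim W ≤ codim W' := by
  rw [codim, codim, List.countP_eq_length_filter, List.countP_eq_length_filter]
  exact (hW.subperm h).length_le

end CodeWords

/-! ### Strata of nodes and twigs -/

section Strata

variable {K : Type u} [Field K] {A : Type v} [CommRing A] [Algebra K A] {x : Fin 2 → A}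
  {o : A →ₐ[K] K} [CharZero K] [IsAlgClosed K] [Algebra.FiniteType K A]
    (hx : LinearIndependent A (fun i => KaehlerDifferential.D K A (x i)))
    (hx' : Submodule.span A (Set.range (fun i => KaehlerDifferential.D K A (x i))) = ⊤)
include hx hx'

/-- A point of `I_{i+2}` itself contributes the symbol whose subscript is its own position. A point
of a further prolongation projects to the same divisor and so repeats the preceding symbol. -/
lemma isCodeWord_code {k : ℕ} (p : S K x k) : IsCodeWord (code x k p) := by
  induction k with
  | zero => exact ⟨by simp [code], by simp [code]⟩
  | succ k ih =>
    refine isCodeWord_snoc.2 ⟨ih _, fun h => ?_, fun a ha => ?_⟩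
    · obtain h1 | ⟨i, h1⟩ := lastSymbol_eq_none_or p
      · exact h1
      · obtain ⟨n, hn, -⟩ := (lastSymbol_eq_iff hx hx').1 h1
        have h2 := length_code (proj x p)
        rw [h, List.length_nil] at h2
        omega
    · obtain h1 | ⟨i, h1⟩ := lastSymbol_eq_none_or p
      · exact Or.inl h1
      obtain ⟨n, hk, hn⟩ := (lastSymbol_eq_iff hx hx').1 h1
      rw [length_code, h1]
      obtain _ | n := n
      · exact Or.inr (Or.inl (congrArg some (by omega)))
      · have h2 := (lastSymbol_eq_iff hx hx').2 ⟨n, by omega, hn.proj hk⟩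
        obtain _ | k := k
        · omega
        · rw [code, List.getLast?_concat, h2, Option.some_inj] at ha
          exact Or.inr (Or.inr ha)

lemma mem_intersectionLocus_iff {k : ℕ} {W : List (Option ℕ)} {p : S K x k} :
    p ∈ intersectionLocus x k W ↔
      ∀ i, W.count (some (i + 2)) ≤ (code x k p).count (some (i + 2)) := by
  constructor
  · intro h i
    rcases hc : W.count (some (i + 2)) with _ | n
    · exact Nat.zero_le _
    · exact (overDivisor_iff_count hx hx').1 (h i n hc)
  · intro h i n hc
    exact (overDivisor_iff_count hx hx').2 (hc ▸ h i)

/-- The intersection loci through `p` are those of words whose counts are bounded by those of `code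
x k p`. A different code word with such counts has strictly smaller codimension, so minimality of
dimension singles out the code. -/
lemma inStratum_iff {k : ℕ} {W : List (Option ℕ)} {p : S K x k} :
    InStratum x k W p ↔ W = code x k p := by
  have hcode := isCodeWord_code hx hx' p
  constructor
  · rintro ⟨h1, h2, h3, h4⟩
    by_contra hne
    rw [mem_intersectionLocus_iff hx hx'] at h3
    exact h4 _ (length_code p) hcode
      (h2.codim_lt hcode (h1.trans (length_code p).symm) h3 hne)
      ((mem_intersectionLocus_iff hx hx').2 fun _ => le_rfl)
  · rintro rfl
    refine ⟨length_code p, hcode, (mem_intersectionLocus_iff hx hx').2 fun _ => le_rfl,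
      fun W' _ h2 h3 h4 => h3.not_ge (h2.codim_le ((mem_intersectionLocus_iff hx hx').1 h4))⟩

/-- Up to the level of the node the projections are those of the node. One level higher the nonzero
coordinate rules out every prolonged divisor. From then on the axis lies on the prolongations of the
divisor created next. -/
lemma code_of_mem_axis (ho : ∀ i, o (x i) = 0) {k m : ℕ} {w : List (Fin 2)} {a : Fin 2}
    {p : S K x k} (hk : k = w.length + 1 + m) {q : S K x w.length} (hq : q ∈ node x o w.length w)
    (hp : p ∈ axis x o k (twigWord m w a) a)
    (hne : (level K x k).act (twigWord m w a) (opp a) p ≠ 0) :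
    code x k p = code x w.length q ++ none :: List.replicate m (some (w.length + 2)) := by
  induction m generalizing k with
  | zero =>
    subst hk
    obtain rfl := (existsUnique_node hx hx' rfl).unique (proj_mem_node ho hp) hq
    have h : lastSymbol x p = none := by
      refine (lastSymbol_eq_none_or p).resolve_right ?_
      rintro ⟨i, hi⟩
      obtain ⟨n, hn, h1⟩ := (lastSymbol_eq_iff hx hx').1 hi
      obtain ⟨b, w', h2, h3⟩ := h1.chart hx hx' hn (axis_subset_dom hp)
      -- A prolonged divisor in a chart ending in `a` would require the coordinate with the letter
      -- opposite to `a` to vanish.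
      have h4 : a = opp b := (List.cons.inj h2).1
      rw [h4, opp_opp, ← h4] at hne
      exact hne h3
    exact congrArg (code x w.length (proj x p) ++ [·]) h
  | succ m ih =>
    subst hk
    have h1 : (level K x (w.length + 1 + m)).act (twigWord m w a) (opp a) (proj x p) ≠ 0 := by
      rw [← level_act_self]
      exact hne
    have h3 : lastSymbol x p = some (w.length + 2) := by
      refine (lastSymbol_eq_iff hx hx').2 ⟨m, by omega, ?_⟩
      exact overDivisor_of_mem_axis hx hx' (by omega) hp
    refine (congrArg₂ (fun L s => L ++ [s]) (ih rfl (proj_mem_axis hp) h1) h3).trans ?_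
    rw [List.replicate_succ', ← List.cons_append, ← List.append_assoc]

variable (ho : ∀ i, o (x i) = 0)
include ho

lemma code_of_mem_twigSet {k m : ℕ} {w : List (Fin 2)} {p : S K x k} (hp : p ∈ twigSet x o k m w)
    {q : S K x w.length} (hq : q ∈ node x o w.length w) (hne : ∀ w, p ∉ node x o k w) :
    code x k p = code x w.length q ++ none :: List.replicate m (some (w.length + 2)) := by
  have hk := length_of_mem_twigSet hp
  obtain ⟨a, ha⟩ := hp
  exact code_of_mem_axis hx hx' ho hk hq ha ((notMem_node_of_mem_axis ho ha).2 hne)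

omit ho in
lemma isNodeWord_iff {w : List (Fin 2)} {q : S K x w.length} (hq : q ∈ node x o w.length w)
    {W : List (Option ℕ)} : IsNodeWord x o w.length w W ↔ W = code x w.length q := by
  constructor
  · rintro ⟨p, hp, hW⟩
    obtain rfl := (existsUnique_node hx hx' rfl).unique hp hq
    exact (inStratum_iff hx hx').1 hW
  · rintro rfl
    exact ⟨q, hq, (inStratum_iff hx hx').2 rfl⟩

lemma isTwigWord_iff {k m : ℕ} {w : List (Fin 2)} (hk : k = w.length + 1 + m) {q : S K x w.length}
    (hq : q ∈ node x o w.length w) {W : List (Option ℕ)} :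
    IsTwigWord x o k (twigSet x o k m w) W ↔
      W = code x w.length q ++ none :: List.replicate m (some (w.length + 2)) := by
  have key : ∀ p ∈ twigSet x o k m w, (∀ w, p ∉ node x o k w) → (InStratum x k W p ↔
      W = code x w.length q ++ none :: List.replicate m (some (w.length + 2))) := fun p hp hne => by
    rw [inStratum_iff hx hx', code_of_mem_twigSet hx hx' ho hp hq hne]
  constructor
  · rintro ⟨⟨p, hp, hne⟩, h⟩
    exact (key p hp hne).1 (h p hp hne)
  · intro h
    obtain ⟨p, hp, hs⟩ := exists_mem_axis hx hx' ho hk 0 1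
    exact ⟨⟨p, ⟨0, hp⟩, (notMem_node_of_mem_axis ho hp).1 (hs ▸ one_ne_zero)⟩,
      fun p hp hne => (key p hp hne).2 h⟩

end Strata

theorem theorem6p3 {K : Type u} [Field K] [IsAlgClosed K] [CharZero K]
    {A : Type v} [CommRing A] [Algebra K A] [Algebra.Smooth K A] (x : Fin 2 → A)
    (hx : LinearIndependent A (fun i => KaehlerDifferential.D K A (x i)))
    (hx' : Submodule.span A (Set.range (fun i => KaehlerDifferential.D K A (x i))) = ⊤)
    (o : A →ₐ[K] K) (ho : ∀ i, o (x i) = 0)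
    (j k : ℕ) (hjk : j + 1 ≤ k) (w : List (Fin 2)) (hw : w.length = j) :
    (∃! p, p ∈ node x o j w) ∧
    (∃! W, IsNodeWord x o j w W) ∧
    (∃! Z, IsTwigWithLabel x o k Z w) ∧
    ∀ Z W, IsTwigWithLabel x o k Z w → IsNodeWord x o j w W →
      ∀ W', IsTwigWord x o k Z W' ↔
        W' = W ++ none :: List.replicate (k - 1 - j) (some (j + 2)) := by
  subst hw
  -- Here `m = k - 1 - j` counts the prolongations after the twig has emerged at level `j + 1`.
  obtain ⟨m, rfl⟩ := Nat.exists_eq_add_of_le hjk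
  obtain ⟨q, hq, hq'⟩ := existsUnique_node hx hx' (o := o) (w := w) rfl
  have hZ : ∀ Z, IsTwigWithLabel x o (w.length + 1 + m) Z w → Z = twigSet x o _ m w := by
    intro Z hZ
    obtain ⟨m', hm, rfl⟩ := eq_twigSet_of_isTwigWithLabel hx hx' ho hZ
    obtain rfl : m = m' := by omega
    rfl
  refine ⟨⟨q, hq, hq'⟩, ⟨_, (isNodeWord_iff hx hx' hq).2 rfl,
    fun W hW => (isNodeWord_iff hx hx' hq).1 hW⟩,
    ⟨_, isTwigWithLabel_twigSet hx hx' ho rfl, hZ⟩, fun Z W hZw hW W' => ?_⟩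
  obtain rfl := hZ Z hZw
  obtain rfl := (isNodeWord_iff hx hx' hq).1 hW
  rw [isTwigWord_iff hx hx' ho rfl hq, show w.length + 1 + m - 1 - w.length = m by omega]
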